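/- A \emph{PC prograph} is a finite connected directed plane graph without directed cycles whose vertices are coproducts (one input; a left and a right output) and products (a left and a right input; one output), drawn with the flow going upwards, in which exactly one coproduct has its input unconnected (the input of the prograph) and exactly one product has its output unconnected (the output of the prograph), both on the exterior face. Joining the output to the input by a virtual edge through the exterior gives a map on the sphere. Its dual, in which each edge is oriented from the left to the right of the prograph edge that it crosses and the dual of the virtual edge is the root, is a \emph{rooted oriented triangulation of the sphere}: a triangulation, with multiple edges allowed, oriented without directed cycles, with exactly one source and exactly one sink, and with a root edge from the source to the sink. This duality is a bijection between PC prographs and rooted oriented triangulations of the sphere, up to isomorphism. The type of a (non-virtual) edge of a PC prograph is given by the ports that it joins: from a left output of a coproduct, types I, II, III; from a right output of a coproduct, types IV, V, VI; from the output of a product, types VII, VIII, IX; in each triple the edge goes respectively to the input of a coproduct, the left input of a product, the right input of a product. The four \emph{rotation rules} replace two adjacent operators by two others with the same external connections, in the same left-to-right order: \begin{itemize} \item IV $\to$ I: a coproduct on the right output of a coproduct is moved to its left output; \item VIII $\to$ IX: a product on the left input of a product is moved to its right input; \item III $\to$ VII: a coproduct $x$ whose left output is the right input of a product $y$ is replaced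 by $x$ standing on the output of $y$; \item VII $\to$ V: a coproduct $x$ standing on the output of a product $y$ is replaced by $x$ whose right output is the left input of $y$. \end{itemize} A \emph{valid flip} of a non-root edge of a rooted oriented triangulation is possible when the two triangles at this edge form a quadrilateral with four distinct corners: it removes the edge and draws the other diagonal with some orientation, all other edges, their orientations and the root being kept, in such a way that the result is again a rooted oriented triangulation of the sphere. \textbf{Theorem.} Each rule applies, in exactly one way, at every non-virtual edge of its source type, and can be reversed, in exactly one way, at every non-virtual edge of its target type. Under duality, the four rotation rules and their reverses at an edge of a PC prograph correspond exactly to the valid flips of the dual edge: each rotation or reverse rotation gives a valid flip, the edge that it creates being dual to the new diagonal, and each valid flip arises in this way from exactly one rotation or reverse rotation. The non-virtual edges whose dual edge admits no valid flip are exactly those of types II and VI. -/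

import Mathlib

universe u

/-! ## Maps on the sphere as permutations -/

/-- Number of orbits of a permutation. -/
noncomputable def orbitCount {D : Type u} (f : Equiv.Perm D) : ℕ :=
  Nat.card (Quotient (Equiv.Perm.SameCycle.setoid f))

/-- Two permutations of a finite set of darts, `φ` (turning around the cells of one kind) and the
involution `α` (exchanging the two darts of an edge), describe a connected map embedded in the
sphere: the action is transitive and the Euler characteristic is `2`. The orbits of `φ`, of `α` and
of `α * φ⁻¹` are the cells of one kind, the edges, and the cells of the dual kind. -/
def IsSphereMap {D : Type u} (φ α : Equiv.Perm D) : Prop :=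
  (∀ x y : D, ∃ g ∈ Subgroup.closure {φ, α}, g x = y) ∧
    orbitCount φ + orbitCount (α * φ⁻¹) = orbitCount α + 2

/-! ## PC prographs -/

/-- Output ports: a coproduct has a left and a right output, a product has one output.
Here `C` is the set of coproducts and `Pr` the set of products. -/
inductive Out (C Pr : Type u) : Type u
  | left (c : C)
  | right (c : C)
  | prod (p : Pr)

/-- Input ports: a coproduct has one input, a product has a left and a right input. -/
inductive Inp (C Pr : Type u) : Type u
  | cop (c : C)
  | left (p : Pr)
  | right (p : Pr)

/-- All ports of the operators. -/
abbrev Port (C Pr : Type u) : Type u := Out C Pr ⊕ Inp C Pr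

/-- The operator that carries an output port. -/
def Out.owner {C Pr : Type u} : Out C Pr → C ⊕ Pr
  | .left c => .inl c
  | .right c => .inl c
  | .prod p => .inr p

/-- The operator that carries an input port. -/
def Inp.owner {C Pr : Type u} : Inp C Pr → C ⊕ Pr
  | .cop c => .inl c
  | .left p => .inr p
  | .right p => .inr p

/-- Relabelling of the operators. -/
def Out.map {C Pr C' Pr' : Type u} (f : C → C') (g : Pr → Pr') : Out C Pr → Out C' Pr'
  | .left c => .left (f c)
  | .right c => .right (f c)
  | .prod p => .prod (g p)

/-- Relabelling of the operators. -/
def Inp.map {C Pr C' Pr' : Type u} (f : C → C') (g : Pr → Pr') : Inp C Pr → Inp C' Pr'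
  | .cop c => .cop (f c)
  | .left p => .left (g p)
  | .right p => .right (g p)

/-- Turning counterclockwise around each operator, when the flow goes upwards:
`input → right output → left output → input` around a coproduct,
`output → left input → right input → output` around a product. -/
def Port.turn (C Pr : Type u) : Equiv.Perm (Port C Pr) where
  toFun
    | .inr (.cop c) => .inl (.right c)
    | .inl (.right c) => .inl (.left c)
    | .inl (.left c) => .inr (.cop c)
    | .inl (.prod p) => .inr (.left p)
    | .inr (.left p) => .inr (.right p)
    | .inr (.right p) => .inl (.prod p)
  invFun
    | .inl (.right c) => .inr (.cop c)
    | .inl (.left c) => .inl (.right c)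
    | .inr (.cop c) => .inl (.left c)
    | .inr (.left p) => .inl (.prod p)
    | .inr (.right p) => .inr (.left p)
    | .inl (.prod p) => .inr (.right p)
  left_inv := by rintro ((c | c | p) | (c | p | p)) <;> rfl
  right_inv := by rintro ((c | c | p) | (c | p | p)) <;> rfl

/-- The involution of the ports that exchanges the two ends of each edge. -/
def Port.wire {C Pr : Type u} (next : Out C Pr ≃ Inp C Pr) : Equiv.Perm (Port C Pr) where
  toFun
    | .inl q => .inr (next q)
    | .inr i => .inl (next.symm i)
  invFun
    | .inl q => .inr (next q)
    | .inr i => .inl (next.symm i)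
  left_inv := by rintro (q | i) <;> simp
  right_inv := by rintro (q | i) <;> simp

/-- A PC prograph with set of coproducts `C` and set of products `Pr`. Its input (the unconnected
input of one coproduct) and its output (the unconnected output of one product `root`) are joined by
a virtual edge from the output to the input through the exterior face. Every edge, the virtual one
included, is recorded as the output port it leaves; `next` gives the input port it enters. -/
@[ext]
structure PCPrograph (C Pr : Type u) where
  next : Out C Pr ≃ Inp C Pr
  /-- the product whose output is the output of the prograph -/
  root : Pr
  finite_cop : Finite C
  finite_prod : Finite Pr
  /-- the virtual edge enters the input of a coproduct, the input of the prograph -/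
  root_next : ∃ c : C, next (.prod root) = .cop c
  /-- without the virtual edge, there is no directed cycle -/
  acyclic : ∀ o : C ⊕ Pr, ¬ Relation.TransGen
    (fun a b => ∃ q : Out C Pr, q ≠ .prod root ∧ q.owner = a ∧ (next q).owner = b) o o
  /-- the prograph is connected and, closed up by the virtual edge, drawn on the sphere with the
  prescribed cyclic order of the ports around each operator -/
  planar : IsSphereMap (Port.turn C Pr) (Port.wire next)

/-- The output port that feeds a given input port. -/
def PCPrograph.prev {C Pr : Type u} (P : PCPrograph C Pr) (i : Inp C Pr) : Out C Pr :=
  P.next.symm i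

/-- Isomorphism of PC prographs. -/
def PCPrograph.Isomorphic {C Pr C' Pr' : Type u} (P : PCPrograph C Pr) (Q : PCPrograph C' Pr') :
    Prop :=
  ∃ (f : C ≃ C') (g : Pr ≃ Pr'),
    (∀ q, Q.next (q.map f g) = (P.next q).map f g) ∧ Q.root = g P.root

/-- The nine types of edges. -/
inductive EdgeType
  | I | II | III | IV | V | VI | VII | VIII | IX

/-- The type of an edge, by the output port it leaves and the input port it enters. -/
def PCPrograph.edgeType {C Pr : Type u} (P : PCPrograph C Pr) (e : Out C Pr) : EdgeType :=
  match e, P.next e with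
  | .left _, .cop _ => .I
  | .left _, .left _ => .II
  | .left _, .right _ => .III
  | .right _, .cop _ => .IV
  | .right _, .left _ => .V
  | .right _, .right _ => .VI
  | .prod _, .cop _ => .VII
  | .prod _, .left _ => .VIII
  | .prod _, .right _ => .IX

/-- The four rotation rules. -/
inductive Rule
  | IVtoI | VIIItoIX | IIItoVII | VIItoV

/-- The type of the edge to which a rule applies. -/
def Rule.source : Rule → EdgeType
  | .IVtoI => .IV
  | .VIIItoIX => .VIII
  | .IIItoVII => .III
  | .VIItoV => .VII

/-- The type of the edge that a rule produces. -/
def Rule.target : Rule → EdgeType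
  | .IVtoI => .I
  | .VIIItoIX => .IX
  | .IIItoVII => .VII
  | .VIItoV => .V

/-- `Rotates r P e P' e'`: the rule `r` applied at the edge `e` of `P` gives `P'`, and `e'` is the
edge of `P'` between the two operators involved. The two operators keep their names; the
connections that are not mentioned, and the input and output of the prograph, do not change, and
neither `e` nor `e'` is the virtual edge. -/
def Rotates {C Pr : Type u} (r : Rule) (P : PCPrograph C Pr) (e : Out C Pr)
    (P' : PCPrograph C Pr) (e' : Out C Pr) : Prop :=
  P'.root = P.root ∧ e ≠ .prod P.root ∧ e' ≠ .prod P'.root ∧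
  match r with
  | .IVtoI =>
      -- coproduct `y` on the right output of `x` becomes `y` on the left output of `x`;
      -- the three upper branches keep their order from left to right
      ∃ x y : C, e = .right x ∧ e' = .left x ∧ P.next (.right x) = .cop y ∧
        P'.next (.left x) = .cop y ∧
        P'.next (.left y) = P.next (.left x) ∧
        P'.next (.right y) = P.next (.left y) ∧
        P'.next (.right x) = P.next (.right y) ∧
        ∀ q, q ≠ .left x → q ≠ .right x → q ≠ .left y → q ≠ .right y → P'.next q = P.next q
  | .VIIItoIX =>
      -- product `z` below the left input of `y` becomes `z` below the right input of `y`;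
      -- the three lower branches keep their order from left to right
      ∃ y z : Pr, e = .prod z ∧ e' = .prod z ∧ P.prev (.left y) = .prod z ∧
        P'.prev (.right y) = .prod z ∧
        P'.prev (.left y) = P.prev (.left z) ∧
        P'.prev (.left z) = P.prev (.right z) ∧
        P'.prev (.right z) = P.prev (.right y) ∧
        ∀ i, i ≠ .left y → i ≠ .right y → i ≠ .left z → i ≠ .right z → P'.prev i = P.prev i
  | .IIItoVII =>
      -- the left output of the coproduct `x` is the right input of the product `y`; afterwards `x`
      -- stands on the output of `y`
      ∃ (x : C) (y : Pr), e = .left x ∧ e' = .prod y ∧ P.next (.left x) = .right y ∧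
        P'.next (.prod y) = .cop x ∧
        P'.next (P.prev (.cop x)) = .right y ∧
        P'.next (.left x) = P.next (.prod y) ∧
        ∀ q, q ≠ .prod y → q ≠ P.prev (.cop x) → q ≠ .left x → P'.next q = P.next q
  | .VIItoV =>
      -- the coproduct `x` stands on the output of the product `y`; afterwards the right output of
      -- `x` is the left input of `y`
      ∃ (x : C) (y : Pr), e = .prod y ∧ e' = .right x ∧ P.next (.prod y) = .cop x ∧
        P'.next (.right x) = .left y ∧
        P'.next (P.prev (.left y)) = .cop x ∧
        P'.next (.prod y) = P.next (.right x) ∧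
        ∀ q, q ≠ .right x → q ≠ P.prev (.left y) → q ≠ .prod y → P'.next q = P.next q

/-- `P'` (with its edge `e'`) is obtained from `P` (with its edge `e`) by one of the four rotations
or by the reverse of one of them. -/
def RotationStep {C Pr : Type u} (P : PCPrograph C Pr) (e : Out C Pr)
    (P' : PCPrograph C Pr) (e' : Out C Pr) : Prop :=
  ∃ r : Rule, Rotates r P e P' e' ∨ Rotates r P' e' P e

/-! ## Rooted oriented triangulations of the sphere -/

/-- The permutation turning counterclockwise around the vertices, when `face` sends a dart to the
next dart along the boundary of the face on its left, and `opp` reverses darts. -/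
def vertexPerm {D : Type u} (face opp : Equiv.Perm D) : Equiv.Perm D := opp * face⁻¹

/-- A rooted, bipolar-oriented triangulation of the sphere (multiple edges are allowed, loops are
excluded by acyclicity), as a combinatorial map on the set `D` of darts (oriented sides of edges).
Each dart has the face on its left. -/
structure Triangulation (D : Type u) where
  finite : Finite D
  /-- next dart along the boundary of the face on the left -/
  face : Equiv.Perm D
  /-- the same edge in the other direction -/
  opp : Equiv.Perm D
  opp_opp : ∀ d, opp (opp d) = d
  opp_ne : ∀ d, opp d ≠ d
  /-- each face is a triangle -/
  triangle : ∀ d, face (face (face d)) = d ∧ face d ≠ d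
  sphere : IsSphereMap face opp
  /-- the darts that follow the orientation of their edge -/
  pos : D → Prop
  pos_opp : ∀ d, pos (opp d) ↔ ¬ pos d
  /-- the root edge, directed from the source to the sink -/
  root : D
  pos_root : pos root
  /-- there is no directed cycle -/
  acyclic : ∀ v : Quotient (Equiv.Perm.SameCycle.setoid (vertexPerm face opp)),
    ¬ Relation.TransGen (fun a b => ∃ d, pos d ∧ Quotient.mk _ d = a ∧ Quotient.mk _ (opp d) = b)
      v v
  /-- the origin of the root is the only source -/
  source_iff : ∀ v : Quotient (Equiv.Perm.SameCycle.setoid (vertexPerm face opp)),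
    (∀ d, pos d → Quotient.mk _ (opp d) ≠ v) ↔ v = Quotient.mk _ root
  /-- the end of the root is the only sink -/
  sink_iff : ∀ v : Quotient (Equiv.Perm.SameCycle.setoid (vertexPerm face opp)),
    (∀ d, pos d → Quotient.mk _ d ≠ v) ↔ v = Quotient.mk _ (opp root)

/-- The vertices of a triangulation. -/
abbrev Triangulation.Vertex {D : Type u} (T : Triangulation D) : Type u :=
  Quotient (Equiv.Perm.SameCycle.setoid (vertexPerm T.face T.opp))

/-- The vertex from which a dart starts. -/
def Triangulation.origin {D : Type u} (T : Triangulation D) (d : D) : T.Vertex :=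
  Quotient.mk _ d

/-- Isomorphism of rooted oriented triangulations. -/
def Triangulation.Isomorphic {D D' : Type u} (T : Triangulation D) (T' : Triangulation D') :
    Prop :=
  ∃ g : D ≃ D', (∀ d, T'.face (g d) = g (T.face d)) ∧ (∀ d, T'.opp (g d) = g (T.opp d)) ∧
    (∀ d, T'.pos (g d) ↔ T.pos d) ∧ T'.root = g T.root

/-- `Flip T d T' d'`: the edge of the dart `d` of `T` is not the root edge, the two triangles that
it borders form a quadrilateral (with four distinct corners) of which it is a diagonal, and removing
it and drawing the other diagonal, with some orientation, gives (a copy of) the rooted oriented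
triangulation `T'`; all the other edges, their orientations and the root are kept, and `d'` is one
of the two darts of the new diagonal. -/
def Flip {D D' : Type u} (T : Triangulation D) (d : D) (T' : Triangulation D') (d' : D') : Prop :=
  d ≠ T.root ∧ d ≠ T.opp T.root ∧
  [T.origin d, T.origin (T.opp d), T.origin (T.face (T.face d)),
    T.origin (T.face (T.face (T.opp d)))].Nodup ∧
  ∃ g : D ≃ D',
    (d' = g d ∨ d' = g (T.opp d)) ∧
    (∀ x, T'.opp (g x) = g (T.opp x)) ∧
    T'.root = g T.root ∧
    (∀ x, x ≠ d → x ≠ T.opp d → (T'.pos (g x) ↔ T.pos x)) ∧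
    -- the two new triangles
    T'.face (g d) = g (T.face (T.face d)) ∧
    T'.face (g (T.face (T.face d))) = g (T.face (T.opp d)) ∧
    T'.face (g (T.face (T.opp d))) = g d ∧
    T'.face (g (T.opp d)) = g (T.face (T.face (T.opp d))) ∧
    T'.face (g (T.face (T.face (T.opp d)))) = g (T.face d) ∧
    T'.face (g (T.face d)) = g (T.opp d) ∧
    -- the other triangles
    ∀ x, x ≠ d → x ≠ T.face d → x ≠ T.face (T.face d) → x ≠ T.opp d → x ≠ T.face (T.opp d) →
      x ≠ T.face (T.face (T.opp d)) → T'.face (g x) = g (T.face x)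

/-! ## Duality -/

/-- `T` is the dual of `P`: the triangles of `T` are the operators of `P`, the sides of a triangle
are the ports of the operator in the same cyclic order, two triangles are glued along a side when
the corresponding ports are connected, each edge of `T` is oriented from the left to the right of
the edge of `P` that it crosses (so that the dart with the triangle of an operator on its left is
positive exactly at the inputs), and the root edge of `T` crosses the virtual edge of `P`. -/
structure Duality {C Pr D : Type u} (P : PCPrograph C Pr) (T : Triangulation D) where
  dart : Port C Pr ≃ D
  dart_turn : ∀ a, dart (Port.turn C Pr a) = T.face (dart a)
  dart_wire : ∀ a, dart (Port.wire P.next a) = T.opp (dart a)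
  pos_out : ∀ q, ¬ T.pos (dart (.inl q))
  pos_inp : ∀ i, T.pos (dart (.inr i))
  dart_root : dart (.inr (P.next (.prod P.root))) = T.root

/-! ### Orbits of permutations, and functions on the vertices of a map. -/

section Orbits

variable {D D' : Type*}

/-! A triangle whose boundary is not a directed cycle has either one positive and two negative
sides, a coproduct, or one negative and two positive sides, a product. Passing between ports and
darts is therefore mere renaming, and what duality has to prove is that the global conditions
correspond: acyclicity, and uniqueness of source and sink. The bridge is a homological form of the
Jordan curve theorem. By Euler's formula, an antisymmetric function on the darts of a sphere map is
an increment of a face function plus an increment of a vertex function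
(`IsSphereMap.exists_decomposition`), and the two parts are orthogonal. The flow along a directed
cycle is thus the increment of a potential on the dual cells, monotone along the orientation and not
constant (`exists_monotone_potential`). On the dual side such a potential is extremal at the input
and the output, or at the source and the sink, and the virtual or root edge between these forces it
to be constant. A second source or sink is excluded by turning around it: this would be a directed
cycle of operators.

A rotation is encoded by a permutation `ψ` of the ports that conjugates the new wires to the old
ones (`RuleData`, `rotates_iff`), and `ψ.symm` satisfies the equations of a flip. So every rotation
is a flip, and what remains is that its result is again a prograph. Except when the edge has type
VII, two sides of the quadrilateral form a directed path parallel to the new diagonal, and the other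
two conditions, no new source and no new sink, are also visible on the four sides
(`Relabelling.exists_prograph_of_signs`). At type VII there is no such path; there acyclicity is
checked on the prograph, by exchanging the two operators
(`Relabelling.exists_prograph_of_prod_cop`).

Conversely, a dual triangulation with `n` products has `n` inner vertices, and each of them is the
place of a passage from outgoing to incoming darts at some product; so the passage is unique
(`Duality.eq_of_pos_pos`), and likewise for coproducts. It follows that an edge of type II is the
only edge into its end and an edge of type VI the only edge out of its origin, and flipping it would
create a source or a sink. For the other types, the requirement that the two new triangles be
non-cyclic leaves exactly the orientations realised by a rule or its reverse. Only VII is both a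
source and a target type; its two outcomes differ because the new edge leaves a right output in one
and a left output in the other (`not_rotates_VII`). -/

theorem mk_apply_eq (f : Equiv.Perm D) (x : D) :
    (Quotient.mk (Equiv.Perm.SameCycle.setoid f) (f x)) = Quotient.mk _ x :=
  Quotient.sound (s := Equiv.Perm.SameCycle.setoid f)
    (Equiv.Perm.sameCycle_apply_left.2 (Equiv.Perm.SameCycle.refl f x))

theorem eq_of_sameCycle {f : Equiv.Perm D} {A : Type*} {F : D → A} (h : ∀ x, F (f x) = F x)
    {x y : D} (hxy : f.SameCycle x y) : F x = F y := by
  obtain ⟨i, rfl⟩ := hxy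
  have hinv : ∀ x, F (f⁻¹ x) = F x := fun x => by
    rw [← h (f⁻¹ x)]; simp
  induction i using Int.induction_on with
  | zero => simp
  | succ n ih => rw [add_comm, zpow_add, zpow_one, Equiv.Perm.mul_apply, h, ← ih]
  | pred n ih =>
    rw [sub_eq_neg_add, zpow_add, zpow_neg_one, Equiv.Perm.mul_apply, hinv, ← ih]

theorem exists_orbit_lift {f : Equiv.Perm D} {A : Type*} (F : D → A) (h : ∀ x, F (f x) = F x) :
    ∃ G : Quotient (Equiv.Perm.SameCycle.setoid f) → A, ∀ x, G (Quotient.mk _ x) = F x :=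
  ⟨Quotient.lift F fun _ _ hxy => eq_of_sameCycle h hxy, fun _ => rfl⟩

theorem vertexPerm_face (face opp : Equiv.Perm D) (y : D) :
    vertexPerm face opp (face y) = opp y := by
  simp [vertexPerm]

theorem mk_opp_eq (face opp : Equiv.Perm D) (y : D) :
    (Quotient.mk (Equiv.Perm.SameCycle.setoid (vertexPerm face opp)) (opp y)) =
      Quotient.mk _ (face y) := by
  rw [← vertexPerm_face face opp, mk_apply_eq]

theorem vertexPerm_invariant {face opp : Equiv.Perm D} {A : Type*} {F : D → A}
    (h : ∀ y, F (opp y) = F (face y)) (x : D) : F (vertexPerm face opp x) = F x := by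
  have := h (face⁻¹ x)
  simpa [vertexPerm] using this

/-- Turning around a vertex sends `face y` to `opp y`, so the condition is invariance under
`vertexPerm`. Vertex functions are handled in this form from here on. -/
theorem exists_vertex_lift {face opp : Equiv.Perm D} {A : Type*} (F : D → A)
    (h : ∀ y, F (opp y) = F (face y)) :
    ∃ G : Quotient (Equiv.Perm.SameCycle.setoid (vertexPerm face opp)) → A,
      ∀ x, G (Quotient.mk _ x) = F x :=
  exists_orbit_lift F (vertexPerm_invariant h)

theorem orbitCount_congr {D D' : Type u} {f : Equiv.Perm D} {f' : Equiv.Perm D'} (e : D ≃ D')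
    (h : ∀ x, e (f x) = f' (e x)) : orbitCount f = orbitCount f' := by
  obtain ⟨G, hG⟩ := exists_orbit_lift (f := f)
    (fun x => Quotient.mk (Equiv.Perm.SameCycle.setoid f') (e x))
    (fun x => by rw [h]; exact mk_apply_eq f' _)
  obtain ⟨H, hH⟩ := exists_orbit_lift (f := f')
    (fun x => Quotient.mk (Equiv.Perm.SameCycle.setoid f) (e.symm x))
    (fun x => by
      have : e.symm (f' x) = f (e.symm x) := by rw [Equiv.symm_apply_eq, h]; simp
      rw [this]; exact mk_apply_eq f _)
  refine Nat.card_congr ⟨G, H, ?_, ?_⟩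
  · intro q; induction q using Quotient.inductionOn; rw [hG, hH]; simp
  · intro q; induction q using Quotient.inductionOn; rw [hH, hG]; simp

/-- Transitivity of the group generated by two permutations, in terms of functions. -/
theorem transitive_iff (φ α : Equiv.Perm D) :
    (∀ x y : D, ∃ g ∈ Subgroup.closure {φ, α}, g x = y) ↔
      ∀ p : D → Prop, (∀ x, p (φ x) ↔ p x) → (∀ x, p (α x) ↔ p x) → ∀ x y, p x → p y := by
  constructor
  · intro h p h1 h2 x y hx
    obtain ⟨g, hg, rfl⟩ := h x y
    have : ∀ x, p (g x) ↔ p x := by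
      induction hg using Subgroup.closure_induction with
      | mem g hg => rcases hg with rfl | rfl <;> assumption
      | one => simp
      | mul a b _ _ ha hb => intro x; rw [Equiv.Perm.mul_apply, ha, hb]
      | inv a _ ha => intro x; rw [← ha (a⁻¹ x)]; simp
    exact (this x).2 hx
  · intro h x y
    refine h (fun y => ∃ g ∈ Subgroup.closure {φ, α}, g x = y) ?_ ?_ x y
      ⟨1, Subgroup.one_mem _, rfl⟩
    all_goals
      intro z
      constructor
      · rintro ⟨g, hg, h⟩
        refine ⟨_⁻¹ * g, Subgroup.mul_mem _ (Subgroup.inv_mem _ (Subgroup.subset_closure ?_)) hg,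
          by rw [Equiv.Perm.mul_apply, h]; exact Equiv.symm_apply_apply _ z⟩
        simp
      · rintro ⟨g, hg, rfl⟩
        refine ⟨_ * g, Subgroup.mul_mem _ (Subgroup.subset_closure ?_) hg, rfl⟩
        simp

theorem IsSphereMap.congr {D D' : Type u} {φ α : Equiv.Perm D} {φ' α' : Equiv.Perm D'}
    (e : D ≃ D') (hφ : ∀ x, e (φ x) = φ' (e x)) (hα : ∀ x, e (α x) = α' (e x))
    (h : IsSphereMap φ α) : IsSphereMap φ' α' := by
  obtain ⟨h1, h2⟩ := h
  have hφi : ∀ x, e (φ⁻¹ x) = φ'⁻¹ (e x) := fun x => by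
    rw [Equiv.Perm.eq_inv_iff_eq, ← hφ]; simp
  constructor
  · rw [transitive_iff] at h1 ⊢
    intro p hp1 hp2 x y hx
    have := h1 (fun d => p (e d)) (fun d => by rw [hφ, hp1]) (fun d => by rw [hα, hp2])
      (e.symm x) (e.symm y) (by simpa using hx)
    simpa using this
  · rw [← orbitCount_congr e hφ, ← orbitCount_congr e hα,
      ← orbitCount_congr (f := α * φ⁻¹) e (fun x => by
        rw [Equiv.Perm.mul_apply, Equiv.Perm.mul_apply, hα, hφi]), h2]

end Orbits

/-! ### Rational cochains on a sphere map. -/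

section Cochains

variable {D : Type u}

/-- Functions constant on the orbits of a permutation. -/
def invariantFunctions (f : Equiv.Perm D) : Submodule ℚ (D → ℚ) where
  carrier := {h | ∀ x, h (f x) = h x}
  add_mem' ha hb x := by simp [ha x, hb x]
  zero_mem' x := rfl
  smul_mem' c h hh x := by simp [hh x]

/-- Functions changing sign under an involution. -/
def antisymmetricFunctions (α : Equiv.Perm D) : Submodule ℚ (D → ℚ) where
  carrier := {h | ∀ x, h (α x) = - h x}
  add_mem' ha hb x := by simp [ha x, hb x]; ring
  zero_mem' x := by simp
  smul_mem' c h hh x := by simp [hh x]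

/-- The increment of a function along the darts. -/
def increment (α : Equiv.Perm D) : (D → ℚ) →ₗ[ℚ] (D → ℚ) where
  toFun h x := h (α x) - h x
  map_add' f g := by ext x; simp; ring
  map_smul' c f := by ext x; simp; ring

theorem orbitCount_le_finrank [Finite D] (f : Equiv.Perm D) :
    orbitCount f ≤ Module.finrank ℚ (invariantFunctions f) := by
  have : Fintype (Quotient (Equiv.Perm.SameCycle.setoid f)) := Fintype.ofFinite _
  let L : (Quotient (Equiv.Perm.SameCycle.setoid f) → ℚ) →ₗ[ℚ] invariantFunctions f :=
    { toFun := fun h => ⟨fun x => h (Quotient.mk _ x), fun x => congrArg h (mk_apply_eq f x)⟩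
      map_add' := fun _ _ => rfl
      map_smul' := fun _ _ => rfl }
  have hL : Function.Injective L := by
    intro h h' hh
    ext q
    induction q using Quotient.inductionOn with
    | h x => exact congrFun (congrArg Subtype.val hh) x
  have := LinearMap.finrank_le_finrank_of_injective hL
  rwa [Module.finrank_fintype_fun_eq_card, ← Nat.card_eq_fintype_card] at this

/-- One value in each orbit of `α` determines an antisymmetric function. -/
theorem finrank_antisymmetric_le [Finite D] (α : Equiv.Perm D) :
    Module.finrank ℚ (antisymmetricFunctions α) ≤ orbitCount α := by
  have : Fintype (Quotient (Equiv.Perm.SameCycle.setoid α)) := Fintype.ofFinite _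
  let L : antisymmetricFunctions α →ₗ[ℚ] (Quotient (Equiv.Perm.SameCycle.setoid α) → ℚ) :=
    { toFun := fun h q => h.1 q.out
      map_add' := fun _ _ => rfl
      map_smul' := fun _ _ => rfl }
  have hL : Function.Injective L := by
    rw [← LinearMap.ker_eq_bot, LinearMap.ker_eq_bot']
    rintro ⟨h, hh⟩ h0
    ext x
    have hx : h (Quotient.mk (Equiv.Perm.SameCycle.setoid α) x).out = 0 :=
      congrFun h0 (Quotient.mk (Equiv.Perm.SameCycle.setoid α) x)
    have hs : α.SameCycle (Quotient.mk (Equiv.Perm.SameCycle.setoid α) x).out x :=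
      Quotient.mk_out (s := Equiv.Perm.SameCycle.setoid α) x
    -- The values change sign along an orbit, but their vanishing is constant on it.
    have := eq_of_sameCycle (F := fun x => h x = 0)
      (fun x => by have := hh x; simp [this]) hs
    exact this.mp hx
  have := LinearMap.finrank_le_finrank_of_injective hL
  rwa [Module.finrank_fintype_fun_eq_card, ← Nat.card_eq_fintype_card] at this

/-- By connectedness, an invariant function with zero increment is constant; this kernel accounts
for the `+ 1`. -/
theorem finrank_map_increment [Finite D] [Nonempty D] (f α : Equiv.Perm D)
    (hc : ∀ h : D → ℚ, (∀ x, h (f x) = h x) → (∀ x, h (α x) = h x) → ∀ x y, h x = h y) :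
    orbitCount f ≤ Module.finrank ℚ ((invariantFunctions f).map (increment α)) + 1 := by
  let L := (increment α).domRestrict (invariantFunctions f)
  have h1 := LinearMap.finrank_range_add_finrank_ker L
  have h2 : LinearMap.range L = (invariantFunctions f).map (increment α) := by
    rw [← LinearMap.range_domRestrict]
  have h3 : Module.finrank ℚ (LinearMap.ker L) ≤ 1 := by
    obtain ⟨d⟩ := ‹Nonempty D›
    let E : LinearMap.ker L →ₗ[ℚ] ℚ :=
      { toFun := fun h => h.1.1 d
        map_add' := fun _ _ => rfl
        map_smul' := fun _ _ => rfl }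
    have hE : Function.Injective E := by
      rw [injective_iff_map_eq_zero]
      rintro ⟨⟨h, hh⟩, hk⟩ h0
      ext x
      have h0 : h d = 0 := h0
      have : h x = h d := hc h hh (fun x => by
        have : h (α x) - h x = 0 := congrFun (LinearMap.mem_ker.1 hk) x
        linarith) x d
      simp [this, h0]
    simpa using LinearMap.finrank_le_finrank_of_injective hE
  have := orbitCount_le_finrank f
  rw [← h2]; omega

/-- Darts of the two kinds of coboundaries are orthogonal. -/
theorem sum_increment_mul [Fintype D] {φ α : Equiv.Perm D} {f h : D → ℚ}
    (hf : ∀ x, f (φ x) = f x) (hh : ∀ x, h (α x) = h (φ x)) :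
    ∑ x, (h (α x) - h x) * f x = 0 := by
  have : ∑ x, h (α x) * f x = ∑ x, h x * f x := by
    rw [← Equiv.sum_comp φ (fun x => h x * f x)]
    exact Finset.sum_congr rfl fun x _ => by rw [hh, hf]
  simp [sub_mul, this]

/-- Summation by parts: pairing with an increment reduces to pairing with the function itself, which
turns orthogonality to functions into orthogonality to their increments. -/
theorem sum_antisymmetric_mul_increment [Fintype D] {α : Equiv.Perm D} (hα : ∀ x, α (α x) = x)
    {c f : D → ℚ} (hc : ∀ x, c (α x) = - c x) :
    ∑ x, c x * (f (α x) - f x) = -2 * ∑ x, c x * f x := by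
  have : ∑ x, c x * f (α x) = - ∑ x, c x * f x := by
    rw [← Equiv.sum_comp α (fun x => c x * f (α x)), ← Finset.sum_neg_distrib]
    exact Finset.sum_congr rfl fun x _ => by rw [hc, hα]; ring
  simp only [mul_sub, Finset.sum_sub_distrib, this]; ring

/-- On the sphere, every antisymmetric function on the darts is the sum of an increment of a
function of the faces and of an increment of a function of the vertices. -/
theorem IsSphereMap.exists_decomposition [Finite D] {φ α : Equiv.Perm D} (h : IsSphereMap φ α)
    (hα : ∀ x, α (α x) = x) {c : D → ℚ} (hc : ∀ x, c (α x) = - c x) :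
    ∃ f g : D → ℚ, (∀ x, f (φ x) = f x) ∧ (∀ x, g (α x) = g (φ x)) ∧
      ∀ x, c x = (f (α x) - f x) + (g (α x) - g x) := by
  have := Fintype.ofFinite D
  obtain ⟨h1, h2⟩ := h
  rw [transitive_iff] at h1
  -- Without darts all orbit counts vanish, and Euler's formula would read `0 = 2`.
  have hne : Nonempty D := by
    by_contra hne
    rw [not_nonempty_iff] at hne
    have : ∀ f : Equiv.Perm D, orbitCount f = 0 := fun f => by
      have : IsEmpty (Quotient (Equiv.Perm.SameCycle.setoid f)) :=
        ⟨fun q => Quotient.inductionOn q hne.elim⟩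
      exact Nat.card_of_isEmpty
    simp [this] at h2
  have hconst : ∀ h : D → ℚ, (∀ x, h (φ x) = h x) → (∀ x, h (α x) = h x) → ∀ x y, h x = h y :=
    fun h e1 e2 x y => (h1 (fun z => h x = h z) (fun z => by rw [e1]) (fun z => by rw [e2]) x y rfl)
  have key : ∀ g ∈ invariantFunctions (α * φ⁻¹), ∀ x, g (α x) = g (φ x) := fun g hg x => by
    have := hg (φ x)
    simpa using this
  have d1 := finrank_map_increment φ α hconst
  have d2 := finrank_map_increment (α * φ⁻¹) α (fun g e1 e2 => hconst g (fun x => by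
    rw [← key g e1, e2]) e2)
  have d3 := finrank_antisymmetric_le α
  have anti : ∀ g : D → ℚ, increment α g ∈ antisymmetricFunctions α := fun g x => by
    simp [increment, hα]
  have hle : (invariantFunctions φ).map (increment α) ⊔
      (invariantFunctions (α * φ⁻¹)).map (increment α) ≤ antisymmetricFunctions α := by
    rw [sup_le_iff]
    constructor
    · rintro _ ⟨g, -, rfl⟩; exact anti g
    · rintro _ ⟨g, -, rfl⟩; exact anti g
  -- A common element is orthogonal to itself: one factor is read as the increment of a vertex
  -- function, the other as that of a face function.
  have hinf : (invariantFunctions φ).map (increment α) ⊓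
      (invariantFunctions (α * φ⁻¹)).map (increment α) = ⊥ := by
    rw [eq_bot_iff]
    rintro c ⟨⟨f, hf, hfc⟩, ⟨g, hg, rfl⟩⟩
    have e1 := sum_increment_mul hf (key g hg)
    have e2 := sum_antisymmetric_mul_increment (f := f) hα (anti g)
    have e3 : ∑ x, (increment α g x) * (increment α g x) = 0 := by
      have : ∀ x, increment α g x = f (α x) - f x := fun x => by rw [← hfc]; rfl
      calc _ = ∑ x, increment α g x * (f (α x) - f x) := by simp [this]
        _ = 0 := by rw [e2]; exact mul_eq_zero_of_right _ e1
    rw [Finset.sum_eq_zero_iff_of_nonneg fun x _ => mul_self_nonneg _] at e3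
    rw [Submodule.mem_bot]
    ext x
    exact mul_self_eq_zero.1 (e3 x (Finset.mem_univ x))
  have hdim := Submodule.finrank_sup_add_finrank_inf_eq
    ((invariantFunctions φ).map (increment α)) ((invariantFunctions (α * φ⁻¹)).map (increment α))
  rw [hinf, finrank_bot] at hdim
  -- The sum has dimension at least `(F - 1) + (V - 1)`, where `F` and `V` are the numbers of orbits
  -- of `φ` and of `α * φ⁻¹`. By Euler's formula this is the number of edges.
  have heq := Submodule.eq_of_le_of_finrank_le hle (by omega)
  have hmem : c ∈ antisymmetricFunctions α := hc
  rw [← heq, Submodule.mem_sup] at hmem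
  obtain ⟨_, ⟨f, hf, rfl⟩, _, ⟨g, hg, rfl⟩, rfl⟩ := hmem
  exact ⟨f, g, hf, key g hg, fun x => rfl⟩

/-- In the decomposition, both `c` and the vertex part are orthogonal to `f`. Hence so is the
increment of `f`, and summation by parts makes its norm zero. -/
theorem IsSphereMap.exists_vertex_potential [Fintype D] {φ α : Equiv.Perm D}
    (h : IsSphereMap φ α) (hα : ∀ x, α (α x) = x) {c : D → ℚ} (hc : ∀ x, c (α x) = - c x)
    (h0 : ∀ f : D → ℚ, (∀ x, f (φ x) = f x) → ∑ x, c x * f x = 0) :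
    ∃ g : D → ℚ, (∀ x, g (α x) = g (φ x)) ∧ ∀ x, c x = g (α x) - g x := by
  obtain ⟨f, g, hf, hg, e⟩ := h.exists_decomposition hα hc
  refine ⟨g, hg, ?_⟩
  have e1 := h0 f hf
  have e2 := sum_increment_mul hf hg
  have e3 : ∑ x, (f (α x) - f x) * f x = 0 := by
    rw [← sub_zero (0 : ℚ)]
    nth_rewrite 1 [← e1]
    rw [← e2, ← Finset.sum_sub_distrib]
    exact Finset.sum_congr rfl fun x _ => by rw [e]; ring
  have e4 := sum_antisymmetric_mul_increment (f := f) (c := fun x => f (α x) - f x) hα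
    (fun x => by simp [hα])
  rw [e3, mul_zero, Finset.sum_eq_zero_iff_of_nonneg fun x _ => mul_self_nonneg _] at e4
  intro x
  rw [e, mul_self_eq_zero.1 (e4 x (Finset.mem_univ x)), zero_add]

/-- The same argument with faces and vertices exchanged; now the increment of `g` is shown to have
norm zero. -/
theorem IsSphereMap.exists_face_potential [Fintype D] {φ α : Equiv.Perm D}
    (h : IsSphereMap φ α) (hα : ∀ x, α (α x) = x) {c : D → ℚ} (hc : ∀ x, c (α x) = - c x)
    (h0 : ∀ g : D → ℚ, (∀ x, g (α x) = g (φ x)) → ∑ x, c x * g x = 0) :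
    ∃ f : D → ℚ, (∀ x, f (φ x) = f x) ∧ ∀ x, c x = f (α x) - f x := by
  obtain ⟨f, g, hf, hg, e⟩ := h.exists_decomposition hα hc
  refine ⟨f, hf, ?_⟩
  have e1 := h0 g hg
  have e2 := sum_increment_mul hf hg
  have a1 := sum_antisymmetric_mul_increment (f := f) (c := fun x => g (α x) - g x) hα
    (fun x => by simp [hα])
  have a2 := sum_antisymmetric_mul_increment (f := g) (c := fun x => f (α x) - f x) hα
    (fun x => by simp [hα])
  rw [e2, mul_zero] at a1
  have e3 : ∑ x, (f (α x) - f x) * g x = 0 := by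
    have : ∑ x, (f (α x) - f x) * (g (α x) - g x) = 0 := by
      rw [← a1]; exact Finset.sum_congr rfl fun x _ => mul_comm _ _
    linarith
  have e5 : ∑ x, (g (α x) - g x) * g x = 0 := by
    rw [← sub_zero (0 : ℚ)]
    nth_rewrite 1 [← e1]
    rw [← e3, ← Finset.sum_sub_distrib]
    exact Finset.sum_congr rfl fun x _ => by rw [e]; ring
  have e4 := sum_antisymmetric_mul_increment (f := g) (c := fun x => g (α x) - g x) hα
    (fun x => by simp [hα])
  rw [e5, mul_zero, Finset.sum_eq_zero_iff_of_nonneg fun x _ => mul_self_nonneg _] at e4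
  intro x
  rw [e, mul_self_eq_zero.1 (e4 x (Finset.mem_univ x)), add_zero]

/-- The flow carried by a directed path. -/
theorem exists_flow [Fintype D] {X : Type*} (α : Equiv.Perm D) (π : D → X) (p : D → Prop) {x y : X}
    (h : Relation.TransGen (fun a b => ∃ d, p d ∧ π d = a ∧ π (α d) = b) x y) :
    ∃ n : D → ℚ, (∀ d, 0 ≤ n d) ∧ (∀ d, n d ≠ 0 → p d) ∧ (∃ d, n d ≠ 0) ∧
      ∀ f : X → ℚ, ∑ d, n d * (f (π (α d)) - f (π d)) = f y - f x := by
  classical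
  have step : ∀ d : D, ∀ f : X → ℚ,
      ∑ d', (if d' = d then (1 : ℚ) else 0) * (f (π (α d')) - f (π d')) =
        f (π (α d)) - f (π d) := fun d f => by simp
  -- The witness `n` counts how often the path uses each dart; the sum then telescopes along the
  -- path.
  induction h with
  | single h =>
    obtain ⟨d, hd, rfl, rfl⟩ := h
    refine ⟨fun d' => if d' = d then 1 else 0, fun d' => by dsimp only; split_ifs <;> simp,
      fun d' h => ?_, ⟨d, by simp⟩, step d⟩
    dsimp only at h
    split_ifs at h with h'
    · exact h' ▸ hd
    · exact absurd rfl h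
  | tail _ h ih =>
    obtain ⟨d, hd, rfl, rfl⟩ := h
    obtain ⟨n, h1, h2, -, h4⟩ := ih
    refine ⟨fun d' => n d' + if d' = d then 1 else 0, fun d' => ?_, fun d' h => ?_, ⟨d, ?_⟩,
      fun f => ?_⟩
    · have := h1 d'
      dsimp only
      split_ifs <;> linarith
    · by_cases h' : d' = d
      · exact h' ▸ hd
      · refine h2 d' fun h0 => h ?_
        simp [h0, h']
    · have := h1 d
      simp only [if_true]
      linarith
    · simp only [add_mul, Finset.sum_add_distrib, h4, step]
      ring

/-- A circulation gives an antisymmetric function on the darts; if it is an increment, the potential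
is monotone. -/
theorem exists_monotone_potential [Fintype D] {X : Type*} {α : Equiv.Perm D}
    (hα : ∀ x, α (α x) = x) (π : D → X) (p : D → Prop) (hp : ∀ d, p d → ¬ p (α d))
    (inv : (D → ℚ) → Prop) (dual : (D → ℚ) → Prop)
    (hinv : ∀ f, inv f → ∃ F : X → ℚ, ∀ d, F (π d) = f d)
    (hex : ∀ c : D → ℚ, (∀ x, c (α x) = - c x) → (∀ f : D → ℚ, inv f → ∑ x, c x * f x = 0) →
      ∃ g : D → ℚ, dual g ∧ ∀ x, c x = g (α x) - g x) {x : X}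
    (h : Relation.TransGen (fun a b => ∃ d, p d ∧ π d = a ∧ π (α d) = b) x x) :
    ∃ g : D → ℚ, dual g ∧ (∀ d, p d → g d ≤ g (α d)) ∧
      (∀ d, ¬ p d → ¬ p (α d) → g d = g (α d)) ∧ ∃ d, p d ∧ g d ≠ g (α d) := by
  obtain ⟨n, h1, h2, ⟨d0, h3⟩, h4⟩ := exists_flow α π p h
  -- The net flow of a closed path is orthogonal to every function that comes from `X`. No edge is
  -- used in both directions, so the net flow is nonnegative on the darts in `p`, whence the
  -- monotonicity of `g`.
  obtain ⟨g, hg, hgn⟩ := hex (fun d => n d - n (α d)) (fun d => by simp [hα]) (fun f hf => by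
    obtain ⟨F, hF⟩ := hinv f hf
    have := h4 F
    simp only [hF, sub_self] at this
    have e : ∑ d, n (α d) * f d = ∑ d, n d * f (α d) := by
      rw [← Equiv.sum_comp α (fun d => n d * f (α d))]
      simp [hα]
    simp only [mul_sub, Finset.sum_sub_distrib] at this
    simp only [sub_mul, Finset.sum_sub_distrib, e]
    linarith)
  have n0 : ∀ d, ¬ p d → n d = 0 := fun d hd => by
    by_contra h; exact hd (h2 d h)
  refine ⟨g, hg, fun d hd => ?_, fun d hd hd' => ?_, d0, h2 d0 h3, ?_⟩
  · have := hgn d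
    rw [n0 _ (hp d hd)] at this
    have := h1 d
    linarith
  · have := hgn d
    rw [n0 d hd, n0 _ hd'] at this
    linarith
  · have := hgn d0
    rw [n0 _ (hp d0 (h2 d0 h3))] at this
    intro h
    apply h3
    linarith

end Cochains

/-! ### Acyclic relations on finite sets. -/

section FiniteRelations

theorem wellFounded_of_acyclic {X : Type*} [Finite X] {R : X → X → Prop}
    (h : ∀ x, ¬ Relation.TransGen R x x) : WellFounded R := by
  have : Std.Irrefl (Relation.TransGen R) := ⟨h⟩
  have hw : WellFounded (Relation.TransGen R) := Finite.wellFounded_of_trans_of_irrefl _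
  exact Subrelation.wf (fun h => Relation.TransGen.single h) hw

theorem acyclic_swap {X : Type*} {R : X → X → Prop}
    (h : ∀ x, ¬ Relation.TransGen R x x) (x : X) :
    ¬ Relation.TransGen (fun a b => R b a) x x := fun h' => h x (Relation.transGen_swap.1 h')

/-- Used to turn once around a vertex of the dual and obtain a directed cycle of operators. -/
theorem transGen_of_orbit {D X : Type*} [Finite D] (σ : Equiv.Perm D) {R : X → X → Prop}
    (π : D → X) (s : D → Prop) (hs : ∀ d, s d → s (σ d)) (hR : ∀ d, s d → R (π d) (π (σ d)))
    {d : D} (hd : s d) : Relation.TransGen R (π d) (π d) := by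
  have hsn : ∀ n : ℕ, s ((σ ^ n) d) := fun n => by
    induction n with
    | zero => exact hd
    | succ n ih => rw [pow_succ']; exact hs _ ih
  have h : ∀ n : ℕ, Relation.TransGen R (π d) (π ((σ ^ (n + 1)) d)) := fun n => by
    induction n with
    | zero => simpa using Relation.TransGen.single (hR d hd)
    | succ n ih =>
      refine ih.tail ?_
      rw [pow_succ' σ (n + 1)]
      exact hR _ (hsn _)
  -- The path of `orderOf σ` steps is closed, and this number is positive, so the path is not empty.
  have := h (orderOf σ - 1)
  rwa [Nat.sub_add_cancel (orderOf_pos σ), pow_orderOf_eq_one] at this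

end FiniteRelations

/-! ### Directed cycles give monotone potentials on the dual cells. -/

section Potentials

variable {D X : Type u} [Finite D] {φ α : Equiv.Perm D}

/-- Jordan curve theorem: a directed closed walk through faces separates the vertices, and all its
steps cross the cut in the same direction. The hypothesis `hπ` lets face functions descend to `X`,
which will be the set of operators. -/
theorem IsSphereMap.exists_vertex_monotone (h : IsSphereMap φ α)
    (hα : ∀ x, α (α x) = x) (π : D → X) (p : D → Prop) (hp : ∀ d, p d → ¬ p (α d))
    (hπ : ∀ f : D → ℚ, (∀ x, f (φ x) = f x) → ∃ F : X → ℚ, ∀ d, F (π d) = f d) {x : X}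
    (hx : Relation.TransGen (fun a b => ∃ d, p d ∧ π d = a ∧ π (α d) = b) x x) :
    ∃ g : D → ℚ, (∀ x, g (α x) = g (φ x)) ∧ (∀ d, p d → g d ≤ g (α d)) ∧
      (∀ d, ¬ p d → ¬ p (α d) → g d = g (α d)) ∧ ∃ d, p d ∧ g d ≠ g (α d) := by
  have := Fintype.ofFinite D
  exact exists_monotone_potential hα π p hp (fun f => ∀ x, f (φ x) = f x)
    (fun g => ∀ x, g (α x) = g (φ x)) hπ (fun c => h.exists_vertex_potential hα) hx

/-- The dual form: a directed closed walk through vertices gives a potential on the faces. -/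
theorem IsSphereMap.exists_face_monotone (h : IsSphereMap φ α)
    (hα : ∀ x, α (α x) = x) (π : D → X) (p : D → Prop) (hp : ∀ d, p d → ¬ p (α d))
    (hπ : ∀ g : D → ℚ, (∀ x, g (α x) = g (φ x)) → ∃ F : X → ℚ, ∀ d, F (π d) = g d) {x : X}
    (hx : Relation.TransGen (fun a b => ∃ d, p d ∧ π d = a ∧ π (α d) = b) x x) :
    ∃ f : D → ℚ, (∀ x, f (φ x) = f x) ∧ (∀ d, p d → f d ≤ f (α d)) ∧
      (∀ d, ¬ p d → ¬ p (α d) → f d = f (α d)) ∧ ∃ d, p d ∧ f d ≠ f (α d) := by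
  have := Fintype.ofFinite D
  exact exists_monotone_potential hα π p hp (fun g => ∀ x, g (α x) = g (φ x))
    (fun f => ∀ x, f (φ x) = f x) hπ (fun c => h.exists_face_potential hα) hx

end Potentials

/-! ### Ports of the operators and their owners. -/

section Ports

variable {C Pr : Type u}

/-- The operator that carries a port. -/
def Port.owner : Port C Pr → C ⊕ Pr := Sum.elim Out.owner Inp.owner

@[simp] theorem Port.owner_inl (q : Out C Pr) : Port.owner (.inl q) = q.owner := rfl
@[simp] theorem Port.owner_inr (i : Inp C Pr) : Port.owner (.inr i) = i.owner := rfl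

theorem Port.owner_turn (a : Port C Pr) : Port.owner (Port.turn C Pr a) = Port.owner a := by
  rcases a with ((c | c | p) | (c | p | p)) <;> rfl

theorem Port.exists_owner_lift {A : Type*} (F : Port C Pr → A)
    (h : ∀ a, F (Port.turn C Pr a) = F a) : ∃ G : C ⊕ Pr → A, ∀ a, G (Port.owner a) = F a := by
  refine ⟨Sum.elim (fun c => F (.inr (.cop c))) (fun p => F (.inl (.prod p))), ?_⟩
  rintro ((c | c | p) | (c | p | p))
  · exact h (.inl (.left c))
  · exact (h (.inr (.cop c))).symm
  · rfl
  · rfl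
  · exact (h (.inl (.prod p))).symm
  · exact h (.inr (.right p))

@[simp] theorem Port.wire_inl (next : Out C Pr ≃ Inp C Pr) (q : Out C Pr) :
    Port.wire next (.inl q) = .inr (next q) := rfl
@[simp] theorem Port.wire_inr (next : Out C Pr ≃ Inp C Pr) (i : Inp C Pr) :
    Port.wire next (.inr i) = .inl (next.symm i) := rfl
theorem Port.wire_wire (next : Out C Pr ≃ Inp C Pr) (a : Port C Pr) :
    Port.wire next (Port.wire next a) = a := by
  rcases a with q | i <;> simp

theorem Port.turn_turn_turn (a : Port C Pr) :
    Port.turn C Pr (Port.turn C Pr (Port.turn C Pr a)) = a := by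
  rcases a with ((c | c | p) | (c | p | p)) <;> rfl

theorem Port.turn_ne (a : Port C Pr) : Port.turn C Pr a ≠ a := by
  rcases a with ((c | c | p) | (c | p | p)) <;> simp [Port.turn]

theorem Port.finite [Finite C] [Finite Pr] : Finite (Port C Pr) := by
  have h1 : Finite (Out C Pr) := by
    refine Finite.of_injective (β := C ⊕ C ⊕ Pr) (fun q => match q with
      | .left c => .inl c | .right c => .inr (.inl c) | .prod p => .inr (.inr p)) ?_
    rintro (a | a | a) (b | b | b) h <;> simp_all
  have h2 : Finite (Inp C Pr) := by
    refine Finite.of_injective (β := C ⊕ Pr ⊕ Pr) (fun q => match q with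
      | .cop c => .inl c | .left c => .inr (.inl c) | .right p => .inr (.inr p)) ?_
    rintro (a | a | a) (b | b | b) h <;> simp_all
  infer_instance

end Ports

/-! ### From prographs to triangulations. -/

namespace PCPrograph

variable {C Pr : Type u} (P : PCPrograph C Pr)

/-- A non-virtual edge goes from the first operator to the second. -/
def Arc (a b : C ⊕ Pr) : Prop :=
  ∃ q : Out C Pr, q ≠ .prod P.root ∧ q.owner = a ∧ (P.next q).owner = b

theorem arc_of_ne {q : Out C Pr} (h : q ≠ .prod P.root) : P.Arc q.owner (P.next q).owner :=
  ⟨q, h, rfl, rfl⟩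

theorem acyclic_arc (o : C ⊕ Pr) : ¬ Relation.TransGen P.Arc o o := P.acyclic o

theorem finite_op (P : PCPrograph C Pr) : Finite (C ⊕ Pr) :=
  have := P.finite_cop
  have := P.finite_prod
  inferInstance

/-- Going backwards from any operator one reaches the input coproduct, going forwards the output
product. So `f` is greatest at the former and least at the latter, and the virtual edge, to which
`h` also applies, reverses this inequality. -/
theorem eq_of_antitone (P : PCPrograph C Pr) (f : C ⊕ Pr → ℚ) (h : ∀ q, f (P.next q).owner ≤ f q.owner)
    (a b : C ⊕ Pr) : f a = f b := by
  have := P.finite_op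
  obtain ⟨c, hc⟩ := P.root_next
  have h1 : ∀ o, f o ≤ f (.inl c) := by
    intro o
    induction o using (wellFounded_of_acyclic P.acyclic_arc).induction with
    | _ o ih =>
      by_cases ho : o = .inl c
      · rw [ho]
      · obtain ⟨i, rfl⟩ : ∃ i : Inp C Pr, i.owner = o := by
          rcases o with c | p
          exacts [⟨.cop c, rfl⟩, ⟨.left p, rfl⟩]
        have hq : P.next.symm i ≠ .prod P.root := by
          intro h
          rw [Equiv.symm_apply_eq, hc] at h
          exact ho (h ▸ rfl)
        have := P.arc_of_ne hq
        rw [Equiv.apply_symm_apply] at this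
        have h2 := h (P.next.symm i)
        rw [Equiv.apply_symm_apply] at h2
        exact h2.trans (ih _ this)
  have h2 : ∀ o, f (.inr P.root) ≤ f o := by
    intro o
    induction o using (wellFounded_of_acyclic (acyclic_swap P.acyclic_arc)).induction with
    | _ o ih =>
      by_cases ho : o = .inr P.root
      · rw [ho]
      · obtain ⟨q, rfl⟩ : ∃ q : Out C Pr, q.owner = o := by
          rcases o with c | p
          exacts [⟨.left c, rfl⟩, ⟨.prod p, rfl⟩]
        have hq : q ≠ .prod P.root := by
          rintro rfl
          exact ho rfl
        exact (ih _ (P.arc_of_ne hq)).trans (h q)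
  have h3 := h (.prod P.root)
  rw [hc] at h3
  exact le_antisymm ((h1 a).trans (h3.trans (h2 b))) ((h1 b).trans (h3.trans (h2 a)))

/-- A prograph has a dual triangulation on any copy of its set of ports. -/
theorem exists_dual {D : Type u} (dart : Port C Pr ≃ D) :
    ∃ (T : Triangulation D) (δ : Duality P T), δ.dart = dart := by
  have := P.finite_cop
  have := P.finite_prod
  have hfinP : Finite (Port C Pr) := Port.finite
  have hfin : Finite D := Finite.of_equiv _ dart
  let face : Equiv.Perm D := dart.permCongr (Port.turn C Pr)
  let opp : Equiv.Perm D := dart.permCongr (Port.wire P.next)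
  let pos : D → Prop := fun d => (dart.symm d).isRight = true
  let own : D → C ⊕ Pr := fun d => Port.owner (dart.symm d)
  have hface : ∀ a, dart (Port.turn C Pr a) = face (dart a) := fun a => by simp [face]
  have hopp : ∀ a, dart (Port.wire P.next a) = opp (dart a) := fun a => by simp [opp]
  have opp_opp : ∀ d, opp (opp d) = d := fun d => by
    obtain ⟨a, rfl⟩ := dart.surjective d
    rw [← hopp, ← hopp, Port.wire_wire]
  have pos_opp : ∀ d, pos (opp d) ↔ ¬ pos d := fun d => by
    obtain ⟨a, rfl⟩ := dart.surjective d
    rw [← hopp]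
    rcases a with q | i <;> simp [pos]
  have own_face : ∀ d, own (face d) = own d := fun d => by
    obtain ⟨a, rfl⟩ := dart.surjective d
    rw [← hface]
    simp [own, Port.owner_turn]
  have sphere : IsSphereMap face opp := P.planar.congr dart hface hopp
  have acyclic : ∀ v : Quotient (Equiv.Perm.SameCycle.setoid (vertexPerm face opp)),
      ¬ Relation.TransGen
        (fun a b => ∃ d, pos d ∧ Quotient.mk _ d = a ∧ Quotient.mk _ (opp d) = b) v v := by
    intro v hv
    obtain ⟨f, hf, h1, -, d, hd, hne⟩ := sphere.exists_face_monotone opp_opp _ pos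
      (fun d hd => fun h => (pos_opp d).1 h hd) (fun g hg => exists_vertex_lift g hg) hv
    obtain ⟨F, hF⟩ := Port.exists_owner_lift (fun a => f (dart a)) (fun a => by rw [hface, hf])
    -- Positive darts sit at inputs, so the potential does not increase along the edges of the
    -- prograph, the virtual one included.
    have hconst := P.eq_of_antitone F (fun q => by
      have e1 := hF (.inl q)
      have e2 := hF (.inr (P.next q))
      have e3 := h1 (dart (.inr (P.next q))) (by simp [pos])
      rw [← hopp, ← hF, ← hF] at e3
      simpa using e3)
    apply hne
    obtain ⟨a, rfl⟩ := dart.surjective d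
    rw [← hopp, ← hF, ← hF]
    exact hconst _ _
  let root : D := dart (.inr (P.next (.prod P.root)))
  have opp_root : opp root = dart (.inl (.prod P.root)) := by
    simp only [root]
    rw [← hopp]
    simp
  have out_of_neg : ∀ d, ¬ pos d → ∃ q, d = dart (.inl q) ∧ opp d = dart (.inr (P.next q)) := by
    intro d hd
    obtain ⟨a, rfl⟩ := dart.surjective d
    rcases a with q | i
    · exact ⟨q, rfl, by rw [← hopp]; rfl⟩
    · simp [pos] at hd
  -- If all darts at `v` are outgoing, each step around `v` goes from an operator to the next one
  -- along an edge of the prograph. Only the virtual edge can keep this from being a forbidden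
  -- cycle, and then `v` is the origin of the root.
  have src : ∀ v : Quotient (Equiv.Perm.SameCycle.setoid (vertexPerm face opp)),
      (∀ d, pos d → Quotient.mk _ (opp d) ≠ v) → v = Quotient.mk _ root := by
    intro v hv
    by_contra hne
    have hpos : ∀ d, Quotient.mk _ d = v → pos d := fun d hd => by
      by_contra hn
      exact hv (opp d) ((pos_opp d).2 hn) (by rw [opp_opp]; exact hd)
    induction v using Quotient.inductionOn with | h d =>
    refine P.acyclic_arc _ (transGen_of_orbit (vertexPerm face opp) own
      (fun x => Quotient.mk (Equiv.Perm.SameCycle.setoid (vertexPerm face opp)) x =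
        Quotient.mk _ d) (fun x hx => (mk_apply_eq _ x).trans hx) (fun x hx => ?_) (d := d) rfl)
    obtain ⟨y, rfl⟩ := face.surjective x
    have hy : Quotient.mk (Equiv.Perm.SameCycle.setoid (vertexPerm face opp)) (opp y) =
      Quotient.mk _ d := (mk_opp_eq face opp y).trans hx
    rw [vertexPerm_face, own_face]
    obtain ⟨q, hq, hq'⟩ := out_of_neg y ((pos_opp y).1 (hpos _ hy))
    have hqr : q ≠ .prod P.root := by
      rintro rfl
      exact hne (hy.symm.trans (by rw [hq']))
    have := P.arc_of_ne hqr
    rw [hq, ← hopp]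
    simpa [own] using this
  have snk : ∀ v : Quotient (Equiv.Perm.SameCycle.setoid (vertexPerm face opp)),
      (∀ d, pos d → Quotient.mk _ d ≠ v) → v = Quotient.mk _ (opp root) := by
    intro v hv
    by_contra hne
    have hpos : ∀ d, Quotient.mk _ d = v → ¬ pos d := fun d hd hp => hv d hp hd
    induction v using Quotient.inductionOn with | h d =>
    refine acyclic_swap P.acyclic_arc _ (transGen_of_orbit (vertexPerm face opp) own
      (fun x => Quotient.mk (Equiv.Perm.SameCycle.setoid (vertexPerm face opp)) x =
        Quotient.mk _ d) (fun x hx => (mk_apply_eq _ x).trans hx) (fun x hx => ?_) (d := d) rfl)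
    obtain ⟨y, rfl⟩ := face.surjective x
    have hy : Quotient.mk (Equiv.Perm.SameCycle.setoid (vertexPerm face opp)) (opp y) =
      Quotient.mk _ d := (mk_opp_eq face opp y).trans hx
    rw [vertexPerm_face, own_face]
    obtain ⟨q, hq, hq'⟩ := out_of_neg (opp y) (hpos _ hy)
    rw [opp_opp] at hq'
    have hqr : q ≠ .prod P.root := by
      rintro rfl
      exact hne (hy.symm.trans (by rw [hq, opp_root]))
    have := P.arc_of_ne hqr
    rw [hq, hq']
    simpa [own] using this
  have hV : Nonempty (Quotient (Equiv.Perm.SameCycle.setoid (vertexPerm face opp))) :=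
    ⟨Quotient.mk _ root⟩
  refine ⟨{ finite := hfin, face := face, opp := opp, opp_opp := opp_opp, opp_ne := ?_,
            triangle := ?_, sphere := sphere, pos := pos, pos_opp := pos_opp, root := root,
            pos_root := ?_, acyclic := acyclic, source_iff := ?_, sink_iff := ?_ },
          { dart := dart, dart_turn := hface, dart_wire := hopp, pos_out := ?_, pos_inp := ?_,
            dart_root := rfl }, rfl⟩
  · intro d h
    have := pos_opp d
    rw [h] at this
    exact iff_not_self this
  · intro d
    obtain ⟨a, rfl⟩ := dart.surjective d
    refine ⟨by rw [← hface, ← hface, ← hface, Port.turn_turn_turn], ?_⟩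
    rw [← hface]
    exact fun h => Port.turn_ne a (dart.injective h)
  · simp [pos, root]
  · refine fun v => ⟨src v, ?_⟩
    rintro rfl
    -- A finite acyclic graph has a source, and by `src` it can only be the origin of the root.
    obtain ⟨v, -, hv⟩ := (wellFounded_of_acyclic acyclic).has_min Set.univ Set.univ_nonempty
    have hv' : ∀ d, pos d → Quotient.mk _ (opp d) ≠ v :=
      fun d hd h => hv (Quotient.mk _ d) trivial ⟨d, hd, rfl, h⟩
    rwa [src v hv'] at hv'
  · refine fun v => ⟨snk v, ?_⟩
    rintro rfl
    obtain ⟨v, -, hv⟩ :=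
      (wellFounded_of_acyclic (acyclic_swap acyclic)).has_min Set.univ Set.univ_nonempty
    have hv' : ∀ d, pos d → Quotient.mk _ d ≠ v :=
      fun d hd h => hv (Quotient.mk _ (opp d)) trivial ⟨d, hd, h, rfl⟩
    rwa [snk v hv'] at hv'
  · intro q; simp [pos]
  · intro i; simp [pos]

end PCPrograph

/-! ### From triangulations to prographs. -/

namespace Triangulation

variable {D : Type u} (T : Triangulation D)

/-- An edge goes from the first vertex to the second. -/
def Adj (v w : T.Vertex) : Prop := ∃ d, T.pos d ∧ T.origin d = v ∧ T.origin (T.opp d) = w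

theorem acyclic_adj (v : T.Vertex) : ¬ Relation.TransGen T.Adj v v := T.acyclic v

theorem origin_opp (d : D) : T.origin (T.opp d) = T.origin (T.face d) := mk_opp_eq _ _ d

theorem adj_of_pos {d : D} (h : T.pos d) : T.Adj (T.origin d) (T.origin (T.face d)) :=
  ⟨d, h, rfl, T.origin_opp d⟩

theorem adj_of_neg {d : D} (h : ¬ T.pos d) : T.Adj (T.origin (T.face d)) (T.origin d) :=
  ⟨T.opp d, (T.pos_opp d).2 h, T.origin_opp d, by rw [T.opp_opp]⟩

theorem face_face_face (d : D) : T.face (T.face (T.face d)) = d := (T.triangle d).1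

theorem not_adj_source (v : T.Vertex) : ¬ T.Adj v (T.origin T.root) := by
  rintro ⟨d, hd, -, h⟩
  exact (T.source_iff _).2 rfl d hd h

theorem not_adj_sink (v : T.Vertex) : ¬ T.Adj (T.origin (T.opp T.root)) v := by
  rintro ⟨d, hd, h, -⟩
  exact (T.sink_iff _).2 rfl d hd h

theorem exists_adj_of_ne_source {v : T.Vertex} (h : v ≠ T.origin T.root) : ∃ w, T.Adj w v := by
  by_contra hn
  exact h ((T.source_iff v).1 fun d hd h => hn ⟨_, d, hd, rfl, h⟩)

theorem exists_adj_of_ne_sink {v : T.Vertex} (h : v ≠ T.origin (T.opp T.root)) :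
    ∃ w, T.Adj v w := by
  by_contra hn
  exact h ((T.sink_iff v).1 fun d hd h => hn ⟨_, d, hd, h, rfl⟩)

theorem finite_vertex : Finite T.Vertex :=
  have := T.finite
  inferInstanceAs (Finite (Quotient _))

theorem exists_neg_of_triangle (d : D) :
    ¬ T.pos d ∨ ¬ T.pos (T.face d) ∨ ¬ T.pos (T.face (T.face d)) := by
  by_contra! h
  obtain ⟨h1, h2, h3⟩ := h
  have e := T.adj_of_pos h3
  rw [T.face_face_face] at e
  exact T.acyclic_adj _ (((Relation.TransGen.single (T.adj_of_pos h1)).tail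
    (T.adj_of_pos h2)).tail e)

theorem exists_pos_of_triangle (d : D) :
    T.pos d ∨ T.pos (T.face d) ∨ T.pos (T.face (T.face d)) := by
  by_contra! h
  obtain ⟨h1, h2, h3⟩ := h
  have e := T.adj_of_neg h3
  rw [T.face_face_face] at e
  exact T.acyclic_adj _ ((Relation.TransGen.single e |>.tail
    (T.adj_of_neg h2)).tail (T.adj_of_neg h1))

/-- A triangulation whose triangles and sides are labelled by operators and ports is the dual of a
prograph. -/
theorem exists_predual {C Pr : Type u} (dart : Port C Pr ≃ D) (next : Out C Pr ≃ Inp C Pr) (r : Pr)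
    (hturn : ∀ a, dart (Port.turn C Pr a) = T.face (dart a))
    (hwire : ∀ a, dart (Port.wire next a) = T.opp (dart a))
    (hout : ∀ q, ¬ T.pos (dart (.inl q))) (hinp : ∀ i, T.pos (dart (.inr i)))
    (hroot : dart (.inr (next (.prod r))) = T.root) :
    ∃ (P : PCPrograph C Pr) (δ : Duality P T), P.next = next ∧ P.root = r ∧ δ.dart = dart := by
  have hfin := T.finite
  have hfinV := T.finite_vertex
  have hC : Finite C := Finite.of_injective (fun c : C => dart (.inr (.cop c)))
    (fun a b h => by simpa using dart.injective h)
  have hPr : Finite Pr := Finite.of_injective (fun c : Pr => dart (.inl (.prod c)))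
    (fun a b h => by simpa using dart.injective h)
  have opp_root : T.opp T.root = dart (.inl (.prod r)) := by
    rw [← hroot, ← hwire]
    simp
  let P : PCPrograph C Pr :=
    { next := next, root := r, finite_cop := hC, finite_prod := hPr
      root_next := by
        -- If the root were the left input of a product, the next side would be an edge leaving the
        -- sink; if it were the right input, the preceding side would be an edge entering the
        -- source.
        rcases h : next (.prod r) with c | p | p
        · exact ⟨c, rfl⟩
        · exfalso
          rw [h] at hroot
          have e : T.face T.root = dart (.inr (.right p)) := by
            rw [← hroot, ← hturn]; rfl
          have e2 := T.adj_of_pos (d := T.face T.root) (by rw [e]; exact hinp _)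
          rw [← T.origin_opp T.root] at e2
          exact T.not_adj_sink _ e2
        · exfalso
          rw [h] at hroot
          have e : T.face (dart (.inr (.left p))) = T.root := by
            rw [← hroot, ← hturn]; rfl
          have e2 := T.adj_of_pos (hinp (.left p))
          rw [e] at e2
          exact T.not_adj_source _ e2
      acyclic := by
        intro o ho
        -- Excluding `T.opp T.root` from the allowed darts makes the potential take the same value
        -- at both ends of the root edge.
        obtain ⟨g, hg, h1, h2, d, hd, hne⟩ := T.sphere.exists_vertex_monotone T.opp_opp
          (fun d => Port.owner (dart.symm d)) (fun d => ¬ T.pos d ∧ d ≠ T.opp T.root)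
          (fun d hd h => h.1 ((T.pos_opp d).2 hd.1))
          (fun f hf => by
            obtain ⟨F, hF⟩ := Port.exists_owner_lift (fun a => f (dart a))
              (fun a => by rw [hturn, hf])
            exact ⟨F, fun d => by rw [hF]; simp⟩)
          (x := o) (Relation.TransGen.mono (by
            rintro a b ⟨q, hq, rfl, rfl⟩
            refine ⟨dart (.inl q), ⟨hout q, ?_⟩, by simp, by rw [← hwire]; simp⟩
            rw [opp_root]
            intro h
            exact hq (by simpa using dart.injective h)) _ _ ho)
        obtain ⟨G, hG⟩ := exists_vertex_lift (face := T.face) (opp := T.opp) g hg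
        have hroot' : g T.root = g (T.opp T.root) :=
          h2 _ (fun h => h.1 T.pos_root) (fun h => h.2 rfl)
        have hmono : ∀ v w, T.Adj v w → G w ≤ G v := by
          rintro _ _ ⟨d, hd, rfl, rfl⟩
          simp only [Triangulation.origin]
          rw [hG, hG]
          by_cases hdr : d = T.root
          · rw [hdr, hroot']
          · have := h1 (T.opp d) ⟨fun h => (T.pos_opp d).1 h hd,
              fun h => hdr (T.opp.injective h)⟩
            rwa [T.opp_opp] at this
        -- The potential is greatest at the source and least at the sink, and these two values
        -- agree; so it is constant, against `hne`.
        have l1 : ∀ v, G v ≤ G (T.origin T.root) := by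
          intro v
          induction v using (wellFounded_of_acyclic T.acyclic_adj).induction with
          | _ v ih =>
            by_cases hv : v = T.origin T.root
            · rw [hv]
            · obtain ⟨w, hw⟩ := T.exists_adj_of_ne_source hv
              exact (hmono _ _ hw).trans (ih w hw)
        have l2 : ∀ v, G (T.origin (T.opp T.root)) ≤ G v := by
          intro v
          induction v using (wellFounded_of_acyclic (acyclic_swap T.acyclic_adj)).induction with
          | _ v ih =>
            by_cases hv : v = T.origin (T.opp T.root)
            · rw [hv]
            · obtain ⟨w, hw⟩ := T.exists_adj_of_ne_sink hv
              exact (ih w hw).trans (hmono _ _ hw)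
        have l3 : G (T.origin T.root) = G (T.origin (T.opp T.root)) := by
          simp only [Triangulation.origin]
          rw [hG, hG, hroot']
        have l4 : ∀ d, g d = g T.root := fun d => by
          rw [← hG, ← hG]
          exact le_antisymm (l1 _) (l3.le.trans (l2 _))
        exact hne (by rw [l4, l4 (T.opp d)])
      planar := T.sphere.congr dart.symm
        (fun d => by rw [Equiv.symm_apply_eq, hturn, Equiv.apply_symm_apply])
        (fun d => by rw [Equiv.symm_apply_eq, hwire, Equiv.apply_symm_apply]) }
  let δ : Duality P T :=
    { dart := dart, dart_turn := hturn, dart_wire := hwire, pos_out := hout, pos_inp := hinp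
      dart_root := hroot }
  exact ⟨P, δ, rfl, rfl, rfl⟩

/-- Every triangulation is the dual of a prograph. -/
theorem exists_dual : ∃ (C Pr : Type u) (P : PCPrograph C Pr), Nonempty (Duality P T) := by
  -- An operator is represented by the side of its triangle whose sign differs from the two others:
  -- the input of a coproduct, the output of a product.
  let C := {d : D // T.pos d ∧ ¬ T.pos (T.face d) ∧ ¬ T.pos (T.face (T.face d))}
  let Pr := {d : D // ¬ T.pos d ∧ T.pos (T.face d) ∧ T.pos (T.face (T.face d))}
  let dart0 : Port C Pr → D
    | .inr (.cop c) => c.1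
    | .inl (.right c) => T.face c.1
    | .inl (.left c) => T.face (T.face c.1)
    | .inl (.prod p) => p.1
    | .inr (.left p) => T.face p.1
    | .inr (.right p) => T.face (T.face p.1)
  have hout0 : ∀ q, ¬ T.pos (dart0 (.inl q)) := by
    rintro (c | c | p)
    exacts [c.2.2.2, c.2.2.1, p.2.1]
  have hinp0 : ∀ i, T.pos (dart0 (.inr i)) := by
    rintro (c | p | p)
    exacts [c.2.1, p.2.2.1, p.2.2.2]
  have hturn0 : ∀ a, dart0 (Port.turn C Pr a) = T.face (dart0 a) := by
    rintro ((c | c | p) | (c | p | p))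
    exacts [(T.face_face_face _).symm, rfl, rfl, rfl, rfl, (T.face_face_face _).symm]
  have key : ∀ d, (∃ c : C, c.1 = d) ∨ (∃ c : C, c.1 = T.face d) ∨
      (∃ c : C, c.1 = T.face (T.face d)) ∨ (∃ p : Pr, p.1 = d) ∨ (∃ p : Pr, p.1 = T.face d) ∨
      (∃ p : Pr, p.1 = T.face (T.face d)) := by
    intro d
    have e1 := T.exists_neg_of_triangle d
    have e2 := T.exists_pos_of_triangle d
    have e3 := T.face_face_face d
    by_cases p1 : T.pos d <;> by_cases p2 : T.pos (T.face d) <;>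
      by_cases p3 : T.pos (T.face (T.face d)) <;>
      simp_all [C, Pr]
  have hinj : Function.Injective dart0 := by
    have hs : ∀ a, T.pos (dart0 a) ↔ a.isRight = true := by
      rintro (q | i)
      · simpa using hout0 q
      · simpa using hinp0 i
    -- The signs of a port and of its two successors around the operator determine which of the six
    -- kinds of port it is.
    intro a b h
    have t1 : a.isRight = b.isRight := by rw [Bool.eq_iff_iff, ← hs, ← hs, h]
    have t2 : (Port.turn C Pr a).isRight = (Port.turn C Pr b).isRight := by
      rw [Bool.eq_iff_iff, ← hs, ← hs, hturn0, hturn0, h]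
    have t3 : (Port.turn C Pr (Port.turn C Pr a)).isRight =
        (Port.turn C Pr (Port.turn C Pr b)).isRight := by
      rw [Bool.eq_iff_iff, ← hs, ← hs, hturn0, hturn0, hturn0, hturn0, h]
    rcases a with ((c | c | c) | (c | c | c)) <;> rcases b with ((d | d | d) | (d | d | d)) <;>
      first
      | exact absurd t1 Bool.noConfusion
      | exact absurd t2 Bool.noConfusion
      | exact absurd t3 Bool.noConfusion
      | exact congrArg _ (congrArg _ (Subtype.ext h))
      | exact congrArg _ (congrArg _ (Subtype.ext (T.face.injective h)))
      | exact congrArg _ (congrArg _ (Subtype.ext (T.face.injective (T.face.injective h))))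
  have hsurj : Function.Surjective dart0 := by
    intro d
    have e3 := T.face_face_face d
    rcases key d with ⟨c, hc⟩ | ⟨c, hc⟩ | ⟨c, hc⟩ | ⟨c, hc⟩ | ⟨c, hc⟩ | ⟨c, hc⟩
    · exact ⟨.inr (.cop c), hc⟩
    · exact ⟨.inl (.left c), by simp only [dart0]; rw [hc, e3]⟩
    · exact ⟨.inl (.right c), by simp only [dart0]; rw [hc, e3]⟩
    · exact ⟨.inl (.prod c), hc⟩
    · exact ⟨.inr (.right c), by simp only [dart0]; rw [hc, e3]⟩
    · exact ⟨.inr (.left c), by simp only [dart0]; rw [hc, e3]⟩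
  let dart : Port C Pr ≃ D := Equiv.ofBijective dart0 ⟨hinj, hsurj⟩
  have hwire : ∃ next : Out C Pr ≃ Inp C Pr, ∀ a, dart (Port.wire next a) = T.opp (dart a) := by
    have h1 : ∀ q, ∃ i, dart (.inr i) = T.opp (dart (.inl q)) := by
      intro q
      obtain ⟨q' | i, h⟩ := dart.surjective (T.opp (dart (.inl q)))
      · exact absurd ((T.pos_opp _).2 (hout0 q)) (h ▸ hout0 q')
      · exact ⟨i, h⟩
    have h2 : ∀ i, ∃ q, dart (.inl q) = T.opp (dart (.inr i)) := by
      intro i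
      obtain ⟨q' | i', h⟩ := dart.surjective (T.opp (dart (.inr i)))
      · exact ⟨q', h⟩
      · exact absurd (h ▸ hinp0 i') (fun h => (T.pos_opp _).1 h (hinp0 i))
    choose f hf using h1
    choose g hg using h2
    refine ⟨⟨f, g, fun q => ?_, fun i => ?_⟩, ?_⟩
    · apply Sum.inl_injective
      apply dart.injective
      rw [hg, hf, T.opp_opp]
    · apply Sum.inr_injective
      apply dart.injective
      rw [hf, hg, T.opp_opp]
    · rintro (q | i)
      exacts [hf q, hg i]
  obtain ⟨next, hwire⟩ := hwire
  -- In the triangle of `T.opp T.root`, the next side starts at the source and the third one ends at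
  -- the sink, so both are positive and the triangle is a product.
  have hr : ∃ r : Pr, r.1 = T.opp T.root := by
    refine ⟨⟨T.opp T.root, fun h => (T.pos_opp _).1 h T.pos_root, ?_, ?_⟩, rfl⟩
    · by_contra h
      have := T.adj_of_neg h
      rw [← T.origin_opp (T.opp T.root), T.opp_opp] at this
      exact T.not_adj_source _ this
    · by_contra h
      have := T.adj_of_neg h
      rw [T.face_face_face] at this
      exact T.not_adj_sink _ this
  obtain ⟨r, hr⟩ := hr
  obtain ⟨P, δ, -, -, -⟩ := T.exists_predual dart next r hturn0 hwire hout0 hinp0 (by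
    have := hwire (.inl (.prod r))
    rw [Port.wire_inl] at this
    rw [this, ← T.opp_opp T.root, ← hr]
    rfl)
  exact ⟨C, Pr, P, ⟨δ⟩⟩

end Triangulation

/-! ### Isomorphisms on the two sides of the duality. -/

section Isomorphisms

variable {C Pr C' Pr' D D' : Type u}

/-- Relabelling of the operators, on the ports. -/
def Port.mapEquiv (f : C ≃ C') (g : Pr ≃ Pr') : Port C Pr ≃ Port C' Pr' where
  toFun := Sum.map (Out.map f g) (Inp.map f g)
  invFun := Sum.map (Out.map f.symm g.symm) (Inp.map f.symm g.symm)
  left_inv := by rintro ((c | c | p) | (c | p | p)) <;> simp [Out.map, Inp.map]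
  right_inv := by rintro ((c | c | p) | (c | p | p)) <;> simp [Out.map, Inp.map]

/-- The input of a coproduct is the only kind of port that is an input followed by two outputs. -/
theorem Port.eq_cop_of_commute {κ : Port C Pr ≃ Port C' Pr'}
    (h : ∀ a, κ (Port.turn C Pr a) = Port.turn C' Pr' (κ a))
    (hs : ∀ a, (κ a).isRight = a.isRight) (c : C) : ∃ c', κ (.inr (.cop c)) = .inr (.cop c') := by
  have h1 := hs (.inr (.cop c))
  have h2 := hs (Port.turn C Pr (.inr (.cop c)))
  have h3 := hs (Port.turn C Pr (Port.turn C Pr (.inr (.cop c))))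
  rw [h] at h2
  rw [h, h] at h3
  rcases hk : κ (.inr (.cop c)) with ((d | d | d) | (d | d | d)) <;> rw [hk] at h1 h2 h3 <;>
    first
    | exact ⟨d, rfl⟩
    | exact absurd h1 Bool.noConfusion
    | exact absurd h2 Bool.noConfusion
    | exact absurd h3 Bool.noConfusion

theorem Port.eq_prod_of_commute {κ : Port C Pr ≃ Port C' Pr'}
    (h : ∀ a, κ (Port.turn C Pr a) = Port.turn C' Pr' (κ a))
    (hs : ∀ a, (κ a).isRight = a.isRight) (p : Pr) :
    ∃ p', κ (.inl (.prod p)) = .inl (.prod p') := by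
  have h1 := hs (.inl (.prod p))
  have h2 := hs (Port.turn C Pr (.inl (.prod p)))
  have h3 := hs (Port.turn C Pr (Port.turn C Pr (.inl (.prod p))))
  rw [h] at h2
  rw [h, h] at h3
  rcases hk : κ (.inl (.prod p)) with ((d | d | d) | (d | d | d)) <;> rw [hk] at h1 h2 h3 <;>
    first
    | exact ⟨d, rfl⟩
    | exact absurd h1 Bool.noConfusion
    | exact absurd h2 Bool.noConfusion
    | exact absurd h3 Bool.noConfusion

/-- A bijection of ports that commutes with the rotation around the operators and distinguishes
inputs from outputs comes from a relabelling of the operators. -/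
theorem Port.exists_eq_mapEquiv {κ : Port C Pr ≃ Port C' Pr'}
    (h : ∀ a, κ (Port.turn C Pr a) = Port.turn C' Pr' (κ a))
    (hs : ∀ a, (κ a).isRight = a.isRight) :
    ∃ (f : C ≃ C') (g : Pr ≃ Pr'), ∀ a, κ a = Port.mapEquiv f g a := by
  have h' : ∀ a, κ.symm (Port.turn C' Pr' a) = Port.turn C Pr (κ.symm a) := fun a => by
    rw [Equiv.symm_apply_eq, h, Equiv.apply_symm_apply]
  have hs' : ∀ a, (κ.symm a).isRight = a.isRight := fun a => by
    rw [← hs, Equiv.apply_symm_apply]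
  choose f hf using Port.eq_cop_of_commute h hs
  choose f' hf' using Port.eq_cop_of_commute h' hs'
  choose g hg using Port.eq_prod_of_commute h hs
  choose g' hg' using Port.eq_prod_of_commute h' hs'
  refine ⟨⟨f, f', fun c => ?_, fun c => ?_⟩, ⟨g, g', fun c => ?_, fun c => ?_⟩, ?_⟩
  · have := hf' (f c)
    rw [← hf, Equiv.symm_apply_apply] at this
    simpa using this.symm
  · have := hf (f' c)
    rw [← hf', Equiv.apply_symm_apply] at this
    simpa using this.symm
  · have := hg' (g c)
    rw [← hg, Equiv.symm_apply_apply] at this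
    simpa using this.symm
  · have := hg (g' c)
    rw [← hg', Equiv.apply_symm_apply] at this
    simpa using this.symm
  · have hf1 : ∀ c, κ (.inl (.right c)) = .inl (.right (f c)) := fun c => by
      have := h (.inr (.cop c))
      rw [hf] at this
      exact this
    have hg1 : ∀ c, κ (.inr (.left c)) = .inr (.left (g c)) := fun c => by
      have := h (.inl (.prod c))
      rw [hg] at this
      exact this
    rintro ((c | c | p) | (c | p | p))
    · have := h (.inl (.right c))
      rw [hf1] at this
      exact this
    · exact hf1 c
    · exact hg p
    · exact hf c
    · exact hg1 p
    · have := h (.inr (.left p))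
      rw [hg1] at this
      exact this

variable {P : PCPrograph C Pr} {P' : PCPrograph C' Pr'} {T : Triangulation D}
  {T' : Triangulation D'}

theorem Duality.pos_iff (δ : Duality P T) (a : Port C Pr) :
    T.pos (δ.dart a) ↔ a.isRight = true := by
  rcases a with q | i
  · simpa using δ.pos_out q
  · simpa using δ.pos_inp i

theorem Duality.symm_face (δ : Duality P T) (d : D) :
    δ.dart.symm (T.face d) = Port.turn C Pr (δ.dart.symm d) := by
  rw [Equiv.symm_apply_eq, δ.dart_turn, Equiv.apply_symm_apply]

theorem Duality.symm_opp (δ : Duality P T) (d : D) :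
    δ.dart.symm (T.opp d) = Port.wire P.next (δ.dart.symm d) := by
  rw [Equiv.symm_apply_eq, δ.dart_wire, Equiv.apply_symm_apply]

theorem Duality.opp_root (δ : Duality P T) :
    T.opp T.root = δ.dart (.inl (.prod P.root)) := by
  rw [← δ.dart_root, ← δ.dart_wire]
  simp

/-- The operators can be read off from the faces and the signs alone, so no condition on the gluing
of the triangles is needed. -/
theorem Duality.exists_relabelling (δ : Duality P T) (δ' : Duality P' T') (g : D ≃ D')
    (hf : ∀ d, T'.face (g d) = g (T.face d)) (hp : ∀ d, T'.pos (g d) ↔ T.pos d) :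
    ∃ (f : C ≃ C') (h : Pr ≃ Pr'), ∀ a, δ'.dart (Port.mapEquiv f h a) = g (δ.dart a) := by
  obtain ⟨f, h, hκ⟩ := Port.exists_eq_mapEquiv (κ := (δ.dart.trans g).trans δ'.dart.symm)
    (fun a => by simp [δ.dart_turn, ← hf, δ'.symm_face])
    (fun a => by rw [Bool.eq_iff_iff, ← δ'.pos_iff, ← δ.pos_iff, ← hp]; simp)
  exact ⟨f, h, fun a => by rw [← hκ]; simp⟩

/-- Duality is a bijection on isomorphism classes. -/
theorem Duality.isomorphic_iff (δ : Duality P T) (δ' : Duality P' T') :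
    P.Isomorphic P' ↔ T.Isomorphic T' := by
  constructor
  · rintro ⟨f, g, h1, h2⟩
    have hsymm : ∀ i, (Port.wire P'.next (.inr (Inp.map f g i))) =
        .inl (Out.map f g (P.next.symm i)) := fun i => by
      rw [Port.wire_inr, Sum.inl.injEq, Equiv.symm_apply_eq, h1, Equiv.apply_symm_apply]
    refine ⟨(δ.dart.symm.trans (Port.mapEquiv f g)).trans δ'.dart, fun d => ?_, fun d => ?_,
      fun d => ?_, ?_⟩
    · obtain ⟨a, rfl⟩ := δ.dart.surjective d
      simp only [Equiv.trans_apply, Equiv.symm_apply_apply, ← δ.dart_turn, ← δ'.dart_turn]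
      rcases a with ((c | c | p) | (c | p | p)) <;> rfl
    · obtain ⟨a, rfl⟩ := δ.dart.surjective d
      simp only [Equiv.trans_apply, Equiv.symm_apply_apply, ← δ.dart_wire, ← δ'.dart_wire]
      congr 1
      rcases a with q | i
      · exact congrArg Sum.inr (h1 q)
      · exact hsymm i
    · obtain ⟨a, rfl⟩ := δ.dart.surjective d
      simp only [Equiv.trans_apply, Equiv.symm_apply_apply, δ.pos_iff, δ'.pos_iff]
      rcases a with q | i <;> simp [Port.mapEquiv]
    · rw [← δ.dart_root, ← δ'.dart_root, h2]
      simp only [Equiv.trans_apply, Equiv.symm_apply_apply]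
      exact congrArg _ (congrArg Sum.inr (h1 (.prod P.root)))
  · rintro ⟨g, h1, h2, h3, h4⟩
    obtain ⟨f, h, hκ⟩ := δ.exists_relabelling δ' g h1 h3
    refine ⟨f, h, fun q => ?_, ?_⟩
    · have := hκ (Port.wire P.next (.inl q))
      rw [δ.dart_wire, ← h2, ← hκ, ← δ'.dart_wire] at this
      simpa [Port.mapEquiv] using (δ'.dart.injective this).symm
    · have := hκ (.inl (.prod P.root))
      rw [← δ.opp_root, ← h2, ← h4, δ'.opp_root] at this
      simpa [Port.mapEquiv, Out.map] using (δ'.dart.injective this).symm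

end Isomorphisms

/-! ### Flips of maps with triangular faces. -/

section Flips

/-- The effect of a flip at the edge of the dart `d` on the faces: `f` and `o` are the face
permutation and the edge involution before the flip, `f'` is the face permutation afterwards, the
darts being renamed by `g`. -/
def FlipEqs {D D' : Type*} (f o : Equiv.Perm D) (d : D) (f' : Equiv.Perm D') (g : D ≃ D') : Prop :=
  f' (g d) = g (f (f d)) ∧ f' (g (f (f d))) = g (f (o d)) ∧ f' (g (f (o d))) = g d ∧
  f' (g (o d)) = g (f (f (o d))) ∧ f' (g (f (f (o d)))) = g (f d) ∧ f' (g (f d)) = g (o d) ∧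
  ∀ x, x ≠ d → x ≠ f d → x ≠ f (f d) → x ≠ o d → x ≠ f (o d) → x ≠ f (f (o d)) →
    f' (g x) = g (f x)

/-- The dart `d` of a map with triangular faces has two different faces on its sides. -/
structure TwoTriangles {D : Type*} (f o : Equiv.Perm D) (d : D) : Prop where
  opp_opp : ∀ x, o (o x) = x
  opp_ne : o d ≠ d
  face_ne : ∀ x, f x ≠ x
  face_face_face : ∀ x, f (f (f x)) = x
  opp_ne_face : o d ≠ f d
  opp_ne_face_face : o d ≠ f (f d)

theorem TwoTriangles.pairwise {D : Type*} {f o : Equiv.Perm D} {d : D} (h : TwoTriangles f o d) :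
    [d, f d, f (f d), o d, f (o d), f (f (o d))].Nodup := by
  have h1 := h.opp_ne
  have h2 := h.opp_ne_face
  have h3 := h.opp_ne_face_face
  have h4 := h.face_ne
  have h5 := h.face_face_face
  have e1 : ∀ x, f (f x) ≠ x := fun x e => h4 x (by rw [← e, h5, e])
  have e2 : ∀ x y, f x = y → x = f (f y) := fun x y e => by rw [← e, h5]
  simp only [List.nodup_cons, List.mem_cons, List.not_mem_nil, or_false, not_or, not_false_eq_true,
    List.nodup_nil, and_true]
  refine ⟨⟨(h4 _).symm, (e1 _).symm, h1.symm, fun e => h3 (e2 _ _ e.symm), fun e => h2 ?_⟩,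
    ⟨(h4 _).symm, h2.symm, fun e => h1 (f.injective e.symm), fun e => h3 ?_⟩,
    ⟨h3.symm, fun e => h2 (f.injective e.symm), fun e => h1 (f.injective (f.injective e.symm))⟩,
    ⟨(h4 _).symm, (e1 _).symm⟩, (h4 _).symm⟩
  · have := congrArg f e
    rw [h5] at this
    exact this.symm
  · rw [e, h5]

theorem FlipEqs.opp {D D' : Type*} {f o : Equiv.Perm D} {d : D} {f' : Equiv.Perm D'} {g : D ≃ D'}
    (h : FlipEqs f o d f' g) (ho : ∀ x, o (o x) = x) : FlipEqs f o (o d) f' g := by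
  obtain ⟨h1, h2, h3, h4, h5, h6, h7⟩ := h
  refine ⟨h4, by rw [ho]; exact h5, by rw [ho]; exact h6, by rw [ho]; exact h1,
    by rw [ho]; exact h2, by rw [ho]; exact h3, fun x => ?_⟩
  rw [ho]
  exact fun e1 e2 e3 e4 e5 e6 => h7 x e4 e5 e6 e1 e2 e3

theorem TwoTriangles.ne {D : Type*} {f o : Equiv.Perm D} {d : D} (h : TwoTriangles f o d) :
    (d ≠ f d ∧ d ≠ f (f d) ∧ d ≠ o d ∧ d ≠ f (o d) ∧ d ≠ f (f (o d))) ∧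
      (f d ≠ f (f d) ∧ f d ≠ o d ∧ f d ≠ f (o d) ∧ f d ≠ f (f (o d))) ∧
      (f (f d) ≠ o d ∧ f (f d) ≠ f (o d) ∧ f (f d) ≠ f (f (o d))) ∧
      (o d ≠ f (o d) ∧ o d ≠ f (f (o d))) ∧ f (o d) ≠ f (f (o d)) := by
  simpa using h.pairwise

variable {D D' : Type u} {f o : Equiv.Perm D} {d : D} {f' o' : Equiv.Perm D'} {g : D ≃ D'}

/-- The vertices after a flip are those before it. -/
theorem FlipEqs.exists_vertex_equiv (h : FlipEqs f o d f' g) (hd : TwoTriangles f o d)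
    (hg : ∀ x, o' (g x) = g (o x)) :
    ∃ k : Quotient (Equiv.Perm.SameCycle.setoid (vertexPerm f' o')) ≃
        Quotient (Equiv.Perm.SameCycle.setoid (vertexPerm f o)),
      (∀ x, x ≠ d → x ≠ o d → k (Quotient.mk _ (g x)) = Quotient.mk _ x) ∧
      k (Quotient.mk _ (g d)) = Quotient.mk _ (f (f (o d))) ∧
      k (Quotient.mk _ (g (o d))) = Quotient.mk _ (f (f d)) := by
  classical
  obtain ⟨⟨n1, n2, n3, n4, n5⟩, ⟨n6, n7, n8, n9⟩, ⟨n10, n11, n12⟩, ⟨n13, n14⟩, n15⟩ := hd.ne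
  have ho := hd.opp_opp
  have hf := hd.face_face_face
  obtain ⟨h1, h2, h3, h4, h5, h6, h7⟩ := h
  let mkV : D → Quotient (Equiv.Perm.SameCycle.setoid (vertexPerm f o)) := Quotient.mk _
  let mkV' : D' → Quotient (Equiv.Perm.SameCycle.setoid (vertexPerm f' o')) := Quotient.mk _
  have mk_opp : ∀ y, mkV (o y) = mkV (f y) := mk_opp_eq f o
  have mk_opp' : ∀ y, mkV' (g (o y)) = mkV' (f' (g y)) := fun y => by
    rw [← hg]; exact mk_opp_eq f' o' (g y)
  have eqd : ∀ y, o y = d → y = o d := fun y e => by rw [← e, ho]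
  have eqo : ∀ y, o y = o d → y = d := fun y e => o.injective e
  have eqf : ∀ x y, f x = y → x = f (f y) := fun x y e => by rw [← e, hf]
  -- Every dart keeps its origin, except that the new diagonal runs between the two corners opposite
  -- to the old one. `H` is the inverse assignment, naming the two old end points by darts that
  -- survive the flip.
  let K : D → Quotient (Equiv.Perm.SameCycle.setoid (vertexPerm f o)) := fun x =>
    if x = d then mkV (f (f (o d))) else if x = o d then mkV (f (f d)) else mkV x
  have Kd : K d = mkV (f (f (o d))) := if_pos rfl
  have Ko : K (o d) = mkV (f (f d)) := by simp [K, n3.symm]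
  have Kx : ∀ x, x ≠ d → x ≠ o d → K x = mkV x := fun x e1 e2 => by
    simp only [K]; rw [if_neg e1, if_neg e2]
  let H : D → Quotient (Equiv.Perm.SameCycle.setoid (vertexPerm f' o')) := fun x =>
    if x = d then mkV' (g (f (o d))) else if x = o d then mkV' (g (f d)) else mkV' (g x)
  have Hd : H d = mkV' (g (f (o d))) := if_pos rfl
  have Ho : H (o d) = mkV' (g (f d)) := by simp [H, n3.symm]
  have Hx : ∀ x, x ≠ d → x ≠ o d → H x = mkV' (g x) := fun x e1 e2 => by
    simp only [H]; rw [if_neg e1, if_neg e2]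
  have onotin : ∀ y, y ≠ d → y ≠ o d → o y ≠ d ∧ o y ≠ o d := fun y e1 e2 =>
    ⟨fun e => e2 (eqd y e), fun e => e1 (eqo y e)⟩
  have hK : ∀ y, K (g.symm (o' y)) = K (g.symm (f' y)) := by
    intro y
    obtain ⟨y, rfl⟩ := g.surjective y
    rw [hg, Equiv.symm_apply_apply]
    by_cases e1 : y = d
    · rw [e1, h1, Equiv.symm_apply_apply, Ko, Kx _ n2.symm n10]
    by_cases e2 : y = o d
    · rw [e2, h4, Equiv.symm_apply_apply, ho, Kd, Kx _ n5.symm n14.symm]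
    obtain ⟨o1, o2⟩ := onotin y e1 e2
    rw [Kx _ o1 o2, mk_opp]
    by_cases e3 : y = f d
    · rw [e3, h6, Equiv.symm_apply_apply, Ko]
    by_cases e4 : y = f (f d)
    · rw [e4, h2, Equiv.symm_apply_apply, hf, Kx _ n4.symm n13.symm, ← mk_opp, ho]
    by_cases e5 : y = f (o d)
    · rw [e5, h3, Equiv.symm_apply_apply, Kd]
    by_cases e6 : y = f (f (o d))
    · rw [e6, h5, Equiv.symm_apply_apply, hf, Kx _ n1.symm n7, mk_opp]
    · rw [h7 y e1 e3 e4 e2 e5 e6, Equiv.symm_apply_apply, Kx]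
      · exact fun e => e4 (eqf _ _ e)
      · exact fun e => e6 (eqf _ _ e)
  have hH : ∀ y, H (o y) = H (f y) := by
    intro y
    by_cases e1 : y = d
    · rw [e1, Ho, Hx _ n1.symm n7]
    by_cases e2 : y = o d
    · rw [e2, ho, Hd, Hx _ n4.symm n13.symm]
    obtain ⟨o1, o2⟩ := onotin y e1 e2
    rw [Hx _ o1 o2, mk_opp']
    by_cases e3 : y = f d
    · rw [e3, h6, Hx _ n2.symm n10, ← h1, ← mk_opp']
    by_cases e4 : y = f (f d)
    · rw [e4, h2, hf, Hd]
    by_cases e5 : y = f (o d)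
    · rw [e5, h3, Hx _ n5.symm n14.symm, ← h4, ← mk_opp', ho]
    by_cases e6 : y = f (f (o d))
    · rw [e6, h5, hf, Ho]
    · rw [h7 y e1 e3 e4 e2 e5 e6, Hx]
      · exact fun e => e4 (eqf _ _ e)
      · exact fun e => e6 (eqf _ _ e)
  obtain ⟨k, hk⟩ := exists_vertex_lift (fun y => K (g.symm y)) hK
  obtain ⟨l, hl⟩ := exists_vertex_lift H hH
  have kx : ∀ x, k (mkV' (g x)) = K x := fun x => by
    have := hk (g x)
    rwa [Equiv.symm_apply_apply] at this
  have lx : ∀ x, l (mkV x) = H x := hl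
  refine ⟨⟨k, l, ?_, ?_⟩, fun x e1 e2 => (kx x).trans (Kx x e1 e2), (kx _).trans Kd,
    (kx _).trans Ko⟩
  · intro q
    induction q using Quotient.inductionOn with | h y =>
    obtain ⟨x, rfl⟩ := g.surjective y
    change l (k (mkV' (g x))) = mkV' (g x)
    rw [kx]
    by_cases e1 : x = d
    · rw [e1, Kd, lx, Hx _ n5.symm n14.symm, ← h4, ← mk_opp', ho]
    by_cases e2 : x = o d
    · rw [e2, Ko, lx, Hx _ n2.symm n10, ← h1, ← mk_opp']
    · rw [Kx x e1 e2, lx, Hx x e1 e2]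
  · intro q
    induction q using Quotient.inductionOn with | h x =>
    change k (l (mkV x)) = mkV x
    rw [lx]
    by_cases e1 : x = d
    · rw [e1, Hd, kx, Kx _ n4.symm n13.symm, ← mk_opp, ho]
    by_cases e2 : x = o d
    · rw [e2, Ho, kx, Kx _ n1.symm n7, ← mk_opp]
    · rw [Hx x e1 e2, kx, Kx x e1 e2]

/-- Vertices and edges correspond to those before the flip and the number of faces is assumed equal,
so the Euler characteristic does not change. -/
theorem FlipEqs.isSphereMap (h : FlipEqs f o d f' g) (hd : TwoTriangles f o d)
    (hg : ∀ x, o' (g x) = g (o x)) (hF : orbitCount f' = orbitCount f) (hs : IsSphereMap f o) :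
    IsSphereMap f' o' := by
  obtain ⟨k, -⟩ := h.exists_vertex_equiv hd hg
  obtain ⟨hs1, hs2⟩ := hs
  constructor
  · rw [transitive_iff] at hs1 ⊢
    intro p p1 p2 x y hx
    obtain ⟨h1, h2, h3, h4, h5, h6, h7⟩ := h
    have q2 : ∀ x, p (g (o x)) ↔ p (g x) := fun x => by rw [← hg, p2]
    have q1 : ∀ x, p (g (f x)) ↔ p (g x) := by
      intro x
      -- The two new triangles and the new diagonal connect all six darts of the quadrilateral,
      -- hence connect whatever the old triangles connected.
      have r1 := p1 (g d)
      have r2 := p1 (g (f (f d)))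
      have r3 := p1 (g (o d))
      have r4 := p1 (g (f (f (o d))))
      have r5 := q2 d
      rw [h1] at r1
      rw [h2] at r2
      rw [h4] at r3
      rw [h5] at r4
      by_cases e1 : x = d
      · rw [e1]; tauto
      by_cases e2 : x = f d
      · rw [e2]; tauto
      by_cases e3 : x = f (f d)
      · rw [e3, hd.face_face_face]; tauto
      by_cases e4 : x = o d
      · rw [e4]; tauto
      by_cases e5 : x = f (o d)
      · rw [e5]; tauto
      by_cases e6 : x = f (f (o d))
      · rw [e6, hd.face_face_face]; tauto
      · rw [← h7 x e1 e2 e3 e4 e5 e6, p1]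
    have := hs1 (fun x => p (g x)) q1 q2 (g.symm x) (g.symm y) (by simpa using hx)
    simpa using this
  · have e1 : orbitCount (o' * f'⁻¹) = orbitCount (o * f⁻¹) := Nat.card_congr k
    have e2 : orbitCount o = orbitCount o' := orbitCount_congr g (fun x => (hg x).symm)
    rw [hF, e1, ← e2, hs2]

/-- A flip is undone by a flip. -/
theorem FlipEqs.symm [DecidableEq D] (h : FlipEqs f o d f' g) (hd : TwoTriangles f o d)
    (hg : ∀ x, o' (g x) = g (o x)) :
    FlipEqs f' o' (g d) f (g.symm.trans (Equiv.swap d (o d))) := by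
  obtain ⟨⟨n1, n2, n3, n4, n5⟩, ⟨n6, n7, n8, n9⟩, ⟨n10, n11, n12⟩, ⟨n13, n14⟩, n15⟩ := hd.ne
  have hf := hd.face_face_face
  obtain ⟨h1, h2, h3, h4, h5, h6, h7⟩ := h
  -- Two flips in the same sense turn the diagonal by half a turn; this is why its two darts are
  -- exchanged in the statement.
  have sw : ∀ x, x ≠ d → x ≠ o d → Equiv.swap d (o d) x = x := fun x =>
    Equiv.swap_apply_of_ne_of_ne
  simp only [FlipEqs, Equiv.trans_apply, hg, h1, h2, h4, h5, Equiv.symm_apply_apply,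
    Equiv.swap_apply_left, Equiv.swap_apply_right, sw _ n1.symm n7, sw _ n2.symm n10,
    sw _ n4.symm n13.symm, sw _ n5.symm n14.symm, hf, true_and]
  intro x e1 e2 e3 e4 e5 e6
  obtain ⟨x, rfl⟩ := g.surjective x
  have i : ∀ y, g x ≠ g y → x ≠ y := fun y e e' => e (congrArg g e')
  have eqf : ∀ x y, f x = y → x = f (f y) := fun x y e => by rw [← e, hf]
  rw [h7 x (i _ e1) (i _ e6) (i _ e2) (i _ e4) (i _ e3) (i _ e5), Equiv.symm_apply_apply,
    Equiv.symm_apply_apply, sw _ (i _ e1) (i _ e4), sw]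
  · exact fun e => i _ e2 (eqf _ _ e)
  · exact fun e => i _ e5 (eqf _ _ e)

theorem FlipEqs.twoTriangles (h : FlipEqs f o d f' g) (hd : TwoTriangles f o d)
    (hg : ∀ x, o' (g x) = g (o x)) (hne : ∀ x, f' x ≠ x) (hf' : ∀ x, f' (f' (f' x)) = x) :
    TwoTriangles f' o' (g d) := by
  obtain ⟨⟨n1, n2, n3, n4, n5⟩, ⟨n6, n7, n8, n9⟩, ⟨n10, n11, n12⟩, ⟨n13, n14⟩, n15⟩ := hd.ne
  refine ⟨fun x => ?_, ?_, hne, hf', ?_, ?_⟩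
  · obtain ⟨x, rfl⟩ := g.surjective x
    rw [hg, hg, hd.opp_opp]
  · rw [hg]; exact fun e => n3.symm (g.injective e)
  · rw [hg, h.1]; exact fun e => n10.symm (g.injective e)
  · rw [hg, h.1, h.2.1]; exact fun e => n13 (g.injective e)

end Flips

/-! ### Cyclic permutations of four elements. -/

section FourCycles

variable {X : Type*}

open Classical in
/-- The cyclic permutation of four elements. -/
noncomputable def fourCycle (p q r s : X) : Equiv.Perm X :=
  Equiv.swap p q * Equiv.swap q r * Equiv.swap r s

variable {p q r s : X}

theorem fourCycle_fst (h1 : p ≠ q) (h2 : p ≠ r) (h3 : p ≠ s) : fourCycle p q r s p = q := by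
  simp [fourCycle, Equiv.swap_apply_def, h1, h2, h3]

theorem fourCycle_snd (h1 : p ≠ r) (h2 : q ≠ r) (h3 : q ≠ s) : fourCycle p q r s q = r := by
  simp [fourCycle, Equiv.swap_apply_def, h1.symm, h2.symm, h2, h3]

theorem fourCycle_trd (h1 : p ≠ s) (h2 : q ≠ s) (h3 : r ≠ s) : fourCycle p q r s r = s := by
  simp [fourCycle, Equiv.swap_apply_def, h1.symm, h2.symm, h3.symm]

theorem fourCycle_fth : fourCycle p q r s s = p := by
  simp [fourCycle]

theorem fourCycle_of_ne {x : X} (h1 : x ≠ p) (h2 : x ≠ q) (h3 : x ≠ r) (h4 : x ≠ s) :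
    fourCycle p q r s x = x := by
  simp [fourCycle, Equiv.swap_apply_def, h1, h2, h3, h4]

theorem fourCycle_symm_fst : (fourCycle p q r s).symm p = s := by
  rw [Equiv.symm_apply_eq, fourCycle_fth]

theorem fourCycle_symm_snd (h1 : p ≠ q) (h2 : p ≠ r) (h3 : p ≠ s) :
    (fourCycle p q r s).symm q = p := by
  rw [Equiv.symm_apply_eq, fourCycle_fst h1 h2 h3]

theorem fourCycle_symm_trd (h1 : p ≠ r) (h2 : q ≠ r) (h3 : q ≠ s) :
    (fourCycle p q r s).symm r = q := by
  rw [Equiv.symm_apply_eq, fourCycle_snd h1 h2 h3]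

theorem fourCycle_symm_fth (h1 : p ≠ s) (h2 : q ≠ s) (h3 : r ≠ s) :
    (fourCycle p q r s).symm s = r := by
  rw [Equiv.symm_apply_eq, fourCycle_trd h1 h2 h3]

theorem fourCycle_symm_of_ne {x : X} (h1 : x ≠ p) (h2 : x ≠ q) (h3 : x ≠ r) (h4 : x ≠ s) :
    (fourCycle p q r s).symm x = x := by
  rw [Equiv.symm_apply_eq, fourCycle_of_ne h1 h2 h3 h4]

end FourCycles

/-! ### The rotation rules as permutations of the ports. -/

section Rules

variable {C Pr : Type u}

/-- The edge before and the edge after a rotation, given by their ports, and the bijection that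
sends each side of a triangle after the flip of the dual edge to the same side before it. -/
inductive RuleData : Rule → Out C Pr → Inp C Pr → Out C Pr → Inp C Pr →
    Equiv.Perm (Port C Pr) → Prop
  | IVtoI (x y : C) (h : x ≠ y) : RuleData .IVtoI (.right x) (.cop y) (.left x) (.cop y)
      (fourCycle (.inl (.right y)) (.inl (.left y)) (.inl (.left x)) (.inl (.right x)))
  | VIIItoIX (y z : Pr) (h : y ≠ z) : RuleData .VIIItoIX (.prod z) (.left y) (.prod z) (.right y)
      (fourCycle (.inr (.left z)) (.inr (.right z)) (.inr (.right y)) (.inr (.left y)))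
  | IIItoVII (x : C) (y : Pr) : RuleData .IIItoVII (.left x) (.right y) (.prod y) (.cop x)
      (fourCycle (.inr (.cop x)) (.inl (.left x)) (.inl (.prod y)) (.inr (.right y)))
  | VIItoV (x : C) (y : Pr) : RuleData .VIItoV (.prod y) (.cop x) (.right x) (.left y)
      (fourCycle (.inl (.prod y)) (.inl (.right x)) (.inr (.cop x)) (.inr (.left y)))

variable {r : Rule} {e e' : Out C Pr} {j j' : Inp C Pr} {ψ : Equiv.Perm (Port C Pr)}

/-- The rules within one kind of operator keep the sign of the dart of the diagonal, the two mixed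
rules reverse it. -/
theorem RuleData.apply_edge (h : RuleData r e j e' j' ψ) :
    (ψ (.inl e') = .inl e ∧ ψ (.inr j') = .inr j) ∨
      (ψ (.inl e') = .inr j ∧ ψ (.inr j') = .inl e) := by
  cases h with
  | IVtoI x y h =>
    exact .inl ⟨fourCycle_trd (by simp [h.symm]) (by simp) (by simp),
      fourCycle_of_ne (by simp) (by simp) (by simp) (by simp)⟩
  | VIIItoIX y z h =>
    exact .inl ⟨fourCycle_of_ne (by simp) (by simp) (by simp) (by simp),
      fourCycle_trd (by simp [h.symm]) (by simp) (by simp)⟩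
  | IIItoVII x y =>
    exact .inr ⟨fourCycle_trd (by simp) (by simp) (by simp),
      fourCycle_fst (by simp) (by simp) (by simp)⟩
  | VIItoV x y =>
    exact .inr ⟨fourCycle_snd (by simp) (by simp) (by simp), fourCycle_fth⟩

theorem RuleData.isRight_apply (h : RuleData r e j e' j' ψ) (a : Port C Pr) (h1 : a ≠ .inl e')
    (h2 : a ≠ .inr j') : (ψ a).isRight = a.isRight := by
  have key : ∀ {p q r s a : Port C Pr}, p ≠ q → p ≠ r → p ≠ s → q ≠ r → q ≠ s → r ≠ s →
      (a = p → q.isRight = a.isRight) → (a = q → r.isRight = a.isRight) →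
      (a = r → s.isRight = a.isRight) → (a = s → p.isRight = a.isRight) →
      (fourCycle p q r s a).isRight = a.isRight := by
    intro p q r s a n1 n2 n3 n4 n5 n6 i1 i2 i3 i4
    by_cases a1 : a = p
    · rw [← i1 a1, a1, fourCycle_fst n1 n2 n3]
    by_cases a2 : a = q
    · rw [← i2 a2, a2, fourCycle_snd n2 n4 n5]
    by_cases a3 : a = r
    · rw [← i3 a3, a3, fourCycle_trd n3 n5 n6]
    by_cases a4 : a = s
    · rw [← i4 a4, a4, fourCycle_fth]
    rw [fourCycle_of_ne a1 a2 a3 a4]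
  cases h with
  | IVtoI x y h =>
    refine key (by simp) (by simp) (by simp [h.symm]) (by simp [h.symm]) (by simp) (by simp)
      ?_ ?_ ?_ ?_ <;> rintro rfl <;> rfl
  | VIIItoIX y z h =>
    refine key (by simp) (by simp) (by simp [h.symm]) (by simp [h.symm]) (by simp) (by simp)
      ?_ ?_ ?_ ?_ <;> rintro rfl <;> rfl
  | IIItoVII x y =>
    refine key (by simp) (by simp) (by simp) (by simp) (by simp) (by simp)
      ?_ ?_ ?_ ?_ <;> rintro rfl <;> first | rfl | exact absurd rfl h1 | exact absurd rfl h2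
  | VIItoV x y =>
    refine key (by simp) (by simp) (by simp) (by simp) (by simp) (by simp)
      ?_ ?_ ?_ ?_ <;> rintro rfl <;> first | rfl | exact absurd rfl h1 | exact absurd rfl h2

theorem RuleData.twoTriangles (h : RuleData r e j e' j' ψ) {next : Out C Pr ≃ Inp C Pr}
    (hj : next e = j) : TwoTriangles (Port.turn C Pr) (Port.wire next) (.inl e) := by
  refine ⟨Port.wire_wire next, by simp, Port.turn_ne, Port.turn_turn_turn, ?_, ?_⟩ <;>
    rw [Port.wire_inl, hj] <;> cases h <;> simp_all [Port.turn] <;> tauto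

/-- The two new triangles are named by the same two operators, so turning around operators is the
face permutation both before and after the flip. In particular, the number of faces is trivially
preserved. -/
theorem RuleData.flipEqs (h : RuleData r e j e' j' ψ) {next : Out C Pr ≃ Inp C Pr}
    (hj : next e = j) :
    FlipEqs (Port.turn C Pr) (Port.wire next) (.inl e) (Port.turn C Pr) ψ.symm := by
  have sd : ∀ {p q r s : Port C Pr}, p ≠ q ∧ p ≠ r ∧ p ≠ s →
    (fourCycle p q r s).symm q = p := fun h => fourCycle_symm_snd h.1 h.2.1 h.2.2
  have tr : ∀ {p q r s : Port C Pr}, p ≠ r ∧ q ≠ r ∧ q ≠ s →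
    (fourCycle p q r s).symm r = q := fun h => fourCycle_symm_trd h.1 h.2.1 h.2.2
  have ft : ∀ {p q r s : Port C Pr}, p ≠ s ∧ q ≠ s ∧ r ≠ s →
    (fourCycle p q r s).symm s = r := fun h => fourCycle_symm_fth h.1 h.2.1 h.2.2
  have ne : ∀ {p q r s x : Port C Pr}, x ≠ p ∧ x ≠ q ∧ x ≠ r ∧ x ≠ s →
    (fourCycle p q r s).symm x = x := fun h => fourCycle_symm_of_ne h.1 h.2.1 h.2.2.1 h.2.2.2
  unfold FlipEqs
  rw [Port.wire_inl, hj]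
  cases h with
  | IVtoI x y h =>
    refine ⟨?_, ?_, ?_, ?_, ?_, ?_, ?_⟩
    iterate 6 simp [Port.turn, fourCycle_symm_fst, sd, tr, ft, ne, h, h.symm]
    rintro ((c | c | c) | (c | c | c)) <;> simp +contextual [Port.turn, ne, h, h.symm]
  | VIIItoIX y z h =>
    refine ⟨?_, ?_, ?_, ?_, ?_, ?_, ?_⟩
    iterate 6 simp [Port.turn, fourCycle_symm_fst, sd, tr, ft, ne, h, h.symm]
    rintro ((c | c | c) | (c | c | c)) <;> simp +contextual [Port.turn, ne, h, h.symm]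
  | IIItoVII x y =>
    refine ⟨?_, ?_, ?_, ?_, ?_, ?_, ?_⟩
    iterate 6 simp [Port.turn, fourCycle_symm_fst, sd, tr, ft, ne]
    rintro ((c | c | c) | (c | c | c)) <;> simp +contextual [Port.turn, ne]
  | VIItoV x y =>
    refine ⟨?_, ?_, ?_, ?_, ?_, ?_, ?_⟩
    iterate 6 simp [Port.turn, fourCycle_symm_fst, sd, tr, ft, ne]
    rintro ((c | c | c) | (c | c | c)) <;> simp +contextual [Port.turn, ne]

/-- An involution of the ports that exchanges inputs and outputs is given by wires. -/
theorem Port.exists_wire_eq (f : Port C Pr → Port C Pr) (h : ∀ a, f (f a) = a)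
    (hs : ∀ a, (f a).isRight = !a.isRight) :
    ∃ next : Out C Pr ≃ Inp C Pr, ∀ a, Port.wire next a = f a := by
  have h1 : ∀ q, ∃ i, f (.inl q) = .inr i := fun q => by
    have := hs (.inl q)
    rcases hq : f (.inl q) with q' | i
    · simp [hq] at this
    · exact ⟨i, rfl⟩
  have h2 : ∀ i, ∃ q, f (.inr i) = .inl q := fun i => by
    have := hs (.inr i)
    rcases hq : f (.inr i) with q' | i
    · exact ⟨q', rfl⟩
    · simp [hq] at this
  choose g hg using h1
  choose g' hg' using h2
  refine ⟨⟨g, g', fun q => ?_, fun i => ?_⟩, ?_⟩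
  · have := h (.inl q)
    rw [hg, hg'] at this
    simpa using this
  · have := h (.inr i)
    rw [hg', hg] at this
    simpa using this
  · rintro (q | i)
    exacts [(hg q).symm, (hg' i).symm]

/-- The new wires are the conjugate of the old ones by `ψ`. They still join outputs to inputs,
because `ψ` can mix the two only at the ends of the new edge, and these are joined to each other. -/
theorem Port.exists_relabelled (next : Out C Pr ≃ Inp C Pr)
    (hs : ∀ a, a ≠ .inl e' → a ≠ .inr j' → (ψ a).isRight = a.isRight)
    (he : Port.wire next (ψ (.inl e')) = ψ (.inr j')) :
    ∃ next' : Out C Pr ≃ Inp C Pr, next' e' = j' ∧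
      ∀ a, ψ (Port.wire next' a) = Port.wire next (ψ a) := by
  have hsw : ∀ a, (Port.wire next a).isRight = !a.isRight := by
    rintro (q | i) <;> simp
  have e1 : ψ.symm (Port.wire next (ψ (.inl e'))) = .inr j' := by
    rw [he, Equiv.symm_apply_apply]
  have e2 : ψ.symm (Port.wire next (ψ (.inr j'))) = .inl e' := by
    rw [← he, Port.wire_wire, Equiv.symm_apply_apply]
  obtain ⟨next', h⟩ := Port.exists_wire_eq (fun a => ψ.symm (Port.wire next (ψ a)))
    (fun a => by simp [Port.wire_wire]) (fun a => by
      by_cases h1 : a = .inl e'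
      · simp only [h1, e1]; rfl
      by_cases h2 : a = .inr j'
      · simp only [h2, e2]; rfl
      · rw [← hs (ψ.symm (Port.wire next (ψ a))), Equiv.apply_symm_apply, hsw, hs a h1 h2]
        · intro h
          apply h2
          rw [Equiv.symm_apply_eq] at h
          apply ψ.injective
          rw [← he, ← h, Port.wire_wire]
        · intro h
          apply h1
          rw [Equiv.symm_apply_eq, ← he] at h
          exact ψ.injective ((Port.wire next).injective h))
  refine ⟨next', ?_, fun a => by rw [h]; simp⟩
  have := h (.inl e')
  rw [e1] at this
  simpa using this

end Rules

/-! ### Rotations as conjugations of wires. -/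

section Rotations

variable {C Pr : Type u} {P P' : PCPrograph C Pr} {r : Rule} {e e' : Out C Pr}
  {ψ : Equiv.Perm (Port C Pr)}

/-- Wires are involutions exchanging inputs and outputs, so half of the ports suffice. -/
theorem Port.commute_of_out {next next' : Out C Pr ≃ Inp C Pr}
    (h : ∀ q, ψ (.inr (next' q)) = Port.wire next (ψ (.inl q))) (a : Port C Pr) :
    ψ (Port.wire next' a) = Port.wire next (ψ a) := by
  rcases a with q | i
  · exact h q
  · have := h (next'.symm i)
    rw [Equiv.apply_symm_apply] at this
    rw [this, Port.wire_wire]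
    rfl

theorem Port.commute_of_inp {next next' : Out C Pr ≃ Inp C Pr}
    (h : ∀ i, ψ (.inl (next'.symm i)) = Port.wire next (ψ (.inr i))) (a : Port C Pr) :
    ψ (Port.wire next' a) = Port.wire next (ψ a) := by
  rcases a with q | i
  · have := h (next' q)
    rw [Equiv.symm_apply_apply] at this
    rw [this, Port.wire_wire]
    rfl
  · exact h i

theorem PCPrograph.owner_ne {q : Out C Pr} (h : q ≠ .prod P.root) :
    q.owner ≠ (P.next q).owner := fun h' =>
  P.acyclic_arc _ (.single (h' ▸ P.arc_of_ne h : P.Arc q.owner q.owner))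

theorem PCPrograph.owner_ne_of_arc {q q' : Out C Pr} (h : q ≠ .prod P.root)
    (h' : q' ≠ .prod P.root) (hq : (P.next q).owner = q'.owner) : q.owner ≠ (P.next q').owner := by
  intro h2
  have a1 := P.arc_of_ne h
  have a2 := P.arc_of_ne h'
  rw [← h2, ← hq] at a2
  exact P.acyclic_arc _ ((Relation.TransGen.single a1).tail a2)

/-- A rotation transports the wires along the bijection of the ports given by the rule. -/
theorem rotates_iff : Rotates r P e P' e' ↔
    P'.root = P.root ∧ e ≠ .prod P.root ∧ e' ≠ .prod P'.root ∧ ∃ j' ψ,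
      RuleData r e (P.next e) e' j' ψ ∧
        ∀ a, ψ (Port.wire P'.next a) = Port.wire P.next (ψ a) := by
  unfold Rotates
  refine and_congr_right fun hr => and_congr_right fun he => and_congr_right fun he' => ?_
  cases r with
  | IVtoI =>
    have keys : ∀ x y : C, x ≠ y → P.next (.right x) = .cop y → ∃ ψ : Equiv.Perm (Port C Pr),
        ψ = fourCycle (.inl (.right y)) (.inl (.left y)) (.inl (.left x)) (.inl (.right x)) ∧
        ψ (.inr (.cop y)) = Port.wire P.next (ψ (.inl (.left x))) ∧
        ψ (.inr (P.next (.left x))) = Port.wire P.next (ψ (.inl (.left y))) ∧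
        ψ (.inr (P.next (.left y))) = Port.wire P.next (ψ (.inl (.right y))) ∧
        ψ (.inr (P.next (.right y))) = Port.wire P.next (ψ (.inl (.right x))) ∧
        ∀ q, q ≠ .left x → q ≠ .right x → q ≠ .left y → q ≠ .right y →
          ψ (.inr (P.next q)) = Port.wire P.next (ψ (.inl q)) := by
      intro x y hxy h1
      have fi : ∀ i, fourCycle (.inl (.right y)) (.inl (.left y)) (.inl (.left x))
          (.inl (.right x)) (.inr i : Port C Pr) = .inr i := fun i =>
        fourCycle_of_ne (by simp) (by simp) (by simp) (by simp)
      refine ⟨_, rfl, ?_, ?_, ?_, ?_, fun q e1 e2 e3 e4 => ?_⟩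
      · rw [fi, fourCycle_trd (by simp [hxy.symm]) (by simp) (by simp), Port.wire_inl, h1]
      · rw [fi, fourCycle_snd (by simp) (by simp [hxy.symm]) (by simp), Port.wire_inl]
      · rw [fi, fourCycle_fst (by simp) (by simp) (by simp [hxy.symm]), Port.wire_inl]
      · rw [fi, fourCycle_fth, Port.wire_inl]
      · rw [fi, fourCycle_of_ne (by simpa) (by simpa) (by simpa) (by simpa), Port.wire_inl]
    constructor
    · rintro ⟨x, y, rfl, rfl, h1, h2, h3, h4, h5, h6⟩
      have hxy : x ≠ y := fun h => P.owner_ne he (by rw [h1, h]; rfl)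
      obtain ⟨ψ, hψ, k1, k2, k3, k4, k5⟩ := keys x y hxy h1
      refine ⟨_, ψ, by rw [h1, hψ]; exact RuleData.IVtoI x y hxy, Port.commute_of_out fun q => ?_⟩
      by_cases e1 : q = .left x
      · rw [e1, h2, k1]
      by_cases e2 : q = .right x
      · rw [e2, h5, k4]
      by_cases e3 : q = .left y
      · rw [e3, h3, k2]
      by_cases e4 : q = .right y
      · rw [e4, h4, k3]
      rw [h6 q e1 e2 e3 e4, k5 q e1 e2 e3 e4]
    · rintro ⟨j', ψ, h, hc⟩
      generalize hj : P.next e = j at h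
      cases h with | IVtoI x y hxy =>
      obtain ⟨ψ, hψ, k1, k2, k3, k4, k5⟩ := keys x y hxy hj
      rw [← hψ] at hc
      have hc' : ∀ q i, ψ (.inr i) = Port.wire P.next (ψ (.inl q)) → P'.next q = i :=
        fun q i h => Sum.inr_injective (ψ.injective ((hc (.inl q)).trans h.symm))
      exact ⟨x, y, rfl, rfl, hj, hc' _ _ k1, hc' _ _ k2, hc' _ _ k3, hc' _ _ k4,
        fun q e1 e2 e3 e4 => hc' _ _ (k5 q e1 e2 e3 e4)⟩
  | VIIItoIX =>
    have keys : ∀ y z : Pr, y ≠ z → P.next (.prod z) = .left y → ∃ ψ : Equiv.Perm (Port C Pr),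
        ψ = fourCycle (.inr (.left z)) (.inr (.right z)) (.inr (.right y)) (.inr (.left y)) ∧
        ψ (.inl (.prod z)) = Port.wire P.next (ψ (.inr (.right y))) ∧
        ψ (.inl (P.prev (.left z))) = Port.wire P.next (ψ (.inr (.left y))) ∧
        ψ (.inl (P.prev (.right z))) = Port.wire P.next (ψ (.inr (.left z))) ∧
        ψ (.inl (P.prev (.right y))) = Port.wire P.next (ψ (.inr (.right z))) ∧
        ∀ i, i ≠ .left y → i ≠ .right y → i ≠ .left z → i ≠ .right z →
          ψ (.inl (P.prev i)) = Port.wire P.next (ψ (.inr i)) := by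
      intro y z hyz h1
      have fi : ∀ q, fourCycle (.inr (.left z)) (.inr (.right z)) (.inr (.right y))
          (.inr (.left y)) (.inl q : Port C Pr) = .inl q := fun q =>
        fourCycle_of_ne (by simp) (by simp) (by simp) (by simp)
      refine ⟨_, rfl, ?_, ?_, ?_, ?_, fun q e1 e2 e3 e4 => ?_⟩
      · rw [fi, fourCycle_trd (by simp [hyz.symm]) (by simp) (by simp), Port.wire_inr, ← h1,
          Equiv.symm_apply_apply]
      · rw [fi, fourCycle_fth, Port.wire_inr]; rfl
      · rw [fi, fourCycle_fst (by simp) (by simp) (by simp [hyz.symm]), Port.wire_inr]; rfl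
      · rw [fi, fourCycle_snd (by simp) (by simp [hyz.symm]) (by simp), Port.wire_inr]; rfl
      · rw [fi, fourCycle_of_ne (by simpa) (by simpa) (by simpa) (by simpa), Port.wire_inr]; rfl
    constructor
    · rintro ⟨y, z, rfl, rfl, h1, h2, h3, h4, h5, h6⟩
      have h1 : P.next (.prod z) = .left y := by
        rw [← h1]; exact P.next.apply_symm_apply _
      have hyz : y ≠ z := fun h => P.owner_ne he (by rw [h1, h]; rfl)
      obtain ⟨ψ, hψ, k1, k2, k3, k4, k5⟩ := keys y z hyz h1
      refine ⟨_, ψ, by rw [h1, hψ]; exact RuleData.VIIItoIX y z hyz, Port.commute_of_inp fun i => ?_⟩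
      change ψ (.inl (P'.prev i)) = _
      by_cases e1 : i = .left y
      · rw [e1, h3, k2]
      by_cases e2 : i = .right y
      · rw [e2, h2, k1]
      by_cases e3 : i = .left z
      · rw [e3, h4, k3]
      by_cases e4 : i = .right z
      · rw [e4, h5, k4]
      rw [h6 i e1 e2 e3 e4, k5 i e1 e2 e3 e4]
    · rintro ⟨j', ψ, h, hc⟩
      generalize hj : P.next e = j at h
      cases h with | VIIItoIX y z hyz =>
      obtain ⟨ψ, hψ, k1, k2, k3, k4, k5⟩ := keys y z hyz hj
      rw [← hψ] at hc
      have hc' : ∀ i q, ψ (.inl q) = Port.wire P.next (ψ (.inr i)) → P'.prev i = q :=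
        fun i q h => Sum.inl_injective (ψ.injective ((hc (.inr i)).trans h.symm))
      exact ⟨y, z, rfl, rfl, (Equiv.symm_apply_eq _).2 hj.symm, hc' _ _ k1, hc' _ _ k2, hc' _ _ k3,
        hc' _ _ k4, fun q e1 e2 e3 e4 => hc' _ _ (k5 q e1 e2 e3 e4)⟩
  | IIItoVII =>
    have keys : ∀ (x : C) (y : Pr), P.next (.prod y) ≠ .cop x → P.next (.left x) = .right y →
        ∃ ψ : Equiv.Perm (Port C Pr),
        ψ = fourCycle (.inr (.cop x)) (.inl (.left x)) (.inl (.prod y)) (.inr (.right y)) ∧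
        ψ (.inr (.cop x)) = Port.wire P.next (ψ (.inl (.prod y))) ∧
        ψ (.inr (.right y)) = Port.wire P.next (ψ (.inl (P.prev (.cop x)))) ∧
        ψ (.inr (P.next (.prod y))) = Port.wire P.next (ψ (.inl (.left x))) ∧
        ∀ q, q ≠ .prod y → q ≠ P.prev (.cop x) → q ≠ .left x →
          ψ (.inr (P.next q)) = Port.wire P.next (ψ (.inl q)) := by
      intro x y hxy h1
      have hp : P.next (P.prev (.cop x)) = .cop x := P.next.apply_symm_apply _
      refine ⟨_, rfl, ?_, ?_, ?_, fun q e1 e2 e3 => ?_⟩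
      · rw [fourCycle_fst (by simp) (by simp) (by simp), fourCycle_trd (by simp) (by simp) (by simp),
          Port.wire_inr, ← h1, Equiv.symm_apply_apply]
      · rw [fourCycle_fth, fourCycle_of_ne (by simp) ?_ ?_ (by simp), Port.wire_inl, hp]
        · intro h
          rw [Sum.inl_injective h, h1] at hp
          simp at hp
        · intro h
          rw [Sum.inl_injective h] at hp
          exact hxy hp
      · rw [fourCycle_snd (by simp) (by simp) (by simp), fourCycle_of_ne ?_ (by simp) (by simp) ?_,
          Port.wire_inl]
        · exact fun h => hxy (Sum.inr_injective h)
        · intro h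
          rw [← h1] at h
          simpa using Sum.inr_injective h
      · rw [fourCycle_of_ne ?_ (by simp) (by simp) ?_,
          fourCycle_of_ne (by simp) (by simpa) (by simpa) (by simp), Port.wire_inl]
        · intro h
          exact e2 ((Equiv.eq_symm_apply _).2 (Sum.inr_injective h))
        · intro h
          rw [← h1] at h
          exact e3 (P.next.injective (Sum.inr_injective h))
    constructor
    · rintro ⟨x, y, rfl, rfl, h1, h2, h3, h4, h5⟩
      -- Otherwise the rule would prescribe two different ends for the wire from `y`. In the
      -- converse direction, acyclicity excludes this case.
      have hxy : P.next (.prod y) ≠ .cop x := by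
        intro h
        rw [← h] at h3
        rw [PCPrograph.prev, Equiv.symm_apply_apply, h2] at h3
        simp at h3
      obtain ⟨ψ, hψ, k1, k2, k3, k4⟩ := keys x y hxy h1
      refine ⟨_, ψ, by rw [h1, hψ]; exact RuleData.IIItoVII x y, Port.commute_of_out fun q => ?_⟩
      by_cases e1 : q = .prod y
      · rw [e1, h2, k1]
      by_cases e2 : q = P.prev (.cop x)
      · rw [e2, h3, k2]
      by_cases e3 : q = .left x
      · rw [e3, h4, k3]
      rw [h5 q e1 e2 e3, k4 q e1 e2 e3]
    · rintro ⟨j', ψ, h, hc⟩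
      generalize hj : P.next e = j at h
      cases h with | IIItoVII x y =>
      have hxy : P.next (.prod y) ≠ .cop x := fun h =>
        P.owner_ne_of_arc he (q' := .prod y) (hr ▸ he') (by rw [hj]; rfl) (by rw [h]; rfl)
      obtain ⟨ψ, hψ, k1, k2, k3, k4⟩ := keys x y hxy hj
      rw [← hψ] at hc
      have hc' : ∀ q i, ψ (.inr i) = Port.wire P.next (ψ (.inl q)) → P'.next q = i :=
        fun q i h => Sum.inr_injective (ψ.injective ((hc (.inl q)).trans h.symm))
      exact ⟨x, y, rfl, rfl, hj, hc' _ _ k1, hc' _ _ k2, hc' _ _ k3,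
        fun q e1 e2 e3 => hc' _ _ (k4 q e1 e2 e3)⟩
  | VIItoV =>
    have keys : ∀ (x : C) (y : Pr), P.next (.right x) ≠ .left y → P.next (.prod y) = .cop x →
        ∃ ψ : Equiv.Perm (Port C Pr),
        ψ = fourCycle (.inl (.prod y)) (.inl (.right x)) (.inr (.cop x)) (.inr (.left y)) ∧
        ψ (.inr (.left y)) = Port.wire P.next (ψ (.inl (.right x))) ∧
        ψ (.inr (.cop x)) = Port.wire P.next (ψ (.inl (P.prev (.left y)))) ∧
        ψ (.inr (P.next (.right x))) = Port.wire P.next (ψ (.inl (.prod y))) ∧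
        ∀ q, q ≠ .right x → q ≠ P.prev (.left y) → q ≠ .prod y →
          ψ (.inr (P.next q)) = Port.wire P.next (ψ (.inl q)) := by
      intro x y hxy h1
      have hp : P.next (P.prev (.left y)) = .left y := P.next.apply_symm_apply _
      refine ⟨_, rfl, ?_, ?_, ?_, fun q e1 e2 e3 => ?_⟩
      · rw [fourCycle_fth, fourCycle_snd (by simp) (by simp) (by simp),
          Port.wire_inr, ← h1, Equiv.symm_apply_apply]
      · rw [fourCycle_trd (by simp) (by simp) (by simp), fourCycle_of_ne ?_ ?_ (by simp) (by simp),
          Port.wire_inl, hp]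
        · intro h
          rw [Sum.inl_injective h, h1] at hp
          simp at hp
        · intro h
          rw [Sum.inl_injective h] at hp
          exact hxy hp
      · rw [fourCycle_fst (by simp) (by simp) (by simp), fourCycle_of_ne (by simp) (by simp) ?_ ?_,
          Port.wire_inl]
        · intro h
          rw [← h1] at h
          simpa using Sum.inr_injective h
        · exact fun h => hxy (Sum.inr_injective h)
      · rw [fourCycle_of_ne (by simp) (by simp) ?_ ?_,
          fourCycle_of_ne (by simpa) (by simpa) (by simp) (by simp), Port.wire_inl]
        · intro h
          rw [← h1] at h
          exact e3 (P.next.injective (Sum.inr_injective h))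
        · intro h
          exact e2 ((Equiv.eq_symm_apply _).2 (Sum.inr_injective h))
    constructor
    · rintro ⟨x, y, rfl, rfl, h1, h2, h3, h4, h5⟩
      have hxy : P.next (.right x) ≠ .left y := by
        intro h
        rw [← h] at h3
        rw [PCPrograph.prev, Equiv.symm_apply_apply, h2] at h3
        simp at h3
      obtain ⟨ψ, hψ, k1, k2, k3, k4⟩ := keys x y hxy h1
      refine ⟨_, ψ, by rw [h1, hψ]; exact RuleData.VIItoV x y, Port.commute_of_out fun q => ?_⟩
      by_cases e1 : q = .right x
      · rw [e1, h2, k1]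
      by_cases e2 : q = P.prev (.left y)
      · rw [e2, h3, k2]
      by_cases e3 : q = .prod y
      · rw [e3, h4, k3]
      rw [h5 q e1 e2 e3, k4 q e1 e2 e3]
    · rintro ⟨j', ψ, h, hc⟩
      generalize hj : P.next e = j at h
      cases h with | VIItoV x y =>
      have hxy : P.next (.right x) ≠ .left y := fun h =>
        P.owner_ne_of_arc he (q' := .right x) (by simp) (by rw [hj]; rfl) (by rw [h]; rfl)
      obtain ⟨ψ, hψ, k1, k2, k3, k4⟩ := keys x y hxy hj
      rw [← hψ] at hc
      have hc' : ∀ q i, ψ (.inr i) = Port.wire P.next (ψ (.inl q)) → P'.next q = i :=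
        fun q i h => Sum.inr_injective (ψ.injective ((hc (.inl q)).trans h.symm))
      exact ⟨x, y, rfl, rfl, hj, hc' _ _ k1, hc' _ _ k2, hc' _ _ k3,
        fun q e1 e2 e3 => hc' _ _ (k4 q e1 e2 e3)⟩

variable {j j' : Inp C Pr}

theorem RuleData.next_eq (h : RuleData r e j e' j' ψ) {next next' : Out C Pr ≃ Inp C Pr}
    (hj : next e = j) (hc : ∀ a, ψ (Port.wire next' a) = Port.wire next (ψ a)) : next' e' = j' := by
  apply Sum.inr_injective
  apply ψ.injective
  have := hc (.inl e')
  rw [Port.wire_inl] at this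
  rw [this]
  rcases h.apply_edge with ⟨h1, h2⟩ | ⟨h1, h2⟩
  · rw [h1, h2, Port.wire_inl, hj]
  · rw [h1, h2, Port.wire_inr, ← hj, Equiv.symm_apply_apply]

theorem RuleData.eq_of_source (h : RuleData r e j e' j' ψ) {e₁ : Out C Pr} {j₁ : Inp C Pr}
    {ψ₁ : Equiv.Perm (Port C Pr)} (h₁ : RuleData r e j e₁ j₁ ψ₁) : e' = e₁ ∧ ψ = ψ₁ := by
  cases h <;> cases h₁ <;> exact ⟨rfl, rfl⟩

theorem RuleData.eq_of_target (h : RuleData r e j e' j' ψ) {e₁ : Out C Pr} {j₁ : Inp C Pr}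
    {ψ₁ : Equiv.Perm (Port C Pr)} (h₁ : RuleData r e₁ j₁ e' j' ψ₁) : e = e₁ ∧ ψ = ψ₁ := by
  cases h <;> cases h₁ <;> exact ⟨rfl, rfl⟩

theorem PCPrograph.eq_of_wire (h : ∀ a, Port.wire P.next a = Port.wire P'.next a)
    (hr : P.root = P'.root) : P = P' := by
  apply PCPrograph.ext _ hr
  ext q
  simpa using h (.inl q)

/-- The rule and the edge determine `ψ`, and `ψ` determines the new wires by conjugation. -/
theorem Rotates.eq_of_source (h : Rotates r P e P' e') {P₁ : PCPrograph C Pr} {e₁ : Out C Pr}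
    (h₁ : Rotates r P e P₁ e₁) : P' = P₁ ∧ e' = e₁ := by
  obtain ⟨hr, -, -, j', ψ, hd, hc⟩ := rotates_iff.1 h
  obtain ⟨hr₁, -, -, j₁, ψ₁, hd₁, hc₁⟩ := rotates_iff.1 h₁
  obtain ⟨rfl, rfl⟩ := hd.eq_of_source hd₁
  exact ⟨PCPrograph.eq_of_wire (fun a => ψ.injective ((hc a).trans (hc₁ a).symm))
    (hr.trans hr₁.symm), rfl⟩

theorem Rotates.eq_of_target (h : Rotates r P e P' e') {P₁ : PCPrograph C Pr} {e₁ : Out C Pr}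
    (h₁ : Rotates r P₁ e₁ P' e') : P = P₁ ∧ e = e₁ := by
  obtain ⟨hr, -, -, j', ψ, hd, hc⟩ := rotates_iff.1 h
  obtain ⟨hr₁, -, -, j₁, ψ₁, hd₁, hc₁⟩ := rotates_iff.1 h₁
  have e1 := hd.next_eq rfl hc
  have e2 := hd₁.next_eq rfl hc₁
  subst e1 e2
  obtain ⟨rfl, rfl⟩ := hd.eq_of_target hd₁
  refine ⟨PCPrograph.eq_of_wire (fun a => ?_) (hr.symm.trans hr₁), rfl⟩
  have := (hc (ψ.symm a)).symm.trans (hc₁ (ψ.symm a))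
  rwa [Equiv.apply_symm_apply] at this

theorem RuleData.edgeType_source (h : RuleData r e (P.next e) e' j' ψ) :
    P.edgeType e = r.source := by
  unfold PCPrograph.edgeType
  generalize P.next e = j at h
  cases h <;> rfl

theorem RuleData.edgeType_target (h : RuleData r e j e' (P.next e') ψ) :
    P.edgeType e' = r.target := by
  unfold PCPrograph.edgeType
  generalize P.next e' = j' at h
  cases h <;> rfl

theorem exists_ruleData_of_source (he : e ≠ .prod P.root) (h : P.edgeType e = r.source) :
    ∃ e' j' ψ, RuleData r e (P.next e) e' j' ψ := by
  have ne := P.owner_ne he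
  unfold PCPrograph.edgeType at h
  generalize P.next e = j at h ne
  rcases e with x | x | x <;> rcases j with y | y | y <;> cases r <;> cases h
  · exact ⟨_, _, _, .IIItoVII x y⟩
  · exact ⟨_, _, _, .IVtoI x y fun h => ne (h ▸ rfl)⟩
  · exact ⟨_, _, _, .VIItoV y x⟩
  · exact ⟨_, _, _, .VIIItoIX y x fun h => ne (h ▸ rfl)⟩

theorem exists_ruleData_of_target (he : e ≠ .prod P.root) (h : P.edgeType e = r.target) :
    ∃ e₀ j₀ ψ, RuleData r e₀ j₀ e (P.next e) ψ := by
  have ne := P.owner_ne he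
  unfold PCPrograph.edgeType at h
  generalize P.next e = j at h ne
  rcases e with x | x | x <;> rcases j with y | y | y <;> cases r <;> cases h
  · exact ⟨_, _, _, .IVtoI x y fun h => ne (h ▸ rfl)⟩
  · exact ⟨_, _, _, .VIItoV x y⟩
  · exact ⟨_, _, _, .IIItoVII y x⟩
  · exact ⟨_, _, _, .VIIItoIX y x fun h => ne (h ▸ rfl)⟩

end Rotations

/-! ### Flips of wires in either direction. -/

section Relabellings

variable {C Pr : Type u} {next next' : Out C Pr ≃ Inp C Pr} {e e' : Out C Pr}
  {ψ : Equiv.Perm (Port C Pr)}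

theorem TwoTriangles.opp {D : Type*} {f o : Equiv.Perm D} {d : D} (h : TwoTriangles f o d) :
    TwoTriangles f o (o d) := by
  obtain ⟨⟨n1, n2, n3, n4, n5⟩, -⟩ := h.ne
  refine ⟨h.opp_opp, ?_, h.face_ne, h.face_face_face, ?_, ?_⟩ <;> rw [h.opp_opp]
  exacts [n3, n4, n5]

/-- The wires `next'` arise from `next` by a flip of the edge dual to `e`, with `e'` dual to the new
diagonal; `ψ` sends each side of a triangle after the flip to the same side before it. -/
structure Relabelling (next next' : Out C Pr ≃ Inp C Pr) (e e' : Out C Pr)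
    (ψ : Equiv.Perm (Port C Pr)) : Prop where
  two : TwoTriangles (Port.turn C Pr) (Port.wire next) (.inl e)
  flip : FlipEqs (Port.turn C Pr) (Port.wire next) (.inl e) (Port.turn C Pr) ψ.symm
  wire : ∀ a, ψ (Port.wire next' a) = Port.wire next (ψ a)
  isRight : ∀ a, a ≠ .inl e' → a ≠ .inr (next' e') → (ψ a).isRight = a.isRight
  edge : ψ.symm (.inl e) = .inl e' ∨ ψ.symm (.inl e) = .inr (next' e')

namespace Relabelling

theorem wire_symm (h : Relabelling next next' e e' ψ) (a : Port C Pr) :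
    Port.wire next' (ψ.symm a) = ψ.symm (Port.wire next a) := by
  rw [Equiv.eq_symm_apply, h.wire, Equiv.apply_symm_apply]

theorem of_ruleData {r : Rule} {j j' : Inp C Pr} (h : RuleData r e j e' j' ψ) (hj : next e = j)
    (hc : ∀ a, ψ (Port.wire next' a) = Port.wire next (ψ a)) : Relabelling next next' e e' ψ := by
  have hj' := h.next_eq hj hc
  refine ⟨h.twoTriangles hj, h.flipEqs hj, hc, hj' ▸ h.isRight_apply, ?_⟩
  rw [Equiv.symm_apply_eq, Equiv.symm_apply_eq, hj']
  rcases h.apply_edge with ⟨h1, h2⟩ | ⟨h1, h2⟩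
  · exact .inl h1.symm
  · exact .inr h2.symm

open Classical in
theorem exists_symm (h : Relabelling next next' e e' ψ) :
    ∃ ψ', Relabelling next' next e' e ψ' ∧
      (ψ'.symm (.inl e')).isRight = !(ψ.symm (.inl e)).isRight ∧
      ∀ a, a ≠ .inl e → a ≠ .inr (next e) → ψ' a = ψ.symm a := by
  have hedge := h.edge
  have e1 := h.wire_symm (.inl e)
  rw [Port.wire_inl] at e1
  have ends : (ψ.symm (.inl e) = .inl e' ∧ ψ.symm (.inr (next e)) = .inr (next' e')) ∨
      (ψ.symm (.inl e) = .inr (next' e') ∧ ψ.symm (.inr (next e)) = .inl e') := by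
    rcases hedge with h1 | h1 <;> rw [h1] at e1
    · exact .inl ⟨h1, e1.symm⟩
    · rw [Port.wire_inr, Equiv.symm_apply_apply] at e1
      exact .inr ⟨h1, e1.symm⟩
  -- The inverse of `ψ` is corrected by the half turn of the diagonal; hence exactly one of the two
  -- flips makes the followed dart positive.
  have sw : ∀ a, a ≠ .inl e → a ≠ .inr (next e) →
      Equiv.swap (.inl e : Port C Pr) (.inr (next e)) a = a := fun a =>
    Equiv.swap_apply_of_ne_of_ne
  have swap_symm : ∀ a, ((ψ.symm.symm.trans
      (Equiv.swap (.inl e : Port C Pr) (.inr (next e)))).symm) a =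
      ψ.symm (Equiv.swap (.inl e : Port C Pr) (.inr (next e)) a) := fun a => by
    simp
  have flip' := h.flip.symm h.two h.wire_symm
  have two' := h.flip.twoTriangles h.two h.wire_symm Port.turn_ne Port.turn_turn_turn
  refine ⟨(ψ.symm.symm.trans (Equiv.swap (.inl e : Port C Pr) (.inr (next e)))).symm,
    ⟨?_, ?_, ?_, ?_, ?_⟩, ?_, ?_⟩
  · rcases ends with ⟨h1, h2⟩ | ⟨h1, h2⟩
    · rwa [h1] at two'
    · have := two'.opp
      rwa [h1, Port.wire_inr, Equiv.symm_apply_apply] at this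
  · rw [Equiv.symm_symm]
    rcases ends with ⟨h1, h2⟩ | ⟨h1, h2⟩
    · rwa [h1] at flip'
    · have := flip'.opp (Port.wire_wire _)
      rwa [h1, Port.wire_inr, Equiv.symm_apply_apply] at this
  · intro a
    rw [swap_symm, swap_symm, h.wire_symm]
    congr 1
    by_cases a1 : a = .inl e
    · rw [a1, Port.wire_inl, Equiv.swap_apply_right, Equiv.swap_apply_left, Port.wire_inr,
        Equiv.symm_apply_apply]
    by_cases a2 : a = .inr (next e)
    · rw [a2, Port.wire_inr, Equiv.symm_apply_apply, Equiv.swap_apply_right,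
        Equiv.swap_apply_left, Port.wire_inl]
    rw [sw a a1 a2, sw]
    · intro h
      apply a2
      rw [← Port.wire_wire next a, h, Port.wire_inl]
    · intro h
      apply a1
      rw [← Port.wire_wire next a, h, Port.wire_inr, Equiv.symm_apply_apply]
  · intro a a1 a2
    rw [swap_symm, sw a a1 a2]
    have := h.isRight (ψ.symm a)
    rw [Equiv.apply_symm_apply] at this
    refine (this ?_ ?_).symm <;> intro h' <;> rcases ends with ⟨h1, h2⟩ | ⟨h1, h2⟩
    · exact a1 (ψ.symm.injective (h'.trans h1.symm))
    · exact a2 (ψ.symm.injective (h'.trans h2.symm))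
    · exact a2 (ψ.symm.injective (h'.trans h2.symm))
    · exact a1 (ψ.symm.injective (h'.trans h1.symm))
  · rw [Equiv.symm_symm]
    simp only [Equiv.trans_apply, Equiv.symm_symm]
    rcases ends with ⟨h1, h2⟩ | ⟨h1, h2⟩
    · rw [← h1, Equiv.apply_symm_apply, Equiv.swap_apply_left]; simp
    · rw [← h2, Equiv.apply_symm_apply, Equiv.swap_apply_right]; simp
  · rw [Equiv.symm_symm]
    simp only [Equiv.trans_apply, Equiv.symm_symm]
    rcases ends with ⟨h1, h2⟩ | ⟨h1, h2⟩
    · rw [h1]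
      nth_rewrite 1 [← h1]
      rw [Equiv.apply_symm_apply, Equiv.swap_apply_left]; rfl
    · rw [h1]
      nth_rewrite 1 [← h2]
      rw [Equiv.apply_symm_apply, Equiv.swap_apply_right]; rfl
  · intro a a1 a2
    rw [swap_symm, sw a a1 a2]

end Relabelling

end Relabellings

/-! ### When a flip gives the dual of a prograph. -/

section Existence

variable {C Pr : Type u}

theorem PCPrograph.exists_dual_on_ports (P : PCPrograph C Pr) :
    ∃ T : Triangulation (Port C Pr), (∀ a, T.face a = Port.turn C Pr a) ∧
      (∀ a, T.opp a = Port.wire P.next a) ∧ (∀ a, T.pos a ↔ a.isRight = true) ∧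
      T.opp T.root = .inl (.prod P.root) := by
  obtain ⟨T, δ, hδ⟩ := P.exists_dual (Equiv.refl (Port C Pr))
  refine ⟨T, fun a => ?_, fun a => ?_, fun a => ?_, ?_⟩
  · simpa [hδ] using (δ.dart_turn a).symm
  · simpa [hδ] using (δ.dart_wire a).symm
  · simpa [hδ] using δ.pos_iff a
  · simpa [hδ] using δ.opp_root

/-- Otherwise the dual edge of the right output of `x` would leave the sink. This keeps the virtual
edge out of the rule III to VII. -/
theorem PCPrograph.ne_root_of_left_right {P : PCPrograph C Pr} {x : C} {y : Pr}
    (h : P.next (.left x) = .right y) : y ≠ P.root := by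
  rintro rfl
  obtain ⟨T, hf, ho, hp, hr⟩ := P.exists_dual_on_ports
  have e1 : T.origin (.inl (.left x)) = T.origin (T.opp T.root) := by
    have := T.origin_opp (.inr (.right P.root))
    rw [ho, Port.wire_inr, ← h, Equiv.symm_apply_apply, h, hf] at this
    rw [hr]
    exact this
  have e2 := T.adj_of_neg (d := .inl (.right x)) (by rw [hp]; simp)
  rw [hf] at e2
  exact T.not_adj_sink _ (e1 ▸ e2)

/-- Otherwise the dual edge of the left output of `x` would enter the source. This keeps the virtual
edge out of the reverse of VII to V. -/
theorem PCPrograph.ne_root_of_right_left {P : PCPrograph C Pr} {x : C} {y : Pr}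
    (h : P.next (.right x) = .left y) : y ≠ P.root := by
  rintro rfl
  obtain ⟨T, hf, ho, hp, hr⟩ := P.exists_dual_on_ports
  have e1 : T.origin (.inl (.left x)) = T.origin T.root := by
    have h1 := T.origin_opp (.inl (.right x))
    have h2 := T.origin_opp (.inl (.prod P.root))
    rw [ho, hf, Port.wire_inl, h] at h1
    rw [← hr, T.opp_opp, hr, hf] at h2
    exact h1.symm.trans h2.symm
  have e2 := T.adj_of_neg (d := .inl (.left x)) (by rw [hp]; simp)
  exact T.not_adj_source _ (e1 ▸ e2)

variable {P : PCPrograph C Pr} {next' : Out C Pr ≃ Inp C Pr} {e e' : Out C Pr} {r : Rule}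
  {j j' : Inp C Pr} {ψ : Equiv.Perm (Port C Pr)}

theorem RuleData.target_ne_root (h : RuleData r e (P.next e) e' j' ψ) (he : e ≠ .prod P.root) :
    e' ≠ .prod P.root := by
  generalize hj : P.next e = j at h
  cases h with
  | IVtoI x y h => simp
  | VIIItoIX y z h => exact he
  | IIItoVII x y =>
    intro h
    exact P.ne_root_of_left_right hj (by simpa using h)
  | VIItoV x y => simp

theorem RuleData.source_ne_root (h : RuleData r e' j' e (P.next e) ψ) (he : e ≠ .prod P.root) :
    e' ≠ .prod P.root := by
  generalize hj : P.next e = j at h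
  cases h with
  | IVtoI x y h => simp
  | VIIItoIX y z h => exact he
  | IIItoVII x y => simp
  | VIItoV x y =>
    intro h
    exact P.ne_root_of_right_left hj (by simpa using h)

theorem RuleData.apply_prod (h : RuleData r e j e' j' ψ) {p : Pr} (h1 : e ≠ .prod p)
    (h2 : e' ≠ .prod p) : ψ (.inl (.prod p)) = .inl (.prod p) := by
  cases h with
  | IVtoI x y h => exact fourCycle_of_ne (by simp) (by simp) (by simp) (by simp)
  | VIIItoIX y z h => exact fourCycle_of_ne (by simp) (by simp) (by simp) (by simp)
  | IIItoVII x y =>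
    exact fourCycle_of_ne (by simp) (by simp) (fun h => h2 (Sum.inl_injective h).symm) (by simp)
  | VIItoV x y =>
    exact fourCycle_of_ne (fun h => h1 (Sum.inl_injective h).symm) (by simp) (by simp) (by simp)

/-- Whether a rotation makes the dart of the flipped edge positive. -/
def Rule.reversesDart : Rule → Bool
  | .IVtoI => false
  | .VIIItoIX => false
  | .IIItoVII => true
  | .VIItoV => true

theorem RuleData.isRight_symm (h : RuleData r e j e' j' ψ) :
    (ψ.symm (.inl e)).isRight = r.reversesDart := by
  cases h with
  | IVtoI x y h =>
    rw [fourCycle_symm_fth (by simpa using h.symm) (by simp) (by simp)]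
    rfl
  | VIIItoIX y z h =>
    rw [fourCycle_symm_of_ne (by simp) (by simp) (by simp) (by simp)]
    rfl
  | IIItoVII x y =>
    rw [fourCycle_symm_snd (by simp) (by simp) (by simp)]
    rfl
  | VIItoV x y =>
    rw [fourCycle_symm_fst]
    rfl

theorem exists_relabelling_of_source (he : e ≠ .prod P.root) (h : P.edgeType e = r.source) :
    ∃ next' e' j' ψ, RuleData r e (P.next e) e' j' ψ ∧ Relabelling P.next next' e e' ψ ∧
      (ψ.symm (.inl e)).isRight = r.reversesDart ∧
      ψ (.inl (.prod P.root)) = .inl (.prod P.root) ∧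
      ∀ P' : PCPrograph C Pr, P'.next = next' → P'.root = P.root → Rotates r P e P' e' := by
  obtain ⟨e', j', ψ, hd⟩ := exists_ruleData_of_source he h
  obtain ⟨next', -, hc⟩ := Port.exists_relabelled (e' := e') (j' := j') (ψ := ψ) P.next
    hd.isRight_apply (by
      rcases hd.apply_edge with ⟨h1, h2⟩ | ⟨h1, h2⟩ <;> rw [h1, h2] <;> simp)
  have he' := hd.target_ne_root he
  refine ⟨next', e', j', ψ, hd, .of_ruleData hd rfl hc, hd.isRight_symm, hd.apply_prod he he', ?_⟩
  rintro P' rfl hr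
  exact rotates_iff.2 ⟨hr, he, hr ▸ he', j', ψ, hd, hc⟩

/-- The wires before the rotation are obtained by conjugating with `φ.symm`. As a relabelling, this
needs the half turn of `Relabelling.exists_symm`, so `ψ` agrees with `φ.symm` only away from the
edge. -/
theorem exists_relabelling_of_target (he : e ≠ .prod P.root) (h : P.edgeType e = r.target) :
    ∃ next' e' ψ φ, RuleData r e' (next' e') e (P.next e) φ ∧ Relabelling P.next next' e e' ψ ∧
      (ψ.symm (.inl e)).isRight = !r.reversesDart ∧
      ψ (.inl (.prod P.root)) = .inl (.prod P.root) ∧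
      (∀ a, a ≠ .inl e' → a ≠ .inr (next' e') → ψ a = φ.symm a) ∧
      ∀ P' : PCPrograph C Pr, P'.next = next' → P'.root = P.root → Rotates r P' e' P e := by
  obtain ⟨e₀, j₀, φ, hd⟩ := exists_ruleData_of_target he h
  have ends := hd.apply_edge
  have he₀ := hd.source_ne_root he
  obtain ⟨next₀, hn, hc⟩ := Port.exists_relabelled (e' := e₀) (j' := j₀) (ψ := φ.symm) P.next
    (fun a a1 a2 => by
      have := hd.isRight_apply (φ.symm a)
      rw [Equiv.apply_symm_apply] at this
      refine (this ?_ ?_).symm <;> rw [ne_eq, Equiv.symm_apply_eq] <;> intro h' <;>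
        rcases ends with ⟨h1, h2⟩ | ⟨h1, h2⟩ <;> simp_all)
    (by
      rcases ends with ⟨h1, h2⟩ | ⟨h1, h2⟩ <;> rw [← h1, ← h2] <;> simp)
  have hc' : ∀ a, φ (Port.wire P.next a) = Port.wire next₀ (φ a) := fun a => by
    rw [← Equiv.eq_symm_apply, hc, Equiv.symm_apply_apply]
  subst hn
  obtain ⟨ψ, h1, h2, h3⟩ := (Relabelling.of_ruleData hd rfl hc').exists_symm
  refine ⟨next₀, e₀, ψ, φ, hd, h1, by rw [h2, hd.isRight_symm], ?_, h3, ?_⟩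
  · rw [h3 _ (by simpa using he₀.symm) (by simp), Equiv.symm_apply_eq, hd.apply_prod he₀ he]
  · rintro P' rfl hr
    exact rotates_iff.2 ⟨hr.symm, hr ▸ he₀, he, _, φ, hd, hc'⟩

theorem Relabelling.isSphereMap (h : Relabelling P.next next' e e' ψ) :
    IsSphereMap (Port.turn C Pr) (Port.wire next') :=
  h.flip.isSphereMap h.two h.wire_symm rfl P.planar

theorem Relabelling.isRight_symm (h : Relabelling P.next next' e e' ψ) {a : Port C Pr}
    (h1 : a ≠ .inl e) (h2 : a ≠ .inr (P.next e)) : (ψ.symm a).isRight = a.isRight := by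
  have := h.isRight (ψ.symm a)
  rw [Equiv.apply_symm_apply] at this
  have e1 := h.wire_symm (.inl e)
  rw [Port.wire_inl] at e1
  refine (this ?_ ?_).symm <;> intro h' <;> rcases h.edge with h3 | h3 <;> rw [h3] at e1
  · exact h1 (ψ.symm.injective (h'.trans h3.symm))
  · rw [Port.wire_inr, Equiv.symm_apply_apply] at e1
    exact h2 (ψ.symm.injective (h'.trans e1))
  · exact h2 (ψ.symm.injective (h'.trans e1))
  · exact h1 (ψ.symm.injective (h'.trans h3.symm))

theorem Relabelling.isRight_symm_next (h : Relabelling P.next next' e e' ψ) :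
    (ψ.symm (.inr (P.next e))).isRight = !(ψ.symm (.inl e)).isRight := by
  have e1 := h.wire_symm (.inl e)
  rw [Port.wire_inl] at e1
  rcases h.edge with h3 | h3 <;> rw [h3] at e1 ⊢ <;> rw [← e1] <;> rfl

/-- If the new diagonal joins two vertices that are already comparable, and the removed edge is
neither the only edge into its end nor the only edge out of its origin, then the flip gives the dual
of a prograph. -/
theorem Relabelling.exists_prograph (h : Relabelling P.next next' e e' ψ) (he : e ≠ .prod P.root)
    (hroot : ψ (.inl (.prod P.root)) = .inl (.prod P.root))
    {T : Triangulation (Port C Pr)} (hf : ∀ a, T.face a = Port.turn C Pr a)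
    (ho : ∀ a, T.opp a = Port.wire P.next a) (hp : ∀ a, T.pos a ↔ a.isRight = true)
    (hr : T.opp T.root = .inl (.prod P.root))
    (hin : ∃ d, T.pos d ∧ d ≠ .inr (P.next e) ∧ T.origin (T.opp d) = T.origin (.inl e))
    (hout : ∃ d, T.pos d ∧ d ≠ .inr (P.next e) ∧ T.origin d = T.origin (T.opp (.inl e)))
    (hlt : (ψ.symm (.inl e)).isRight = true → Relation.TransGen T.Adj
      (T.origin (T.face (T.face (T.opp (.inl e))))) (T.origin (T.face (T.face (.inl e)))))
    (hlt' : (ψ.symm (.inl e)).isRight = false → Relation.TransGen T.Adj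
      (T.origin (T.face (T.face (.inl e)))) (T.origin (T.face (T.face (T.opp (.inl e)))))) :
    ∃ P' : PCPrograph C Pr, P'.next = next' ∧ P'.root = P.root := by
  have hF : T.face = Port.turn C Pr := Equiv.ext hf
  have hO : T.opp = Port.wire P.next := Equiv.ext ho
  have hflip : FlipEqs T.face T.opp (.inl e) (Port.turn C Pr) ψ.symm := by rw [hF, hO]; exact h.flip
  have htwo : TwoTriangles T.face T.opp (.inl e) := by rw [hF, hO]; exact h.two
  have hopp : T.opp (.inl e) = .inr (P.next e) := ho _
  have hwire : ∀ a, Port.wire next' (ψ.symm a) = ψ.symm (T.opp a) := by rw [hO]; exact h.wire_symm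
  obtain ⟨k, k1, k2, k3⟩ := hflip.exists_vertex_equiv htwo hwire
  rw [hopp] at k1 k3
  let V := Quotient (Equiv.Perm.SameCycle.setoid (vertexPerm (Port.turn C Pr) (Port.wire next')))
  let org : Port C Pr → V := Quotient.mk _
  have kx : ∀ x, x ≠ .inl e → x ≠ .inr (P.next e) → k (org (ψ.symm x)) = T.origin x := k1
  have ka : k (org (ψ.symm (.inl e))) = T.origin (T.face (T.face (T.opp (.inl e)))) := k2
  have kb : k (org (ψ.symm (.inr (P.next e)))) = T.origin (T.face (T.face (.inl e))) := k3
  have pos_ne : ∀ d, T.pos d → d ≠ .inl e := by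
    rintro d hd rfl
    simp [hp] at hd
  have opp_ne : ∀ d, d ≠ .inl e → d ≠ .inr (P.next e) →
      T.opp d ≠ .inl e ∧ T.opp d ≠ .inr (P.next e) := fun d h1 h2 =>
    ⟨fun h => h2 (by rw [← hopp, ← h, T.opp_opp]), fun h => h1 (T.opp.injective (h.trans hopp.symm))⟩
  -- Each new edge corresponds to a directed path of `T`: an old edge, or the path assumed along the
  -- new diagonal. This carries acyclicity over and forbids edges into the source or out of the
  -- sink.
  have hstep : ∀ d', d'.isRight = true →
      Relation.TransGen T.Adj (k (org d')) (k (org (Port.wire next' d'))) := by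
    intro d' hd'
    obtain ⟨x, rfl⟩ := ψ.symm.surjective d'
    rw [hwire]
    by_cases x1 : x = .inl e
    · rw [x1] at hd' ⊢
      rw [hopp, ka, kb]
      exact hlt hd'
    by_cases x2 : x = .inr (P.next e)
    · rw [x2] at hd' ⊢
      rw [← hopp, T.opp_opp, hopp, ka, kb]
      refine hlt' ?_
      rwa [h.isRight_symm_next, Bool.not_eq_true'] at hd'
    rw [h.isRight_symm x1 x2, ← hp] at hd'
    rw [kx x x1 x2, kx _ (opp_ne x x1 x2).1 (opp_ne x x1 x2).2]
    exact .single ⟨x, hd', rfl, rfl⟩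
  have root_ne : T.root ≠ .inr (P.next e) := by
    intro h
    rw [h, ← hopp, T.opp_opp] at hr
    exact he (Sum.inl_injective hr)
  have hroot' : (.inr (next' (.prod P.root)) : Port C Pr) = ψ.symm T.root := by
    rw [← T.opp_opp T.root, ← hwire, hr, ← hroot, Equiv.symm_apply_apply, Port.wire_inl]
  have hopproot' : (.inl (.prod P.root) : Port C Pr) = ψ.symm (T.opp T.root) := by
    rw [hr, Equiv.eq_symm_apply, hroot]
  have kroot : k (org (.inr (next' (.prod P.root)))) = T.origin T.root := by
    rw [hroot', kx _ (pos_ne _ T.pos_root) root_ne]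
  have kopp : k (org (.inl (.prod P.root))) = T.origin (T.opp T.root) := by
    have := opp_ne _ (pos_ne _ T.pos_root) root_ne
    rw [hopproot', kx _ this.1 this.2]
  have no_in : ∀ v, ¬ Relation.TransGen T.Adj v (T.origin T.root) := fun v hv => by
    obtain ⟨w, -, hw⟩ := Relation.TransGen.tail'_iff.1 hv
    exact T.not_adj_source _ hw
  have no_out : ∀ v, ¬ Relation.TransGen T.Adj (T.origin (T.opp T.root)) v := fun v hv => by
    obtain ⟨w, hw, -⟩ := Relation.TransGen.head'_iff.1 hv
    exact T.not_adj_sink _ hw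
  let T' : Triangulation (Port C Pr) :=
    { finite := T.finite
      face := Port.turn C Pr
      opp := Port.wire next'
      opp_opp := Port.wire_wire next'
      opp_ne := by rintro (q | i) <;> simp
      triangle := fun a => ⟨Port.turn_turn_turn a, Port.turn_ne a⟩
      sphere := h.isSphereMap
      pos := fun a => a.isRight = true
      pos_opp := by rintro (q | i) <;> simp
      root := .inr (next' (.prod P.root))
      pos_root := rfl
      acyclic := fun v hv => by
        refine T.acyclic_adj (k v) (Relation.TransGen.lift' k ?_ _ _ hv)
        rintro _ _ ⟨d, hd, rfl, rfl⟩
        exact hstep d hd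
      source_iff := fun v => by
        constructor
        · intro hv
          apply k.injective
          refine Eq.trans ?_ kroot.symm
          by_contra hne
          -- The edge entering `k v` may be the one removed by the flip; then `hin` supplies
          -- another.
          obtain ⟨w, d, hd, -, hdv⟩ := T.exists_adj_of_ne_source hne
          obtain ⟨d, hd, hd2, hdv⟩ : ∃ d, T.pos d ∧ d ≠ .inr (P.next e) ∧
              T.origin (T.opp d) = k v := by
            by_cases hde : d = .inr (P.next e)
            · obtain ⟨d', h1, h2, h3⟩ := hin
              refine ⟨d', h1, h2, ?_⟩
              rw [h3, ← hdv, hde, ← hopp, T.opp_opp]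
            · exact ⟨d, hd, hde, hdv⟩
          have hd1 := pos_ne d hd
          refine hv (ψ.symm d) ?_ (k.injective ?_)
          · rw [h.isRight_symm hd1 hd2, ← hp]
            exact hd
          · rw [hwire]
            exact (kx _ (opp_ne d hd1 hd2).1 (opp_ne d hd1 hd2).2).trans hdv
        · rintro rfl d hd hdv
          have := hstep d hd
          rw [show org (Port.wire next' d) = org (.inr (next' (.prod P.root))) from hdv, kroot]
            at this
          exact no_in _ this
      sink_iff := fun v => by
        have hw : Port.wire next' (.inr (next' (.prod P.root))) = .inl (.prod P.root) := by simp
        rw [hw]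
        constructor
        · intro hv
          apply k.injective
          refine Eq.trans ?_ kopp.symm
          by_contra hne
          obtain ⟨w, d, hd, hdv, -⟩ := T.exists_adj_of_ne_sink hne
          obtain ⟨d, hd, hd2, hdv⟩ : ∃ d, T.pos d ∧ d ≠ .inr (P.next e) ∧
              T.origin d = k v := by
            by_cases hde : d = .inr (P.next e)
            · obtain ⟨d', h1, h2, h3⟩ := hout
              refine ⟨d', h1, h2, ?_⟩
              rw [h3, ← hdv, hde, ← hopp]
            · exact ⟨d, hd, hde, hdv⟩
          have hd1 := pos_ne d hd
          refine hv (ψ.symm d) ?_ (k.injective ?_)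
          · rw [h.isRight_symm hd1 hd2, ← hp]
            exact hd
          · exact (kx _ hd1 hd2).trans hdv
        · rintro rfl d hd hdv
          have := hstep d hd
          rw [show org d = org (.inl (.prod P.root)) from hdv, kopp] at this
          exact no_out _ this }
  obtain ⟨P', -, h1, h2, -⟩ := T'.exists_predual (Equiv.refl _) next' P.root (fun _ => rfl)
    (fun _ => rfl) (fun _ => by simp [T']) (fun _ => by simp [T']) rfl
  exact ⟨P', h1, h2⟩

end Existence

/-! ### Existence of the results of rotations and reverse rotations. -/

section RotationExistence

variable {C Pr : Type u} {P : PCPrograph C Pr} {next' : Out C Pr ≃ Inp C Pr} {e e' : Out C Pr}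
  {r : Rule} {ψ : Equiv.Perm (Port C Pr)}

/-- The conditions concern the four sides of the quadrilateral: one side enters the end of the
removed edge (`h1`), one leaves its origin (`h2`), and two form a directed path parallel to the new
diagonal (`h3`, `h4`). -/
theorem Relabelling.exists_prograph_of_signs (h : Relabelling P.next next' e e' ψ)
    (he : e ≠ .prod P.root) (hroot : ψ (.inl (.prod P.root)) = .inl (.prod P.root))
    (h1 : (Port.turn C Pr (Port.turn C Pr (.inl e))).isRight = true ∨
      (Port.turn C Pr (.inr (P.next e))).isRight = false)
    (h2 : (Port.turn C Pr (.inl e)).isRight = true ∨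
      (Port.turn C Pr (Port.turn C Pr (.inr (P.next e)))).isRight = false)
    (h3 : (ψ.symm (.inl e)).isRight = true →
      ((Port.turn C Pr (.inr (P.next e))).isRight = false ∧
        (Port.turn C Pr (Port.turn C Pr (.inl e))).isRight = false) ∨
      ((Port.turn C Pr (Port.turn C Pr (.inr (P.next e)))).isRight = true ∧
        (Port.turn C Pr (.inl e)).isRight = true))
    (h4 : (ψ.symm (.inl e)).isRight = false →
      ((Port.turn C Pr (Port.turn C Pr (.inl e))).isRight = true ∧
        (Port.turn C Pr (.inr (P.next e))).isRight = true) ∨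
      ((Port.turn C Pr (.inl e)).isRight = false ∧
        (Port.turn C Pr (Port.turn C Pr (.inr (P.next e)))).isRight = false)) :
    ∃ P' : PCPrograph C Pr, P'.next = next' ∧ P'.root = P.root := by
  obtain ⟨T, hf, ho, hp, hr⟩ := P.exists_dual_on_ports
  have htwo := h.two
  rw [← (Equiv.ext hf : T.face = _), ← (Equiv.ext ho : T.opp = _)] at htwo
  obtain ⟨⟨n1, n2, n3, n4, n5⟩, ⟨n6, n7, n8, n9⟩, ⟨n10, n11, n12⟩, ⟨n13, n14⟩, n15⟩ := htwo.ne
  have hopp : T.opp (.inl e) = .inr (P.next e) := ho _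
  have hn : ∀ a, ¬ T.pos a ↔ a.isRight = false := fun a => by rw [hp]; simp
  generalize hs : (ψ.symm (.inl e)).isRight = s at h3 h4
  simp only [← hp, ← hn, ← hopp, ← hf] at h1 h2 h3 h4
  have o1 := T.origin_opp (.inl e)
  have o2 := T.origin_opp (T.opp (.inl e))
  rw [T.opp_opp] at o2
  have o3 := T.origin_opp (T.face (T.face (.inl e)))
  have o4 := T.origin_opp (T.face (T.opp (.inl e)))
  have o5 := T.origin_opp (T.face (T.face (T.opp (.inl e))))
  rw [T.face_face_face] at o3 o5
  have opp_ne : ∀ d, d ≠ .inl e → T.opp d ≠ T.opp (.inl e) := fun d hd h => hd (T.opp.injective h)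
  refine h.exists_prograph he hroot hf ho hp hr ?_ ?_ (fun hs' => ?_) (fun hs' => ?_)
  · rw [← hopp]
    rcases h1 with h1 | h1
    · exact ⟨_, h1, n10, o3⟩
    · exact ⟨_, (T.pos_opp _).2 h1, opp_ne _ n4.symm, by rw [T.opp_opp, o2]⟩
  · rw [← hopp]
    rcases h2 with h2 | h2
    · exact ⟨_, h2, n7, o1.symm⟩
    · exact ⟨_, (T.pos_opp _).2 h2, opp_ne _ n5.symm, o5⟩
  · rcases h3 (hs.symm.trans hs') with ⟨a1, a2⟩ | ⟨a1, a2⟩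
    · have b1 := T.adj_of_neg a1
      have b2 := T.adj_of_neg a2
      rw [T.face_face_face, o2] at b2
      exact (Relation.TransGen.single b1).tail b2
    · have b1 := T.adj_of_pos a1
      have b2 := T.adj_of_pos a2
      rw [T.face_face_face, o1] at b1
      exact (Relation.TransGen.single b1).tail b2
  · rcases h4 (hs.symm.trans hs') with ⟨a1, a2⟩ | ⟨a1, a2⟩
    · have b1 := T.adj_of_pos a1
      have b2 := T.adj_of_pos a2
      rw [T.face_face_face, o2] at b1
      exact (Relation.TransGen.single b1).tail b2
    · have b1 := T.adj_of_neg a1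
      have b2 := T.adj_of_neg a2
      rw [T.face_face_face, o1] at b2
      exact (Relation.TransGen.single b1).tail b2

/-- At a coproduct standing on the output of a product, the order of the two operators can be
reversed. -/
theorem Relabelling.exists_prograph_of_prod_cop (h : Relabelling P.next next' e e' ψ)
    (he : e ≠ .prod P.root) (hroot : ψ (.inl (.prod P.root)) = .inl (.prod P.root))
    {x : C} {y : Pr} (hex : e = .prod y) (hey : P.next e = .cop x)
    (h1 : e'.owner = .inl x) (h2 : (next' e').owner = .inr y)
    (h3 : ∀ q, q ≠ e' → ((q.owner = .inl x ∨ q.owner = .inr y) ∧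
      Port.owner (ψ (.inl q)) = .inl x) ∨
      (q.owner ≠ .inl x ∧ q.owner ≠ .inr y ∧ ψ (.inl q) = .inl q))
    (h4 : ∀ i, i ≠ next' e' → ((i.owner = .inl x ∨ i.owner = .inr y) ∧
      Port.owner (ψ (.inr i)) = .inr y) ∨
      (i.owner ≠ .inl x ∧ i.owner ≠ .inr y ∧ ψ (.inr i) = .inr i)) :
    ∃ P' : PCPrograph C Pr, P'.next = next' ∧ P'.root = P.root := by
  classical
  have hyx : P.Arc (.inr y) (.inl x) := ⟨e, he, by rw [hex]; rfl, by rw [hey]; rfl⟩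
  -- Afterwards the edge goes from `x` to `y`, and before from `y` to `x`. The other outputs of the
  -- pair belonged to `x` and the other inputs to `y`, so, after the exchange, each new arc becomes
  -- a nonempty path of `P`, lengthened where necessary by the arc from `y` to `x`.
  let τ : Equiv.Perm (C ⊕ Pr) := Equiv.swap (.inl x) (.inr y)
  have τx : τ (.inl x) = .inr y := Equiv.swap_apply_left _ _
  have τy : τ (.inr y) = .inl x := Equiv.swap_apply_right _ _
  have τo : ∀ o, o ≠ .inl x → o ≠ .inr y → τ o = o := fun o => Equiv.swap_apply_of_ne_of_ne
  have out : ∀ q, q ≠ e' → Relation.ReflTransGen P.Arc (τ q.owner) (Port.owner (ψ (.inl q))) := by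
    intro q hq
    rcases h3 q hq with ⟨h | h, h'⟩ | ⟨h, h', h''⟩
    · rw [h, h', τx]; exact .single hyx
    · rw [h, h', τy]
    · rw [h'', τo _ h h']; rfl
  have inp : ∀ i, i ≠ next' e' →
      Relation.ReflTransGen P.Arc (Port.owner (ψ (.inr i))) (τ i.owner) := by
    intro i hi
    rcases h4 i hi with ⟨h | h, h'⟩ | ⟨h, h', h''⟩
    · rw [h, h', τx]
    · rw [h, h', τy]; exact .single hyx
    · rw [h'', τo _ h h']; rfl
  have step : ∀ q, q ≠ .prod P.root → Relation.TransGen P.Arc (τ q.owner) (τ (next' q).owner) := by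
    intro q hq
    by_cases hqe : q = e'
    · rw [hqe, h1, h2, τx, τy]
      exact .single hyx
    · have hne : next' q ≠ next' e' := fun h => hqe (next'.injective h)
      have hs := h.isRight (.inl q) (by simpa) (by simp)
      have hw := h.wire (.inl q)
      have a1 := out q hqe
      have a2 := inp _ hne
      rw [Port.wire_inl] at hw
      rw [hw] at a2
      rcases hψ : ψ (.inl q) with q₀ | i
      · rw [hψ] at a1 a2
        have hq₀ : q₀ ≠ .prod P.root := by
          rintro rfl
          rw [← hroot] at hψ
          exact hq (Sum.inl_injective (ψ.injective hψ))
        exact Relation.TransGen.trans_left (Relation.TransGen.trans_right a1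
          (.single (P.arc_of_ne hq₀))) a2
      · rw [hψ] at hs
        simp at hs
  refine ⟨{ next := next', root := P.root, finite_cop := P.finite_cop
            finite_prod := P.finite_prod, root_next := ?_, acyclic := ?_
            planar := h.isSphereMap }, rfl, rfl⟩
  · obtain ⟨c, hc⟩ := P.root_next
    have hw := h.wire (.inl (.prod P.root))
    rw [Port.wire_inl, hroot, Port.wire_inl, hc] at hw
    refine ⟨c, ?_⟩
    -- The inputs of the pair other than the end of `e'` were inputs of the product `y`, whereas the
    -- virtual edge enters a coproduct.
    rcases h4 (next' (.prod P.root)) (fun h => by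
      have := next'.injective h
      rw [← this] at h1
      simp [Out.owner] at h1) with ⟨-, h⟩ | ⟨-, -, h⟩
    · rw [hw] at h
      simp [Inp.owner] at h
    · exact Sum.inr_injective (h.symm.trans hw)
  · intro o ho
    refine P.acyclic_arc (τ o) (Relation.TransGen.lift' τ ?_ _ _ ho)
    rintro _ _ ⟨q, hq, rfl, rfl⟩
    exact step q hq

/-- Only VII to V fails the sign conditions: when a coproduct stands on a product, no two sides of
the quadrilateral form a path parallel to the new diagonal. -/
theorem exists_rotates_of_source (he : e ≠ .prod P.root) (h : P.edgeType e = r.source) :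
    ∃ (P' : PCPrograph C Pr) (e' : Out C Pr) (ψ : _), Rotates r P e P' e' ∧
      Relabelling P.next P'.next e e' ψ ∧ (ψ.symm (.inl e)).isRight = r.reversesDart ∧
      ψ (.inl (.prod P.root)) = .inl (.prod P.root) := by
  obtain ⟨next', e', j', ψ, hd, hR, hs, hroot, hrot⟩ := exists_relabelling_of_source he h
  suffices h : ∃ P' : PCPrograph C Pr, P'.next = next' ∧ P'.root = P.root by
    obtain ⟨P', h1, h2⟩ := h
    exact ⟨P', e', ψ, hrot P' h1 h2, h1 ▸ hR, hs, hroot⟩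
  have hj' := hd.next_eq rfl hR.wire
  by_cases hr : r = .VIItoV
  · subst hr
    generalize hj : P.next e = j at hd
    cases hd with | VIItoV x y =>
    refine hR.exists_prograph_of_prod_cop he hroot rfl hj rfl (by rw [hj']; rfl) (fun q hq => ?_)
      (fun i hi => ?_)
    · rcases q with c | c | p
      · by_cases hc : c = x
        · left
          rw [hc, fourCycle_of_ne (by simp) (by simp) (by simp) (by simp)]
          exact ⟨.inl rfl, rfl⟩
        · exact .inr ⟨by simpa [Out.owner], by simp [Out.owner],
            fourCycle_of_ne (by simp) (by simp) (by simp) (by simp)⟩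
      · have hc : c ≠ x := fun h => hq (h ▸ rfl)
        exact .inr ⟨by simpa [Out.owner], by simp [Out.owner],
          fourCycle_of_ne (by simp) (by simpa) (by simp) (by simp)⟩
      · by_cases hp : p = y
        · left
          rw [hp, fourCycle_fst (by simp) (by simp) (by simp)]
          exact ⟨.inr rfl, rfl⟩
        · exact .inr ⟨by simp [Out.owner], by simpa [Out.owner],
            fourCycle_of_ne (by simpa) (by simp) (by simp) (by simp)⟩
    · rw [hj'] at hi
      rcases i with c | p | p
      · by_cases hc : c = x
        · left
          rw [hc, fourCycle_trd (by simp) (by simp) (by simp)]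
          exact ⟨.inl rfl, rfl⟩
        · exact .inr ⟨by simpa [Inp.owner], by simp [Inp.owner],
            fourCycle_of_ne (by simp) (by simp) (by simpa) (by simp)⟩
      · have hp : p ≠ y := fun h => hi (h ▸ rfl)
        exact .inr ⟨by simp [Inp.owner], by simpa [Inp.owner],
          fourCycle_of_ne (by simp) (by simp) (by simp) (by simpa)⟩
      · by_cases hp : p = y
        · left
          rw [hp, fourCycle_of_ne (by simp) (by simp) (by simp) (by simp)]
          exact ⟨.inr rfl, rfl⟩
        · exact .inr ⟨by simp [Inp.owner], by simpa [Inp.owner],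
            fourCycle_of_ne (by simp) (by simp) (by simp) (by simp)⟩
  · refine hR.exists_prograph_of_signs he hroot ?_ ?_ ?_ ?_ <;> try rw [hs]
    all_goals
      generalize P.next e = j at hd
      cases hd <;> simp_all [Port.turn, Rule.reversesDart]

/-- Here the exceptional case is the reverse of III to VII, which also starts at an edge of type
VII. -/
theorem exists_rotates_of_target (he : e ≠ .prod P.root) (h : P.edgeType e = r.target) :
    ∃ (P' : PCPrograph C Pr) (e' : Out C Pr) (ψ : _), Rotates r P' e' P e ∧
      Relabelling P.next P'.next e e' ψ ∧ (ψ.symm (.inl e)).isRight = (!r.reversesDart) ∧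
      ψ (.inl (.prod P.root)) = .inl (.prod P.root) := by
  obtain ⟨next', e', ψ, φ, hd, hR, hs, hroot, hψ, hrot⟩ := exists_relabelling_of_target he h
  suffices h : ∃ P' : PCPrograph C Pr, P'.next = next' ∧ P'.root = P.root by
    obtain ⟨P', h1, h2⟩ := h
    exact ⟨P', e', ψ, hrot P' h1 h2, h1 ▸ hR, hs, hroot⟩
  by_cases hr : r = .IIItoVII
  · subst hr
    generalize hj : P.next e = j at hd
    generalize hj' : next' e' = j' at hd
    cases hd with | IIItoVII x y =>
    refine hR.exists_prograph_of_prod_cop he hroot rfl hj rfl (by rw [hj']; rfl) (fun q hq => ?_)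
      (fun i hi => ?_)
    · rw [hψ _ (by simpa) (by simp)]
      rcases q with c | c | p
      · have hc : c ≠ x := fun h => hq (h ▸ rfl)
        exact .inr ⟨by simpa [Out.owner], by simp [Out.owner],
          fourCycle_symm_of_ne (by simp) (by simpa) (by simp) (by simp)⟩
      · by_cases hc : c = x
        · left
          rw [hc, fourCycle_symm_of_ne (by simp) (by simp) (by simp) (by simp)]
          exact ⟨.inl rfl, rfl⟩
        · exact .inr ⟨by simpa [Out.owner], by simp [Out.owner],
            fourCycle_symm_of_ne (by simp) (by simp) (by simp) (by simp)⟩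
      · by_cases hp : p = y
        · left
          rw [hp, fourCycle_symm_trd (by simp) (by simp) (by simp)]
          exact ⟨.inr rfl, rfl⟩
        · exact .inr ⟨by simp [Out.owner], by simpa [Out.owner],
            fourCycle_symm_of_ne (by simp) (by simp) (by simpa) (by simp)⟩
    · rw [hψ _ (by simp) (by simpa)]
      rw [hj'] at hi
      rcases i with c | p | p
      · by_cases hc : c = x
        · left
          rw [hc, fourCycle_symm_fst]
          exact ⟨.inl rfl, rfl⟩
        · exact .inr ⟨by simpa [Inp.owner], by simp [Inp.owner],
            fourCycle_symm_of_ne (by simpa) (by simp) (by simp) (by simp)⟩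
      · by_cases hp : p = y
        · left
          rw [hp, fourCycle_symm_of_ne (by simp) (by simp) (by simp) (by simp)]
          exact ⟨.inr rfl, rfl⟩
        · exact .inr ⟨by simp [Inp.owner], by simpa [Inp.owner],
            fourCycle_symm_of_ne (by simp) (by simp) (by simp) (by simp)⟩
      · have hp : p ≠ y := fun h => hi (h ▸ rfl)
        exact .inr ⟨by simp [Inp.owner], by simpa [Inp.owner],
          fourCycle_symm_of_ne (by simp) (by simp) (by simp) (by simpa)⟩
  · refine hR.exists_prograph_of_signs he hroot ?_ ?_ ?_ ?_ <;> try rw [hs]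
    all_goals
      generalize P.next e = j at hd
      generalize next' e' = j' at hd
      cases hd <;> simp_all [Port.turn, Rule.reversesDart]

end RotationExistence

/-! ### Rotations give flips; counting vertices. -/

section FlipDuality

namespace Triangulation

variable {D : Type u} (T : Triangulation D)

theorem ne_of_adj {v w : T.Vertex} (h : T.Adj v w) : v ≠ w := by
  rintro rfl
  exact T.acyclic_adj v (.single h)

theorem origin_ne_face (d : D) : T.origin d ≠ T.origin (T.face d) := by
  by_cases h : T.pos d
  · exact T.ne_of_adj (T.adj_of_pos h)
  · exact (T.ne_of_adj (T.adj_of_neg h)).symm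

theorem origin_ne_face_face (d : D) : T.origin d ≠ T.origin (T.face (T.face d)) := by
  have := T.origin_ne_face (T.face (T.face d))
  rw [T.face_face_face] at this
  exact this.symm

/-- A triangle glued to itself would have two equal corners, hence a loop among its sides. -/
theorem twoTriangles (d : D) : TwoTriangles T.face T.opp d := by
  refine ⟨T.opp_opp, T.opp_ne d, fun x => (T.triangle x).2, T.face_face_face, fun h => ?_,
    fun h => ?_⟩
  · have := T.origin_opp (T.opp d)
    rw [T.opp_opp, h] at this
    exact T.origin_ne_face_face d this
  · have := T.origin_opp d
    rw [h] at this
    exact T.origin_ne_face (T.face d) this.symm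

end Triangulation

theorem FlipEqs.conj {D D' E E' : Type*} {f o : Equiv.Perm D} {d : D} {f' : Equiv.Perm D'}
    {g : D ≃ D'} (h : FlipEqs f o d f' g) {F O : Equiv.Perm E} {F' : Equiv.Perm E'} (e₁ : D ≃ E)
    (e₂ : D' ≃ E') (hf : ∀ x, e₁ (f x) = F (e₁ x)) (ho : ∀ x, e₁ (o x) = O (e₁ x))
    (hf' : ∀ x, e₂ (f' x) = F' (e₂ x)) :
    FlipEqs F O (e₁ d) F' (e₁.symm.trans (g.trans e₂)) := by
  obtain ⟨h1, h2, h3, h4, h5, h6, h7⟩ := h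
  simp only [FlipEqs, ← hf, ← ho, Equiv.trans_apply, Equiv.symm_apply_apply, ← hf', h1, h2, h3, h4,
    h5, h6, true_and]
  intro x
  obtain ⟨x, rfl⟩ := e₁.surjective x
  intro e1 e2 e3 e4 e5 e6
  have i : ∀ y, e₁ x ≠ e₁ y → x ≠ y := fun y e e' => e (congrArg e₁ e')
  rw [← hf, Equiv.symm_apply_apply, Equiv.symm_apply_apply,
    h7 x (i _ e1) (i _ e2) (i _ e3) (i _ e4) (i _ e5) (i _ e6)]

theorem FlipEqs.exists_common {D D₁ D₂ : Type*} {f o : Equiv.Perm D} {d : D} {f₁ : Equiv.Perm D₁}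
    {g₁ : D ≃ D₁} {f₂ : Equiv.Perm D₂} {g₂ : D ≃ D₂} (h₁ : FlipEqs f o d f₁ g₁)
    (h₂ : FlipEqs f o d f₂ g₂) (x : D) : ∃ y, f₁ (g₁ x) = g₁ y ∧ f₂ (g₂ x) = g₂ y := by
  obtain ⟨a1, a2, a3, a4, a5, a6, a7⟩ := h₁
  obtain ⟨b1, b2, b3, b4, b5, b6, b7⟩ := h₂
  by_cases e1 : x = d
  · rw [e1]; exact ⟨_, a1, b1⟩
  by_cases e2 : x = f d
  · rw [e2]; exact ⟨_, a6, b6⟩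
  by_cases e3 : x = f (f d)
  · rw [e3]; exact ⟨_, a2, b2⟩
  by_cases e4 : x = o d
  · rw [e4]; exact ⟨_, a4, b4⟩
  by_cases e5 : x = f (o d)
  · rw [e5]; exact ⟨_, a3, b3⟩
  by_cases e6 : x = f (f (o d))
  · rw [e6]; exact ⟨_, a5, b5⟩
  exact ⟨_, a7 x e1 e2 e3 e4 e5 e6, b7 x e1 e2 e3 e4 e5 e6⟩

/-- The two corners opposite to the old diagonal are distinct because the new diagonal is not a
loop; the other pairs are ends of sides of `T`. -/
theorem nodup_of_flipEqs {D D' : Type u} {T : Triangulation D} {T' : Triangulation D'} {d : D}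
    {g : D ≃ D'} (h : FlipEqs T.face T.opp d T'.face g) (ho : ∀ x, T'.opp (g x) = g (T.opp x)) :
    [T.origin d, T.origin (T.opp d), T.origin (T.face (T.face d)),
      T.origin (T.face (T.face (T.opp d)))].Nodup := by
  obtain ⟨k, -, k2, k3⟩ := h.exists_vertex_equiv (T.twoTriangles d) ho
  have e1 := T.origin_opp d
  have e2 := T.origin_opp (T.opp d)
  rw [T.opp_opp] at e2
  have n1 : T.origin d ≠ T.origin (T.opp d) := by rw [e1]; exact T.origin_ne_face d
  have n2 := T.origin_ne_face_face d
  have n3 : T.origin d ≠ T.origin (T.face (T.face (T.opp d))) := by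
    rw [e2]; exact T.origin_ne_face _
  have n4 : T.origin (T.opp d) ≠ T.origin (T.face (T.face d)) := by
    rw [e1]; exact T.origin_ne_face _
  have n5 := T.origin_ne_face_face (T.opp d)
  have n6 : T.origin (T.face (T.face d)) ≠ T.origin (T.face (T.face (T.opp d))) := by
    intro h
    have h' := T'.origin_ne_face (g d)
    rw [← T'.origin_opp, ho] at h'
    exact h' (k.injective (k2.trans (h.symm.trans k3.symm)))
  simp [n1, n2, n3, n4, n5, n6]

variable {C Pr D D' : Type u} {P P' : PCPrograph C Pr} {T : Triangulation D} {T' : Triangulation D'}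
  {e e' : Out C Pr} {d' : D'}

theorem Rotates.exists_relabelling {r : Rule} (h : Rotates r P e P' e') :
    ∃ ψ, Relabelling P.next P'.next e e' ψ ∧ ψ (.inl (.prod P.root)) = .inl (.prod P.root) := by
  obtain ⟨hr, he, he', j', ψ, hd, hc⟩ := rotates_iff.1 h
  exact ⟨ψ, .of_ruleData hd rfl hc, hd.apply_prod he (hr ▸ he')⟩

theorem RotationStep.exists_relabelling (h : RotationStep P e P' e') :
    e ≠ .prod P.root ∧ P'.root = P.root ∧ ∃ ψ, Relabelling P.next P'.next e e' ψ ∧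
      ψ (.inl (.prod P.root)) = .inl (.prod P.root) := by
  obtain ⟨r, h | h⟩ := h
  · obtain ⟨hr, he, he', -⟩ := rotates_iff.1 h
    exact ⟨he, hr, h.exists_relabelling⟩
  · obtain ⟨hr, he', he, -⟩ := rotates_iff.1 h
    obtain ⟨φ, h1, h2⟩ := h.exists_relabelling
    obtain ⟨ψ, h3, -, h4⟩ := h1.exists_symm
    refine ⟨he, hr.symm, ψ, h3, ?_⟩
    rw [hr, h4 _ (by simpa using he'.symm) (by simp), Equiv.symm_apply_eq, h2]

/-- A rotation, or a reverse rotation, is a flip of the dual triangulation. -/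
theorem RotationStep.flip (h : RotationStep P e P' e') (δ : Duality P T) (δ' : Duality P' T')
    (hd' : d' = δ'.dart (.inl e') ∨ d' = T'.opp (δ'.dart (.inl e'))) :
    Flip T (δ.dart (.inl e)) T' d' := by
  obtain ⟨he, hr, ψ, hR, hroot⟩ := h.exists_relabelling
  let g : D ≃ D' := δ.dart.symm.trans (ψ.symm.trans δ'.dart)
  have gd : ∀ a, g (δ.dart a) = δ'.dart (ψ.symm a) := fun a => by simp [g]
  have hflip : FlipEqs T.face T.opp (δ.dart (.inl e)) T'.face g :=
    hR.flip.conj δ.dart δ'.dart δ.dart_turn δ.dart_wire δ'.dart_turn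
  have hopp : ∀ x, T'.opp (g x) = g (T.opp x) := fun x => by
    obtain ⟨a, rfl⟩ := δ.dart.surjective x
    rw [gd, ← δ.dart_wire, gd, ← δ'.dart_wire, hR.wire_symm]
  refine ⟨fun h => δ.pos_out e (h ▸ T.pos_root), fun h => ?_, nodup_of_flipEqs hflip hopp, g, ?_,
    hopp, ?_, fun x h1 h2 => ?_, hflip⟩
  · rw [δ.opp_root] at h
    exact he (Sum.inl_injective (δ.dart.injective h))
  · rw [← hopp, gd]
    rcases hR.edge with h1 | h1
    · rw [h1]
      exact hd'
    · rw [h1, ← δ'.dart_wire, Port.wire_inr, Equiv.symm_apply_apply]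
      rw [← δ'.dart_wire, Port.wire_inl] at hd'
      exact hd'.symm
  · rw [← T.opp_opp T.root, ← hopp, δ.opp_root, gd, ← hroot, Equiv.symm_apply_apply, ← hr,
      ← δ'.opp_root, T'.opp_opp]
  · obtain ⟨a, rfl⟩ := δ.dart.surjective x
    rw [gd, δ'.pos_iff, δ.pos_iff, hR.isRight_symm (fun h => h1 (h ▸ rfl))]
    rintro rfl
    rw [← δ.dart_wire] at h2
    exact h2 rfl

/-- At each vertex, all darts but `a` have the same sign, when there is only one change of sign. -/
theorem forall_or_eq_of_sameCycle [Finite D] {σ : Equiv.Perm D} {p : D → Prop} {a : D}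
    (h1 : p (σ a)) (h2 : ∀ x, σ.SameCycle a x → p x → ¬ p (σ x) → σ x = a) {x : D}
    (hx : σ.SameCycle a x) : p x ∨ x = a := by
  have key : ∀ n : ℕ, p ((σ ^ n) a) ∨ (σ ^ n) a = a := by
    intro n
    induction n with
    | zero => exact .inr rfl
    | succ n ih =>
      rw [pow_succ', Equiv.Perm.mul_apply]
      rcases ih with ih | ih
      · by_cases h : p (σ ((σ ^ n) a))
        · exact .inl h
        · exact .inr (h2 _ ⟨n, by simp⟩ ih h)
      · rw [ih]; exact .inl h1
  obtain ⟨n, -, rfl⟩ := hx.exists_pow_eq'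
  exact key n

theorem exists_change_of_sameCycle [Finite D] {σ : Equiv.Perm D} {p : D → Prop} {a b : D}
    (h : σ.SameCycle a b) (ha : p a) (hb : ¬ p b) : ∃ x, σ.SameCycle a x ∧ p x ∧ ¬ p (σ x) := by
  by_contra! hn
  have key : ∀ n : ℕ, p ((σ ^ n) a) := by
    intro n
    induction n with
    | zero => exact ha
    | succ n ih =>
      rw [pow_succ', Equiv.Perm.mul_apply]
      exact hn _ ⟨n, by simp⟩ ih
  obtain ⟨n, -, rfl⟩ := h.exists_pow_eq'
  exact hb (key n)

theorem Out.card [Finite C] [Finite Pr] : Nat.card (Out C Pr) = 2 * Nat.card C + Nat.card Pr := by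
  have e : Out C Pr ≃ C ⊕ C ⊕ Pr :=
    { toFun := fun q => match q with
        | .left c => .inl c | .right c => .inr (.inl c) | .prod p => .inr (.inr p)
      invFun := Sum.elim .left (Sum.elim .right .prod)
      left_inv := by rintro (c | c | p) <;> rfl
      right_inv := by rintro (c | c | p) <;> rfl }
  rw [Nat.card_congr e, Nat.card_sum, Nat.card_sum]
  ring

theorem Inp.card [Finite C] [Finite Pr] : Nat.card (Inp C Pr) = Nat.card C + 2 * Nat.card Pr := by
  have e : Inp C Pr ≃ C ⊕ Pr ⊕ Pr :=
    { toFun := fun q => match q with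
        | .cop c => .inl c | .left c => .inr (.inl c) | .right p => .inr (.inr p)
      invFun := Sum.elim .cop (Sum.elim .left .right)
      left_inv := by rintro (c | c | p) <;> rfl
      right_inv := by rintro (c | c | p) <;> rfl }
  rw [Nat.card_congr e, Nat.card_sum, Nat.card_sum]
  ring

theorem orbitCount_turn [Finite C] [Finite Pr] :
    orbitCount (Port.turn C Pr) = Nat.card C + Nat.card Pr := by
  obtain ⟨k, hk⟩ := exists_orbit_lift (f := Port.turn C Pr) Port.owner Port.owner_turn
  obtain ⟨l, hl⟩ := Port.exists_owner_lift
    (fun a => Quotient.mk (Equiv.Perm.SameCycle.setoid (Port.turn C Pr)) a) (mk_apply_eq _)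
  rw [← Nat.card_sum]
  refine Nat.card_congr ⟨k, l, fun q => ?_, fun o => ?_⟩
  · induction q using Quotient.inductionOn with | h a => rw [hk, hl]
  · obtain ⟨a, rfl⟩ : ∃ a : Port C Pr, Port.owner a = o := by
      rcases o with c | p
      exacts [⟨.inr (.cop c), rfl⟩, ⟨.inl (.prod p), rfl⟩]
    rw [hl, hk]

theorem orbitCount_wire (next : Out C Pr ≃ Inp C Pr) :
    orbitCount (Port.wire next) = Nat.card (Out C Pr) := by
  obtain ⟨k, hk⟩ := exists_orbit_lift (f := Port.wire next)
    (fun a => Sum.elim id next.symm a) (by rintro (q | i) <;> simp)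
  refine Nat.card_congr ⟨k, fun q => Quotient.mk _ (.inl q), fun q => ?_, fun q => ?_⟩
  · induction q using Quotient.inductionOn with | h a =>
    rw [hk]
    rcases a with q | i
    · rfl
    · exact mk_apply_eq (Port.wire next) (.inr i)
  · rw [hk]; rfl

theorem PCPrograph.card_cop_eq (P : PCPrograph C Pr) : Nat.card C = Nat.card Pr := by
  have := P.finite_cop
  have := P.finite_prod
  have := Nat.card_congr P.next
  rw [Out.card, Inp.card] at this
  omega

/-- With `n` products there are `n` coproducts, so `2n` triangles and `3n` edges; Euler's formula
gives the vertices. -/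
theorem Duality.card_vertex (δ : Duality P T) : Nat.card T.Vertex = Nat.card Pr + 2 := by
  have := P.finite_cop
  have := P.finite_prod
  have h1 := P.planar.2
  have h2 : orbitCount (Port.wire P.next * (Port.turn C Pr)⁻¹) = Nat.card T.Vertex :=
    orbitCount_congr (f' := vertexPerm T.face T.opp) δ.dart fun x => by
      obtain ⟨y, rfl⟩ := (Port.turn C Pr).surjective x
      rw [δ.dart_turn, vertexPerm_face, ← δ.dart_wire]
      simp
  rw [orbitCount_turn, orbitCount_wire, h2, Out.card] at h1
  have := P.card_cop_eq
  omega

/-- With the source and the sink added, `m` becomes a surjection between finite sets of equal size.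
-/
theorem injective_of_surjective_inner (δ : Duality P T) {A : Type u} (hA : Nat.card A = Nat.card Pr)
    [Finite A] (m : A → T.Vertex)
    (h : ∀ v, v ≠ T.origin T.root → v ≠ T.origin (T.opp T.root) → ∃ a, m a = v) :
    Function.Injective m := by
  classical
  have := T.finite_vertex
  have hne : T.origin T.root ≠ T.origin (T.opp T.root) := by
    rw [T.origin_opp]; exact T.origin_ne_face _
  let k : Option (Option A) → T.Vertex := fun a =>
    a.elim (T.origin T.root) fun a => a.elim (T.origin (T.opp T.root)) m
  have hk : Function.Surjective k := by
    intro v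
    by_cases h1 : v = T.origin T.root
    · exact ⟨none, h1.symm⟩
    by_cases h2 : v = T.origin (T.opp T.root)
    · exact ⟨some none, h2.symm⟩
    obtain ⟨a, ha⟩ := h v h1 h2
    exact ⟨some (some a), ha⟩
  have hc : Nat.card (Option (Option A)) = Nat.card T.Vertex := by
    rw [Finite.card_option, Finite.card_option, δ.card_vertex, hA]
  have := ((Nat.bijective_iff_surjective_and_card k).2 ⟨hk, hc⟩).1
  intro a b hab
  have := @this (some (some a)) (some (some b)) hab
  simpa using this

end FlipDuality

/-! ### Every valid flip comes from exactly one rotation or reverse rotation. -/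

section ValidFlips

variable {C Pr D D' : Type u} {P : PCPrograph C Pr} {T : Triangulation D} {T' : Triangulation D'}
  {e : Out C Pr} {d : D} {d' : D'}

theorem Duality.exists_left_of_pos (δ : Duality P T) {y : D} (h1 : T.pos y)
    (h2 : T.pos (T.face y)) : ∃ p, y = δ.dart (.inr (.left p)) := by
  obtain ⟨a, rfl⟩ := δ.dart.surjective y
  rw [← δ.dart_turn] at h2
  rw [δ.pos_iff] at h1 h2
  rcases a with ((c | c | p) | (c | p | p)) <;> simp [Port.turn] at h1 h2
  exact ⟨p, rfl⟩

theorem Duality.exists_right_of_neg (δ : Duality P T) {y : D} (h1 : ¬ T.pos y)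
    (h2 : ¬ T.pos (T.face y)) : ∃ c, y = δ.dart (.inl (.right c)) := by
  obtain ⟨a, rfl⟩ := δ.dart.surjective y
  rw [← δ.dart_turn] at h2
  rw [δ.pos_iff] at h1 h2
  rcases a with ((c | c | p) | (c | p | p)) <;> simp [Port.turn] at h1 h2
  exact ⟨c, rfl⟩

theorem Triangulation.origin_eq_iff {x y : D} :
    T.origin x = T.origin y ↔ (vertexPerm T.face T.opp).SameCycle x y :=
  Quotient.eq (r := Equiv.Perm.SameCycle.setoid (vertexPerm T.face T.opp))

/-- At each vertex there is at most one change from outgoing to incoming edges. -/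
theorem Duality.eq_of_pos_pos (δ : Duality P T) {y y' : D} (h1 : T.pos y) (h2 : T.pos (T.face y))
    (h1' : T.pos y') (h2' : T.pos (T.face y')) (h : T.origin (T.face y) = T.origin (T.face y')) :
    y = y' := by
  have := P.finite_prod
  have := T.finite
  obtain ⟨p, rfl⟩ := δ.exists_left_of_pos h1 h2
  obtain ⟨p', rfl⟩ := δ.exists_left_of_pos h1' h2'
  -- Around an inner vertex there are both outgoing and incoming darts, so some passage from
  -- outgoing to incoming occurs, and the triangle at it is a product. There are as many products as
  -- inner vertices.
  have hinj := injective_of_surjective_inner δ (A := Pr) rfl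
    (fun p => T.origin (T.face (δ.dart (.inr (.left p))))) (fun v hv hv' => by
      obtain ⟨w, x, hx, -, hxv⟩ := T.exists_adj_of_ne_source hv
      obtain ⟨w', x', hx', hxv', -⟩ := T.exists_adj_of_ne_sink hv'
      obtain ⟨z, hz, hz1, hz2⟩ := exists_change_of_sameCycle (p := T.pos)
        (T.origin_eq_iff.1 (hxv'.trans hxv.symm)) hx' (fun h => (T.pos_opp x).1 h hx)
      obtain ⟨y, rfl⟩ := T.face.surjective z
      rw [vertexPerm_face, T.pos_opp, not_not] at hz2
      obtain ⟨p, rfl⟩ := δ.exists_left_of_pos hz2 hz1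
      exact ⟨p, (T.origin_eq_iff.2 hz).symm.trans hxv'⟩)
  rw [hinj h]

/-- At each vertex there is at most one change from incoming to outgoing edges. -/
theorem Duality.eq_of_neg_neg (δ : Duality P T) {y y' : D} (h1 : ¬ T.pos y)
    (h2 : ¬ T.pos (T.face y)) (h1' : ¬ T.pos y') (h2' : ¬ T.pos (T.face y'))
    (h : T.origin (T.face y) = T.origin (T.face y')) : y = y' := by
  have := P.finite_cop
  have := T.finite
  obtain ⟨p, rfl⟩ := δ.exists_right_of_neg h1 h2
  obtain ⟨p', rfl⟩ := δ.exists_right_of_neg h1' h2'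
  have hinj := injective_of_surjective_inner δ (A := C) P.card_cop_eq
    (fun p => T.origin (T.face (δ.dart (.inl (.right p))))) (fun v hv hv' => by
      obtain ⟨w, x, hx, -, hxv⟩ := T.exists_adj_of_ne_source hv
      obtain ⟨w', x', hx', hxv', -⟩ := T.exists_adj_of_ne_sink hv'
      obtain ⟨z, hz, hz1, hz2⟩ := exists_change_of_sameCycle (p := fun x => ¬ T.pos x)
        (T.origin_eq_iff.1 (hxv.trans hxv'.symm)) (fun h => (T.pos_opp x).1 h hx) (not_not.2 hx')
      obtain ⟨y, rfl⟩ := T.face.surjective z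
      rw [vertexPerm_face, T.pos_opp, not_not] at hz2
      obtain ⟨p, rfl⟩ := δ.exists_right_of_neg hz2 hz1
      exact ⟨p, (T.origin_eq_iff.2 hz).symm.trans hxv⟩)
  rw [hinj h]

/-- A flip of the only edge into its end would create a source. -/
theorem Flip.exists_other_in (h : Flip T d T' d') (hd : ¬ T.pos d) :
    ∃ x, T.origin x = T.origin d ∧ ¬ T.pos x ∧ x ≠ d := by
  by_contra! hall
  obtain ⟨hr1, hr2, hnd, g, -, ho, hroot, hpos, hflip⟩ := h
  obtain ⟨k, k1, k2, k3⟩ := FlipEqs.exists_vertex_equiv hflip (T.twoTriangles d) ho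
  simp only [List.nodup_cons, List.mem_cons, List.not_mem_nil, or_false, not_or] at hnd
  obtain ⟨⟨n1, n2, n3⟩, -⟩ := hnd
  -- The new diagonal does not touch this corner, the corners being distinct, and all other darts
  -- keep their sign.
  have hsrc : ∀ x', T'.origin x' = k.symm (T.origin d) → T'.pos x' := by
    intro x' hx'
    obtain ⟨x, rfl⟩ := g.surjective x'
    rw [Equiv.eq_symm_apply] at hx'
    by_cases h1 : x = d
    · subst h1
      exact absurd (hx'.symm.trans k2) n3
    by_cases h2 : x = T.opp d
    · subst h2
      exact absurd (hx'.symm.trans k3) n2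
    rw [hpos x h1 h2]
    by_contra hn
    exact h1 (hall x ((k1 x h1 h2).symm.trans hx') hn)
  have hv := (T'.source_iff (k.symm (T.origin d))).1 (fun x' hx' h =>
    (T'.pos_opp x').1 (hsrc (T'.opp x') h) hx')
  rw [Equiv.symm_apply_eq, hroot] at hv
  have hv' : T.origin d = T.origin T.root := hv.trans (k1 T.root (Ne.symm hr1)
    (fun h => hr2 (by rw [h, T.opp_opp])))
  have := T.adj_of_neg hd
  rw [hv'] at this
  exact T.not_adj_source _ this

/-- A flip of the only edge out of its origin would create a sink. -/
theorem Flip.exists_other_out (h : Flip T d T' d') (hd : ¬ T.pos d) :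
    ∃ x, T.origin x = T.origin (T.opp d) ∧ T.pos x ∧ x ≠ T.opp d := by
  by_contra! hall
  obtain ⟨hr1, hr2, hnd, g, -, ho, hroot, hpos, hflip⟩ := h
  obtain ⟨k, k1, k2, k3⟩ := FlipEqs.exists_vertex_equiv hflip (T.twoTriangles d) ho
  simp only [List.nodup_cons, List.mem_cons, List.not_mem_nil, or_false, not_or] at hnd
  obtain ⟨⟨n1, n2, n3⟩, ⟨n4, n5⟩, -⟩ := hnd
  have hsnk : ∀ x', T'.origin x' = k.symm (T.origin (T.opp d)) → ¬ T'.pos x' := by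
    intro x' hx'
    obtain ⟨x, rfl⟩ := g.surjective x'
    rw [Equiv.eq_symm_apply] at hx'
    by_cases h1 : x = d
    · subst h1
      exact absurd (hx'.symm.trans k2) n5
    by_cases h2 : x = T.opp d
    · subst h2
      exact absurd (hx'.symm.trans k3) n4
    rw [hpos x h1 h2]
    exact fun hn => h2 (hall x ((k1 x h1 h2).symm.trans hx') hn)
  have hv := (T'.sink_iff (k.symm (T.origin (T.opp d)))).1 (fun x' hx' h => hsnk x' h hx')
  rw [Equiv.symm_apply_eq, hroot, ho] at hv
  have hv' : T.origin (T.opp d) = T.origin (T.opp T.root) :=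
    hv.trans (k1 (T.opp T.root) (Ne.symm hr2) (fun h => hr1 (T.opp.injective h.symm)))
  refine T.not_adj_sink (T.origin d) ⟨T.opp d, (T.pos_opp d).2 hd, hv', by rw [T.opp_opp]⟩

theorem Flip.edgeType_ne_II (δ : Duality P T) (h : Flip T (δ.dart (.inl e)) T' d') :
    P.edgeType e ≠ .II := by
  intro ht
  have := T.finite
  obtain ⟨x, hx, hxn, hxd⟩ := h.exists_other_in (δ.pos_out e)
  obtain ⟨c, p, rfl, hj⟩ : ∃ c p, e = .left c ∧ P.next e = .left p := by
    unfold PCPrograph.edgeType at ht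
    rcases e with c | c | c <;> rcases hj : P.next _ with p | p | p <;> rw [hj] at ht <;> cases ht
    exact ⟨c, p, rfl, rfl⟩
  have hopp : T.opp (δ.dart (.inl (.left c))) = δ.dart (.inr (.left p)) := by
    rw [← δ.dart_wire, Port.wire_inl, hj]
  have hface : T.face (δ.dart (.inr (.left p))) = δ.dart (.inr (.right p)) := by
    rw [← δ.dart_turn]; rfl
  have hface' : T.face (δ.dart (.inl (.right c))) = δ.dart (.inl (.left c)) := by
    rw [← δ.dart_turn]; rfl
  have horg := T.origin_opp (δ.dart (.inr (.left p)))
  rw [← hopp, T.opp_opp, hopp] at horg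
  -- Counterclockwise after the dart of `e`, the coproduct makes the next dart outgoing. The only
  -- passage back to incoming darts is the one at the product `p`, and it leads to the dart of `e`
  -- itself. So `e` is dual to the only edge into this vertex.
  rcases forall_or_eq_of_sameCycle (σ := vertexPerm T.face T.opp) (p := T.pos) (x := x) (by
    rw [← hface', vertexPerm_face, T.pos_opp]
    exact δ.pos_out _) (fun z hz h1 h2 => by
      obtain ⟨y, rfl⟩ := T.face.surjective z
      rw [vertexPerm_face, T.pos_opp, not_not] at h2
      rw [vertexPerm_face, δ.eq_of_pos_pos h2 h1 (δ.pos_inp (.left p))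
        (by rw [hface]; exact δ.pos_inp _) ((T.origin_eq_iff.2 hz).symm.trans horg), ← hopp,
        T.opp_opp]) (T.origin_eq_iff.1 hx.symm) with h' | h'
  · exact hxn h'
  · exact hxd h'

theorem Flip.edgeType_ne_VI (δ : Duality P T) (h : Flip T (δ.dart (.inl e)) T' d') :
    P.edgeType e ≠ .VI := by
  intro ht
  have := T.finite
  obtain ⟨x, hx, hxn, hxd⟩ := h.exists_other_out (δ.pos_out e)
  obtain ⟨c, p, rfl, hj⟩ : ∃ c p, e = .right c ∧ P.next e = .right p := by
    unfold PCPrograph.edgeType at ht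
    rcases e with c | c | c <;> rcases hj : P.next _ with p | p | p <;> rw [hj] at ht <;> cases ht
    exact ⟨c, p, rfl, rfl⟩
  have hopp : T.opp (δ.dart (.inl (.right c))) = δ.dart (.inr (.right p)) := by
    rw [← δ.dart_wire, Port.wire_inl, hj]
  have hface : T.face (δ.dart (.inl (.right c))) = δ.dart (.inl (.left c)) := by
    rw [← δ.dart_turn]; rfl
  have hface' : T.face (δ.dart (.inr (.left p))) = δ.dart (.inr (.right p)) := by
    rw [← δ.dart_turn]; rfl
  have horg := T.origin_opp (δ.dart (.inl (.right c)))
  -- The mirror argument at the origin: the product makes the next dart incoming, and the only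
  -- passage back to outgoing darts is the one at the coproduct.
  rcases forall_or_eq_of_sameCycle (σ := vertexPerm T.face T.opp) (p := fun x => ¬ T.pos x)
    (a := T.opp (δ.dart (.inl (.right c)))) (x := x) (by
    rw [hopp, ← hface', vertexPerm_face, T.pos_opp, not_not]
    exact δ.pos_inp _) (fun z hz h1 h2 => by
      obtain ⟨y, rfl⟩ := T.face.surjective z
      rw [vertexPerm_face, T.pos_opp, not_not] at h2
      rw [vertexPerm_face, δ.eq_of_neg_neg h2 h1 (δ.pos_out (.right c))
        (by rw [hface]; exact δ.pos_out _) ((T.origin_eq_iff.2 hz).symm.trans horg)])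
    (T.origin_eq_iff.1 hx.symm) with h' | h'
  · exact h' hxn
  · exact hxd h'

/-- A rotation, or a reverse rotation, with a given orientation of the new diagonal, unless this
orientation makes one of the two new triangles cyclic. -/
theorem exists_rotationStep_of_orientation (he : e ≠ .prod P.root) (h2 : P.edgeType e ≠ .II)
    (h6 : P.edgeType e ≠ .VI) (s : Bool)
    (n1 : ¬ (s = (Port.turn C Pr (Port.turn C Pr (.inl e))).isRight ∧
      s = (Port.turn C Pr (.inr (P.next e))).isRight))
    (n2 : ¬ ((!s) = (Port.turn C Pr (Port.turn C Pr (.inr (P.next e)))).isRight ∧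
      (!s) = (Port.turn C Pr (.inl e)).isRight)) :
    ∃ (P' : PCPrograph C Pr) (e' : Out C Pr) (ψ : _), RotationStep P e P' e' ∧
      Relabelling P.next P'.next e e' ψ ∧ (ψ.symm (.inl e)).isRight = s ∧
      ψ (.inl (.prod P.root)) = .inl (.prod P.root) ∧ P'.root = P.root := by
  -- The conditions leave one orientation for I, III, IV, V, VIII and IX, and both for VII, one for
  -- each rule there. They also leave both for II and VI, which is why these types need the global
  -- argument.
  have key : (∃ r : Rule, P.edgeType e = r.source ∧ s = r.reversesDart) ∨
      ∃ r : Rule, P.edgeType e = r.target ∧ s = !r.reversesDart := by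
    unfold PCPrograph.edgeType at h2 h6 ⊢
    generalize P.next e = j at h2 h6 n1 n2
    rcases e with c | c | c <;> rcases j with p | p | p <;> cases s <;>
      simp [Port.turn] at n1 n2 h2 h6 <;>
      first
      | exact .inl ⟨.IVtoI, rfl, rfl⟩
      | exact .inl ⟨.VIIItoIX, rfl, rfl⟩
      | exact .inl ⟨.IIItoVII, rfl, rfl⟩
      | exact .inl ⟨.VIItoV, rfl, rfl⟩
      | exact .inr ⟨.IVtoI, rfl, rfl⟩
      | exact .inr ⟨.VIIItoIX, rfl, rfl⟩
      | exact .inr ⟨.IIItoVII, rfl, rfl⟩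
      | exact .inr ⟨.VIItoV, rfl, rfl⟩
  rcases key with ⟨r, hr, rfl⟩ | ⟨r, hr, rfl⟩
  · obtain ⟨P', e', ψ, h1, h2, h3, h4⟩ := exists_rotates_of_source he hr
    exact ⟨P', e', ψ, ⟨r, .inl h1⟩, h2, h3, h4, (rotates_iff.1 h1).1⟩
  · obtain ⟨P', e', ψ, h1, h2, h3, h4⟩ := exists_rotates_of_target he hr
    exact ⟨P', e', ψ, ⟨r, .inr h1⟩, h2, h3, h4, (rotates_iff.1 h1).1.symm⟩

/-- A valid flip comes from a rotation or a reverse rotation. -/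
theorem Flip.exists_rotationStep (δ : Duality P T) (h : Flip T (δ.dart (.inl e)) T' d') :
    ∃ (P' : PCPrograph C Pr) (e' : Out C Pr), RotationStep P e P' e' ∧
      ∃ δ' : Duality P' T', d' = δ'.dart (.inl e') ∨ d' = T'.opp (δ'.dart (.inl e')) := by
  classical
  have h2 := h.edgeType_ne_II δ
  have h6 := h.edgeType_ne_VI δ
  obtain ⟨hr1, hr2, -, g, hd', ho, hroot, hpos, hflip⟩ := h
  change FlipEqs T.face T.opp (δ.dart (.inl e)) T'.face g at hflip
  have he : e ≠ .prod P.root := by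
    rintro rfl
    exact hr2 δ.opp_root.symm
  let G : Port C Pr ≃ D' := δ.dart.trans g
  have hG : ∀ a, T'.opp (G a) = G (Port.wire P.next a) := fun a => by
    simp only [G, Equiv.trans_apply, ho, δ.dart_wire]
  have hflipG : FlipEqs (Port.turn C Pr) (Port.wire P.next) (.inl e) T'.face G := by
    have := hflip.conj δ.dart.symm (Equiv.refl _) δ.symm_face δ.symm_opp (fun _ => rfl)
    rw [Equiv.symm_apply_apply] at this
    exact this
  have posG : ∀ a, a ≠ .inl e → a ≠ .inr (P.next e) → (T'.pos (G a) ↔ a.isRight = true) := by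
    intro a h1 h2
    rw [← δ.pos_iff]
    refine hpos _ (fun h => h1 (δ.dart.injective h)) (fun h => h2 ?_)
    rw [← δ.dart_wire] at h
    exact δ.dart.injective h
  have two : TwoTriangles (Port.turn C Pr) (Port.wire P.next) (.inl e) := by
    have := T.twoTriangles (δ.dart (.inl e))
    refine ⟨Port.wire_wire _, by simp, Port.turn_ne, Port.turn_turn_turn, fun h => ?_, fun h => ?_⟩
    · exact this.opp_ne_face (by rw [← δ.dart_wire, h, δ.dart_turn])
    · exact this.opp_ne_face_face (by rw [← δ.dart_wire, h, δ.dart_turn, δ.dart_turn])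
  obtain ⟨⟨m1, m2, m3, m4, m5⟩, ⟨m6, m7, m8, m9⟩, ⟨m10, m11, m12⟩, ⟨m13, m14⟩, m15⟩ := two.ne
  rw [Port.wire_inl] at *
  have hns : T'.pos (G (.inr (P.next e))) ↔ ¬ T'.pos (G (.inl e)) := by
    rw [← T'.pos_opp, hG, Port.wire_inl]
  obtain ⟨f1, f2, f3, f4, f5, f6, -⟩ := id hflipG
  rw [Port.wire_inl] at f2 f3 f4 f5 f6
  have t1 := T'.exists_neg_of_triangle (G (.inl e))
  have t2 := T'.exists_pos_of_triangle (G (.inl e))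
  have t3 := T'.exists_neg_of_triangle (G (.inr (P.next e)))
  have t4 := T'.exists_pos_of_triangle (G (.inr (P.next e)))
  rw [f1, f2, posG _ m2.symm m10, posG _ m4.symm m13.symm] at t1 t2
  rw [f4, f5, posG _ m5.symm m14.symm, posG _ m1.symm m7, hns] at t3 t4
  obtain ⟨P', e', ψ, hstep, hR, hs, hψ, hrt⟩ := exists_rotationStep_of_orientation he h2 h6
    (decide (T'.pos (G (.inl e)))) (by
      rintro ⟨c1, c2⟩
      rw [← c1, ← c2] at t1 t2
      by_cases hp : T'.pos (G (.inl e)) <;> simp [hp] at t1 t2) (by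
      rintro ⟨c1, c2⟩
      rw [← c1, ← c2] at t3 t4
      by_cases hp : T'.pos (G (.inl e)) <;> simp [hp] at t3 t4)
  have hposψ : ∀ a, T'.pos (G (ψ a)) ↔ a.isRight = true := by
    intro a
    obtain ⟨a, rfl⟩ := ψ.symm.surjective a
    rw [Equiv.apply_symm_apply]
    by_cases a1 : a = .inl e
    · rw [a1, hs]; simp
    by_cases a2 : a = .inr (P.next e)
    · rw [a2, hR.isRight_symm_next, hs, hns]; simp
    rw [hR.isRight_symm a1 a2, posG a a1 a2]
  -- The given flip and the rotation flip the same edge with the same orientation, so they have the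
  -- same faces, wires and signs once the darts are renamed by `ψ`.
  let δ' : Duality P' T' :=
    { dart := ψ.trans G
      dart_turn := fun a => by
        obtain ⟨a, rfl⟩ := ψ.symm.surjective a
        obtain ⟨y, hy1, hy2⟩ := hR.flip.exists_common hflipG a
        simp only [Equiv.trans_apply, Equiv.apply_symm_apply]
        rw [hy1, hy2, Equiv.apply_symm_apply]
      dart_wire := fun a => by
        simp only [Equiv.trans_apply]
        rw [hR.wire, hG]
      pos_out := fun q => by
        rw [Equiv.trans_apply, hposψ]; simp
      pos_inp := fun i => by
        rw [Equiv.trans_apply, hposψ]; rfl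
      dart_root := by
        have := hR.wire (.inl (.prod P.root))
        rw [Port.wire_inl] at this
        rw [Equiv.trans_apply, hrt, this, ← hG, hψ]
        simp only [G, Equiv.trans_apply]
        rw [← δ.opp_root, ← ho, T'.opp_opp, hroot] }
  have hδ : ∀ a, δ'.dart a = G (ψ a) := fun a => rfl
  refine ⟨P', e', hstep, δ', ?_⟩
  have hd2 : d' = G (.inl e) ∨ d' = T'.opp (G (.inl e)) := by
    rw [← ho] at hd'
    exact hd'
  rw [hδ]
  rcases hR.edge with h1 | h1 <;> rw [Equiv.symm_apply_eq] at h1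
  · rwa [← h1]
  · have := hR.wire (.inl e')
    rw [Port.wire_inl, ← h1] at this
    have h3 : ψ (.inl e') = Port.wire P.next (.inl e) := by rw [this, Port.wire_wire]
    rw [h3, ← hG, T'.opp_opp]
    exact hd2.symm

theorem Rotates.edgeType_source {r : Rule} {P' : PCPrograph C Pr} {e' : Out C Pr}
    (h : Rotates r P e P' e') : P.edgeType e = r.source := by
  obtain ⟨-, -, -, j', ψ, hd, hc⟩ := rotates_iff.1 h
  exact hd.edgeType_source

theorem Rotates.edgeType_target {r : Rule} {P' : PCPrograph C Pr} {e' : Out C Pr}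
    (h : Rotates r P e P' e') : P'.edgeType e' = r.target := by
  obtain ⟨-, -, -, j', ψ, hd, hc⟩ := rotates_iff.1 h
  have := hd.next_eq rfl hc
  subst this
  exact hd.edgeType_target

/-- Two prographs with the same dual differ by a relabelling, which cannot send a right output to a
left one. -/
theorem not_rotates_VII {P₁ P₂ : PCPrograph C Pr} {e₁ e₂ : Out C Pr}
    (h₁ : Rotates .VIItoV P e P₁ e₁) (h₂ : Rotates .IIItoVII P₂ e₂ P e) (δ₁ : Duality P₁ T')
    (δ₂ : Duality P₂ T') (h : δ₁.dart (.inl e₁) = δ₂.dart (.inl e₂)) : False := by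
  obtain ⟨-, -, -, x, y, -, rfl, -⟩ := h₁
  obtain ⟨-, -, -, x', y', rfl, -⟩ := h₂
  obtain ⟨f, g, hfg⟩ := δ₁.exists_relabelling δ₂ (Equiv.refl D') (fun _ => rfl) (fun _ => Iff.rfl)
  have := (hfg (.inl (.right x))).trans h
  have := δ₂.dart.injective this
  simp [Port.mapEquiv, Out.map] at this

/-- The type of `e` fixes both the rule and its direction, except for VII, which is the target of
one rule and the source of another. -/
theorem RotationStep.eq_of_dart_eq {P₁ P₂ : PCPrograph C Pr} {e₁ e₂ : Out C Pr}
    (h₁ : RotationStep P e P₁ e₁) (h₂ : RotationStep P e P₂ e₂) (δ₁ : Duality P₁ T')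
    (δ₂ : Duality P₂ T') (h : δ₁.dart (.inl e₁) = δ₂.dart (.inl e₂)) : P₁ = P₂ ∧ e₁ = e₂ := by
  obtain ⟨r₁, h₁ | h₁⟩ := h₁ <;> obtain ⟨r₂, h₂ | h₂⟩ := h₂
  · have := h₁.edgeType_source.symm.trans h₂.edgeType_source
    cases r₁ <;> cases r₂ <;> cases this <;> exact h₁.eq_of_source h₂
  · have := h₁.edgeType_source.symm.trans h₂.edgeType_target
    cases r₁ <;> cases r₂ <;> cases this
    exact (not_rotates_VII h₁ h₂ δ₁ δ₂ h).elim
  · have := h₁.edgeType_target.symm.trans h₂.edgeType_source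
    cases r₁ <;> cases r₂ <;> cases this
    exact (not_rotates_VII h₂ h₁ δ₂ δ₁ h.symm).elim
  · have := h₁.edgeType_target.symm.trans h₂.edgeType_target
    cases r₁ <;> cases r₂ <;> cases this <;> exact h₁.eq_of_target h₂

theorem Flip.existsUnique_rotationStep (δ : Duality P T) (h : Flip T (δ.dart (.inl e)) T' d') :
    ∃! q : PCPrograph C Pr × Out C Pr, RotationStep P e q.1 q.2 ∧
      ∃ δ' : Duality q.1 T', d' = δ'.dart (.inl q.2) ∨ d' = T'.opp (δ'.dart (.inl q.2)) := by
  obtain ⟨P₁, e₁, h₁, δ₁, hd₁⟩ := h.exists_rotationStep δ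
  refine ⟨(P₁, e₁), ⟨h₁, δ₁, hd₁⟩, ?_⟩
  rintro ⟨P₂, e₂⟩ ⟨h₂, δ₂, hd₂⟩
  dsimp only at h₂ δ₂ hd₂
  -- Of the two darts of the new diagonal, only the negative one lies at an output.
  have hd : δ₁.dart (.inl e₁) = δ₂.dart (.inl e₂) := by
    have p1 := δ₁.pos_out e₁
    have p2 := δ₂.pos_out e₂
    rcases hd₁ with h1 | h1 <;> rcases hd₂ with h2 | h2
    · rw [← h1, h2]
    · rw [← h1, h2, T'.pos_opp] at p1
      exact absurd p2 p1
    · rw [← h2, h1, T'.pos_opp] at p2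
      exact absurd p1 p2
    · exact T'.opp.injective (h1.symm.trans h2)
  obtain ⟨rfl, rfl⟩ := h₁.eq_of_dart_eq h₂ δ₁ δ₂ hd
  rfl

theorem exists_flip_of_rotationStep {P' : PCPrograph C Pr} {e' : Out C Pr} (δ : Duality P T)
    (h : RotationStep P e P' e') : ∃ (T' : Triangulation D) (d' : D),
      Flip T (δ.dart (.inl e)) T' d' := by
  obtain ⟨T', δ', -⟩ := P'.exists_dual δ.dart
  exact ⟨T', _, h.flip δ δ' (.inl rfl)⟩

theorem edgeType_iff_not_flip (δ : Duality P T) (he : e ≠ .prod P.root) :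
    (P.edgeType e = .II ∨ P.edgeType e = .VI) ↔
      ∀ (T' : Triangulation D) (d' : D), ¬ Flip T (δ.dart (.inl e)) T' d' := by
  constructor
  · rintro (h | h) T' d' hf
    · exact hf.edgeType_ne_II δ h
    · exact hf.edgeType_ne_VI δ h
  · intro h
    by_contra! hn
    have key : (∃ r : Rule, P.edgeType e = r.source) ∨ ∃ r : Rule, P.edgeType e = r.target := by
      obtain ⟨h2, h6⟩ := hn
      cases ht : P.edgeType e
      exacts [.inr ⟨.IVtoI, rfl⟩, absurd ht h2, .inl ⟨.IIItoVII, rfl⟩, .inl ⟨.IVtoI, rfl⟩,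
        .inr ⟨.VIItoV, rfl⟩, absurd ht h6, .inl ⟨.VIItoV, rfl⟩, .inl ⟨.VIIItoIX, rfl⟩,
        .inr ⟨.VIIItoIX, rfl⟩]
    rcases key with ⟨r, hr⟩ | ⟨r, hr⟩
    · obtain ⟨P', e', -, h1, -⟩ := exists_rotates_of_source he hr
      obtain ⟨T', d', hf⟩ := exists_flip_of_rotationStep δ ⟨r, .inl h1⟩
      exact h T' d' hf
    · obtain ⟨P', e', -, h1, -⟩ := exists_rotates_of_target he hr
      obtain ⟨T', d', hf⟩ := exists_flip_of_rotationStep δ ⟨r, .inr h1⟩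
      exact h T' d' hf

theorem existsUnique_rotates_iff {r : Rule} (he : e ≠ .prod P.root) :
    (P.edgeType e = r.source ↔ ∃! q : PCPrograph C Pr × Out C Pr, Rotates r P e q.1 q.2) ∧
      (P.edgeType e = r.target ↔
        ∃! q : PCPrograph C Pr × Out C Pr, Rotates r q.1 q.2 P e) := by
  refine ⟨⟨fun h => ?_, fun ⟨q, hq, _⟩ => hq.edgeType_source⟩,
    fun h => ?_, fun ⟨q, hq, _⟩ => hq.edgeType_target⟩
  · obtain ⟨P', e', -, h1, -⟩ := exists_rotates_of_source he h
    refine ⟨(P', e'), h1, fun q hq => ?_⟩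
    obtain ⟨h2, h3⟩ := h1.eq_of_source hq
    exact Prod.ext h2.symm h3.symm
  · obtain ⟨P', e', -, h1, -⟩ := exists_rotates_of_target he h
    refine ⟨(P', e'), h1, fun q hq => ?_⟩
    obtain ⟨h2, h3⟩ := h1.eq_of_target hq
    exact Prod.ext h2.symm h3.symm

end ValidFlips

theorem theorem2 :
    -- duality is a bijection, up to isomorphism, between PC prographs and rooted oriented
    -- triangulations of the sphere
    (∀ (C Pr : Type u) (P : PCPrograph C Pr),
      ∃ T : Triangulation (Port C Pr), Nonempty (Duality P T)) ∧
    (∀ (D : Type u) (T : Triangulation D),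
      ∃ (C Pr : Type u) (P : PCPrograph C Pr), Nonempty (Duality P T)) ∧
    (∀ (C Pr C' Pr' D D' : Type u) (P : PCPrograph C Pr) (P' : PCPrograph C' Pr')
      (T : Triangulation D) (T' : Triangulation D'),
      Nonempty (Duality P T) → Nonempty (Duality P' T') →
        (P.Isomorphic P' ↔ T.Isomorphic T')) ∧
    -- each rule applies at every edge of its source type other than the virtual edge, in one way,
    -- and can be reversed, in one way, at every such edge of its target type
    (∀ (C Pr : Type u) (P : PCPrograph C Pr) (e : Out C Pr) (r : Rule), e ≠ .prod P.root →
      (P.edgeType e = r.source ↔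
        ∃! q : PCPrograph C Pr × Out C Pr, Rotates r P e q.1 q.2) ∧
      (P.edgeType e = r.target ↔
        ∃! q : PCPrograph C Pr × Out C Pr, Rotates r q.1 q.2 P e)) ∧
    -- the rotations and their reverses at an edge are exactly the valid flips of the dual edge
    (∀ (C Pr D D' : Type u) (P : PCPrograph C Pr) (T : Triangulation D) (δ : Duality P T)
      (e : Out C Pr) (T' : Triangulation D') (d' : D'),
      (∀ (P' : PCPrograph C Pr) (e' : Out C Pr) (δ' : Duality P' T'),
        RotationStep P e P' e' →
        (d' = δ'.dart (.inl e') ∨ d' = T'.opp (δ'.dart (.inl e'))) →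
          Flip T (δ.dart (.inl e)) T' d') ∧
      (Flip T (δ.dart (.inl e)) T' d' →
        ∃! q : PCPrograph C Pr × Out C Pr, RotationStep P e q.1 q.2 ∧
          ∃ δ' : Duality q.1 T',
            d' = δ'.dart (.inl q.2) ∨ d' = T'.opp (δ'.dart (.inl q.2)))) ∧
    -- the edges without a valid flip are exactly those of types II and VI
    (∀ (C Pr D : Type u) (P : PCPrograph C Pr) (T : Triangulation D) (δ : Duality P T)
      (e : Out C Pr), e ≠ .prod P.root →
      ((P.edgeType e = .II ∨ P.edgeType e = .VI) ↔
        ∀ (T' : Triangulation D) (d' : D), ¬ Flip T (δ.dart (.inl e)) T' d')) := by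
  refine ⟨fun C Pr P => ?_, fun D T => T.exists_dual, ?_, ?_, ?_, ?_⟩
  · obtain ⟨T, δ, -⟩ := P.exists_dual (Equiv.refl _)
    exact ⟨T, ⟨δ⟩⟩
  · rintro C Pr C' Pr' D D' P P' T T' ⟨δ⟩ ⟨δ'⟩
    exact δ.isomorphic_iff δ'
  · intro C Pr P e r he
    exact existsUnique_rotates_iff he
  · intro C Pr D D' P T δ e T' d'
    exact ⟨fun P' e' δ' h hd => h.flip δ δ' hd, fun h => h.existsUnique_rotationStep δ⟩
  · intro C Pr D P T δ e he
    exact edgeType_iff_not_flip δ he
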